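/- Let $\mathbb T\subseteq\mathbb R$ be a time scale (a nonempty closed set) that contains $0$ and is unbounded above, with forward jump operator $\sigma$, graininess $\mu(t)=\sigma(t)-t$, $\Delta$-derivative $f^\Delta$ and $\Delta$-integral. For a locally $\Delta$-integrable function $f$ on $[0,\infty)\cap\mathbb T$ (real- or complex-valued), the generalized Laplace transform is $$\mathcal L_{\mathbb T}[f](z)=\int_0^\infty f(t)\,e_{\ominus z}(\sigma(t),0)\,\Delta t ,$$ for those $z\in\mathbb C$ for which $1+\mu(t)z\neq0$ on $\mathbb T$ and the improper integral exists; here $e_p(t,s)=\exp\int_s^t\xi_{\mu(\tau)}(p(\tau))\Delta\tau$ with $\xi_h(z)=\operatorname{Log}(1+hz)/h$ for $h\ne0$, $\xi_0(z)=z$, and $(\ominus z)(t)=-z/(1+\mu(t)z)$. We call $f$ transformable if $\mathcal L_{\mathbb T}[f](z)$ exists for all $z$ in some right half-plane. We write $g=\mathcal L_{\mathbb T}^{-1}[G]$ if $g$ is a transformable function with $\mathcal L_{\mathbb T}[g](z)=G(z)$ for all $z$ in some right half-plane. We write $f(0^+)$ for the limit of $f(t)$ as $t\to0^+$ in $\mathbb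 T$ if $0$ is right-dense, and for $f(0)$ if $0$ is right-scattered. Powers $z^\alpha$ are principal. For transformable $f$ with $F=\mathcal L_{\mathbb T}[f]$, the fractional integral of order $\alpha>0$ and the fractional derivative of order $\alpha\in(n-1,n]$, $n\in\mathbb N$, are $$I^\alpha_{\mathbb T}f=\mathcal L_{\mathbb T}^{-1}\!\left[\frac{F(z)}{z^\alpha}\right],\qquad f^{(\alpha)}=\mathcal L_{\mathbb T}^{-1}\!\left[z^\alpha F(z)-\sum_{k=0}^{n-1}f^{\Delta^k}(0^+)z^{\alpha-k-1}\right],$$ whenever the inverse transforms and the numbers $f^{\Delta^k}(0^+)$ exist (with $f$ being $n-1$ times $\Delta$-differentiable near $0$ in $[0,\infty)\cap\mathbb T$). Equality of functions below means equality at $\Delta$-almost every $t\in[0,\infty)\cap\mathbb T$, and also at every $t\in[0,\infty)\cap\mathbb T$ at which both sides are right-continuous along $\mathbb T$ (in particular at every right-scattered $t$); so it is equality everywhere on $[0,\infty)\cap\mathbb T$ for rd-continuous functions. **1.** Let $\alpha,\beta>0$ and suppose that $I^\alpha_{\mathbb T}f$ exists. Then $$I_{\mathbb T}^\beta(I_{\mathbb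 T}^\alpha f)=I_{\mathbb T}^{\alpha+\beta}f .$$ More precisely, a function is a fractional integral of order $\beta$ of $I_{\mathbb T}^\alpha f$ if and only if it is a fractional integral of order $\alpha+\beta$ of $f$, and any two such functions are equal. **2.** Let $\alpha,\beta\in(0,1]$. (a) Let $\alpha+\beta\le1$, and suppose that $f^{(\alpha)}$ and $f^{(\alpha)}(0^+)$ exist. If two of the three functions $(f^{(\alpha)})^{(\beta)}$, $f^{(\alpha+\beta)}$, $\mathcal L^{-1}_{\mathbb T}[z^{\beta-1}f^{(\alpha)}(0^+)]$ exist, then so does the third, and $$(f^{(\alpha)})^{(\beta)}=f^{(\alpha+\beta)}-\mathcal L^{-1}_{\mathbb T}\!\left[z^{\beta-1}f^{(\alpha)}(0^+)\right].$$ (b) Let $1<\alpha+\beta\le2$, and suppose that $f^{(\alpha)}$, $f^{(\alpha)}(0^+)$ and $f^\Delta(0^+)$ exist, with $f$ $\Delta$-differentiable near $0$ in $[0,\infty)\cap\mathbb T$. If $\mathcal L^{-1}_{\mathbb T}[z^{\beta-1}f^{(\alpha)}(0^+)]$ and $\mathcal L^{-1}_{\mathbb T}[z^{\alpha+\beta-2}f^{\Delta}(0^+)]$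 exist, then $(f^{(\alpha)})^{(\beta)}$ exists if and only if $f^{(\alpha+\beta)}$ exists, and in that case $$(f^{(\alpha)})^{(\beta)}=f^{(\alpha+\beta)}-\mathcal L^{-1}_{\mathbb T}\!\left[z^{\beta-1}f^{(\alpha)}(0^+)\right]+\mathcal L^{-1}_{\mathbb T}\!\left[z^{\alpha+\beta-2}f^{\Delta}(0^+)\right].$$ Moreover, whenever $(f^{(\alpha)})^{(\beta)}$ and $f^{(\alpha+\beta)}$ both exist, $f^{(\alpha+\beta)}-(f^{(\alpha)})^{(\beta)}=\mathcal L^{-1}_{\mathbb T}[z^{\beta-1}f^{(\alpha)}(0^+)-z^{\alpha+\beta-2}f^\Delta(0^+)]$. (c) Let $f$ be $\Delta$-differentiable at every $t\in[0,\infty)\cap\mathbb T$, with $f$ and $f^\Delta$ transformable. Then $$(f^\Delta)^{(\beta)}=f^{(\beta+1)} .$$ More precisely, a function is a fractional derivative of order $\beta$ of $f^\Delta$ if and only if it is a fractional derivative of order $\beta+1$ of $f$, and any two such functions are equal. -/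

import Mathlib

open Set Filter Topology MeasureTheory

namespace TimeScale

noncomputable section

/-- Forward jump operator `σ(t) = inf {s ∈ T : s > t}`, with `σ(t) = t` if there is no such `s`. -/
def sigma (T : Set ℝ) (t : ℝ) : ℝ :=
  open Classical in if (T ∩ Ioi t).Nonempty then sInf (T ∩ Ioi t) else t

/-- Graininess `μ(t) = σ(t) - t`. -/
def graininess (T : Set ℝ) (t : ℝ) : ℝ := sigma T t - t

/-- `f` has `Δ`-derivative `d` at `t`: for every `ε > 0` there is a neighbourhood of `t` on which
`|f(σ(t)) - f(s) - d (σ(t) - s)| ≤ ε |σ(t) - s|` for all `s ∈ T`. -/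
def HasDeltaDeriv (T : Set ℝ) (f : ℝ → ℂ) (d : ℂ) (t : ℝ) : Prop :=
  ∀ ε : ℝ, 0 < ε → ∀ᶠ s in 𝓝[T] t,
    ‖f (sigma T t) - f s - d * ((sigma T t - s : ℝ) : ℂ)‖ ≤ ε * |sigma T t - s|

/-- `f` is `Δ`-differentiable at `t`. -/
def DeltaDifferentiableAt (T : Set ℝ) (f : ℝ → ℂ) (t : ℝ) : Prop :=
  ∃ d : ℂ, HasDeltaDeriv T f d t

/-- The `Δ`-derivative `f^Δ`, with value `0` at points where it does not exist. -/
def deltaDeriv (T : Set ℝ) (f : ℝ → ℂ) (t : ℝ) : ℂ :=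
  open Classical in if h : DeltaDifferentiableAt T f t then h.choose else 0

/-- The Lebesgue `Δ`-measure of the time scale `T`: Lebesgue measure on `T` together with an atom of
mass `μ(t)` at every right-scattered `t ∈ T`. It gives mass `b - a` to `[a, b) ∩ T`, for
`a ≤ b` in `T`. -/
def deltaMeasure (T : Set ℝ) : Measure ℝ :=
  volume.restrict T +
    Measure.sum fun t : {t : ℝ // t ∈ T ∧ t < sigma T t} =>
      ENNReal.ofReal (graininess T t) • Measure.dirac (t : ℝ)

/-- The `Δ`-integral `∫_a^b f(t) Δt`. -/
def deltaIntegral (T : Set ℝ) (f : ℝ → ℂ) (a b : ℝ) : ℂ :=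
  (∫ t in Ico a b, f t ∂(deltaMeasure T)) - ∫ t in Ico b a, f t ∂(deltaMeasure T)

/-- The cylinder transformation `ξ_h(z) = Log(1 + h z) / h` for `h ≠ 0`, and `ξ_0(z) = z`. -/
def cylinder (h : ℝ) (z : ℂ) : ℂ :=
  open Classical in if h = 0 then z else Complex.log (1 + h * z) / h

/-- The exponential function `e_p(t, s) = exp (∫_s^t ξ_{μ(τ)}(p(τ)) Δτ)`. -/
def expTS (T : Set ℝ) (p : ℝ → ℂ) (t s : ℝ) : ℂ :=
  Complex.exp (deltaIntegral T (fun τ => cylinder (graininess T τ) (p τ)) s t)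

/-- The function `⊖z : t ↦ -z / (1 + μ(t) z)`. -/
def ominus (T : Set ℝ) (z : ℂ) (t : ℝ) : ℂ := -z / (1 + graininess T t * z)

/-- The partial integral `∫_0^b f(t) e_{⊖z}(σ(t), 0) Δt`. -/
def laplacePartial (T : Set ℝ) (f : ℝ → ℂ) (z : ℂ) (b : ℝ) : ℂ :=
  deltaIntegral T (fun t => f t * expTS T (ominus T z) (sigma T t) 0) 0 b

/-- The domain `D[f]`: `f` is locally `Δ`-integrable on `[0, ∞) ∩ T` (as every regulated function
is), `1 + μ(t) z ≠ 0` on `T`, and the improper integral `∫_0^∞ f(t) e_{⊖z}(σ(t), 0) Δt` exists. -/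
def laplaceDomain (T : Set ℝ) (f : ℝ → ℂ) : Set ℂ :=
  {z | (∀ b : ℝ, IntegrableOn f (Ico 0 b) (deltaMeasure T)) ∧
    (∀ t ∈ T, 1 + (graininess T t : ℂ) * z ≠ 0) ∧
    ∃ w : ℂ, Tendsto (laplacePartial T f z) (atTop ⊓ 𝓟 T) (𝓝 w)}

/-- The generalized Laplace transform `L_T[f](z) = ∫_0^∞ f(t) e_{⊖z}(σ(t), 0) Δt`, for
`z ∈ D[f]`. -/
def laplace (T : Set ℝ) (f : ℝ → ℂ) (z : ℂ) : ℂ :=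
  limUnder (atTop ⊓ 𝓟 T) (laplacePartial T f z)

/-- `f` has a generalized Laplace transform on some right half-plane. -/
def LaplaceTransformable (T : Set ℝ) (f : ℝ → ℂ) : Prop :=
  ∃ c : ℝ, ∀ z : ℂ, c < z.re → z ∈ laplaceDomain T f

/-- `g = L_T⁻¹[G]`: the function `g` has generalized Laplace transform `G(z)` for all `z` in some
right half-plane. -/
def IsInvLaplace (T : Set ℝ) (G : ℂ → ℂ) (g : ℝ → ℂ) : Prop :=
  ∃ c : ℝ, ∀ z : ℂ, c < z.re → z ∈ laplaceDomain T g ∧ laplace T g z = G z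

/-- `f(0⁺) = l`: the limit of `f(t)` as `t → 0⁺` in `T` is `l` if `0` is right-dense, and
`f(0) = l` if `0` is right-scattered (the limit condition is then void). -/
def HasInitialValue (T : Set ℝ) (f : ℝ → ℂ) (l : ℂ) : Prop :=
  Tendsto f (𝓝[T ∩ Ioi 0] 0) (𝓝 l) ∧ (0 < sigma T 0 → f 0 = l)

/-- `f` is `n - 1` times `Δ`-differentiable on an initial piece `[0, b) ∩ T` of the time scale, long
enough for the numbers `f^{Δ^k}(0⁺)`, `k < n`, to be meaningful. The condition `0 < σ(t)` leaves out
the point `t = 0` when it is right-dense. -/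
def DeltaDifferentiableNearZero (T : Set ℝ) (n : ℕ) (f : ℝ → ℂ) : Prop :=
  ∃ b ∈ T, (sigma T)^[n] 0 < b ∧
    ∀ k : ℕ, k + 1 < n → ∀ t ∈ T, 0 ≤ t → 0 < sigma T t → t < b →
      DeltaDifferentiableAt T ((deltaDeriv T)^[k] f) t

/-- `g = I_T^α f`, i.e. `g = L_T⁻¹[F(z) / z^α]`, where `F = L_T[f]`. -/
def IsFracIntegral (T : Set ℝ) (α : ℝ) (f g : ℝ → ℂ) : Prop :=
  LaplaceTransformable T f ∧
    IsInvLaplace T (fun z => laplace T f z / z ^ (α : ℂ)) g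

/-- `g = f^{(α)}`, i.e. `g = L_T⁻¹[z^α F(z) - ∑_{k < n} f^{Δ^k}(0⁺) z^{α - k - 1}]`, where
`F = L_T[f]` and `n` is the integer with `n - 1 < α ≤ n`. -/
def IsFracDeriv (T : Set ℝ) (α : ℝ) (f g : ℝ → ℂ) : Prop :=
  LaplaceTransformable T f ∧
    DeltaDifferentiableNearZero T ⌈α⌉₊ f ∧
    ∃ d : ℕ → ℂ, (∀ k < ⌈α⌉₊, HasInitialValue T ((deltaDeriv T)^[k] f) (d k)) ∧
      IsInvLaplace T (fun z => z ^ (α : ℂ) * laplace T f z -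
        ∑ k ∈ Finset.range ⌈α⌉₊, d k * z ^ (((α - k - 1 : ℝ)) : ℂ)) g

/-- Equality of functions on `[0, ∞) ∩ T`: at `Δ`-almost every point, and at every point at which
both functions are right-continuous along `T` (such as every right-scattered point). -/
def DeltaEq (T : Set ℝ) (f g : ℝ → ℂ) : Prop :=
  (∀ᵐ t ∂((deltaMeasure T).restrict (Ici 0)), f t = g t) ∧
    ∀ t ∈ T, 0 ≤ t → ContinuousWithinAt f (T ∩ Ici t) t → ContinuousWithinAt g (T ∩ Ici t) t →
      f t = g t

end

end TimeScale

/-!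
Every identity asserted is first verified on transforms. Where it is defined, the transform of
`f^(α)` is `z ^ α * F(z)` minus boundary terms, so composing two operators multiplies by
`z ^ α * z ^ β = z ^ (α + β)` in a right half-plane, and the conditions "`h` is an iterated
derivative or integral" and "`h` is the derivative or integral of the total order" become conditions
on the transform of `h` that agree up to explicit boundary terms (`isFracDeriv_comp_iff`,
`isFracIntegral_comp_iff`). Two analytic facts are needed besides this algebra.

*The transform determines the function* (`ae_eq_zero_of_laplace_eq_zero`). Suppose that the
transform of `g` vanishes in a right half-plane, fix `a ∈ T`, and put
`H(z) = ∫_0^a g(t) e_z(a, σ(t)) Δt`. For fixed `t`, the exponential `e_z(a, σ(t))` is `exp (z λ)`,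
with `λ` the Lebesgue measure of `T` between `σ(t)` and `a`, times the product of the factors
`1 + μ(τ) z` over the right-scattered `τ` in between. Hence `H` is entire and of exponential type,
and of subexponential growth on the negative real axis, where `exp (z λ)` is bounded and a product
of genus zero is of minimal type. As the transform vanishes, `H(z) e_{⊖z}(a, 0)` is minus the tail
of the Laplace integral beyond `a`; by Abel summation relative to a fixed point `w` of the
half-plane this makes `H` grow at most linearly in a right half-plane, and tend to zero along the
positive real axis. Phragmén–Lindelöf, applied to a difference quotient of `H`, gives `H = 0`
(`eq_zero_of_subexponential`). In particular `H(0) = ∫_0^a g Δt = 0` for all `a`, and `g` vanishes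
almost everywhere.

*The transform of `f^Δ` is `z F(z) - f(0)`* (`exists_laplace_deltaDeriv`), if `f` and `f^Δ` are
transformable and `f` is `Δ`-differentiable everywhere. This follows from integration by parts, with
a boundary term `f(b) e_{⊖z}(b, 0)` that tends to zero.

Integrals over `T` are reduced to integrals over the real line by the retraction `floorTS T` of
`[0, ∞)` onto `T`, which sends `s` to the largest element of `T` that is at most `s`: it pushes
Lebesgue measure forward to the `Δ`-measure (`deltaMeasure_restrict`).
-/

namespace TimeScale

/-- The standing assumptions on a time scale: a closed subset of `ℝ` that contains `0` and is
unbounded above. -/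
structure IsTimeScale (T : Set ℝ) : Prop where
  isClosed : IsClosed T
  zero_mem : (0 : ℝ) ∈ T
  not_bddAbove : ¬ BddAbove T

/-- The largest point of `T` that is at most `max s 0`. On `[0, ∞)` this is the retraction onto
`T` which sends every gap `(t, σ(t))` to its left end point `t`; truncating at `0` makes it
monotone on all of `ℝ`. -/
noncomputable def floorTS (T : Set ℝ) (s : ℝ) : ℝ := sSup (T ∩ Iic (max s 0))

variable {T : Set ℝ}

namespace IsTimeScale

/-! ### Forward jump and retraction onto the time scale -/

lemma nonempty_Ioi (hT : IsTimeScale T) (t : ℝ) : (T ∩ Ioi t).Nonempty := by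
  have h := hT.not_bddAbove
  rw [not_bddAbove_iff] at h
  obtain ⟨y, hy, hty⟩ := h t
  exact ⟨y, hy, hty⟩

lemma sigma_eq (hT : IsTimeScale T) (t : ℝ) : sigma T t = sInf (T ∩ Ioi t) := by
  simp [sigma, hT.nonempty_Ioi t]

lemma bddBelow_Ioi (T : Set ℝ) (t : ℝ) : BddBelow (T ∩ Ioi t) := ⟨t, fun _ h => h.2.le⟩

lemma sigma_mem (hT : IsTimeScale T) (t : ℝ) : sigma T t ∈ T := by
  rw [hT.sigma_eq]
  exact closure_minimal inter_subset_left hT.isClosed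
    (csInf_mem_closure (hT.nonempty_Ioi t) (bddBelow_Ioi T t))

lemma le_sigma (hT : IsTimeScale T) (t : ℝ) : t ≤ sigma T t := by
  rw [hT.sigma_eq]
  exact le_csInf (hT.nonempty_Ioi t) fun _ h => h.2.le

lemma sigma_le (hT : IsTimeScale T) {t s : ℝ} (hs : s ∈ T) (hts : t < s) : sigma T t ≤ s := by
  rw [hT.sigma_eq]
  exact csInf_le (bddBelow_Ioi T t) ⟨hs, hts⟩

lemma sigma_mono (hT : IsTimeScale T) : Monotone (sigma T) := by
  intro s t hst
  rw [hT.sigma_eq, hT.sigma_eq]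
  exact csInf_le_csInf (bddBelow_Ioi T s) (hT.nonempty_Ioi t)
    (inter_subset_inter_right _ (Ioi_subset_Ioi hst))

lemma graininess_nonneg (hT : IsTimeScale T) (t : ℝ) : 0 ≤ graininess T t :=
  sub_nonneg.2 (hT.le_sigma t)

lemma measurable_sigma (hT : IsTimeScale T) : Measurable (sigma T) := hT.sigma_mono.measurable

lemma measurable_graininess (hT : IsTimeScale T) : Measurable (graininess T) :=
  hT.measurable_sigma.sub measurable_id

/-- At a right-dense point the time scale accumulates from the right. -/
lemma exists_mem_Ioo_of_sigma_eq (hT : IsTimeScale T) {t u : ℝ} (ht : sigma T t = t)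
    (htu : t < u) : ∃ r ∈ T, t < r ∧ r < u := by
  by_contra! h
  have : u ≤ sigma T t := by
    rw [hT.sigma_eq]
    exact le_csInf (hT.nonempty_Ioi t) fun r hr => h r hr.1 hr.2
  linarith

lemma nonempty_Iic (hT : IsTimeScale T) (s : ℝ) : (T ∩ Iic (max s 0)).Nonempty :=
  ⟨0, hT.zero_mem, le_max_right s 0⟩

lemma bddAbove_Iic (T : Set ℝ) (s : ℝ) : BddAbove (T ∩ Iic s) := ⟨s, fun _ h => h.2⟩

lemma floor_mem_inter (hT : IsTimeScale T) (s : ℝ) : floorTS T s ∈ T ∩ Iic (max s 0) :=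
  (hT.isClosed.inter isClosed_Iic).csSup_mem (hT.nonempty_Iic s) (bddAbove_Iic T _)

lemma floor_mem (hT : IsTimeScale T) (s : ℝ) : floorTS T s ∈ T := (hT.floor_mem_inter s).1

lemma floor_le (hT : IsTimeScale T) {s : ℝ} (hs : 0 ≤ s) : floorTS T s ≤ s := by
  have h : floorTS T s ≤ max s 0 := (hT.floor_mem_inter s).2
  rwa [max_eq_left hs] at h

lemma le_floor {t s : ℝ} (ht : t ∈ T) (hts : t ≤ s) : t ≤ floorTS T s :=
  le_csSup (bddAbove_Iic T _) ⟨ht, le_max_of_le_left hts⟩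

lemma floor_nonneg (hT : IsTimeScale T) (s : ℝ) : 0 ≤ floorTS T s :=
  le_csSup (bddAbove_Iic T _) ⟨hT.zero_mem, le_max_right s 0⟩

lemma floor_eq_self (hT : IsTimeScale T) {t : ℝ} (ht : t ∈ T) (h : 0 ≤ t) : floorTS T t = t :=
  le_antisymm (hT.floor_le h) (le_floor ht le_rfl)

lemma floor_mono (hT : IsTimeScale T) : Monotone (floorTS T) := by
  intro s t hst
  exact csSup_le_csSup (bddAbove_Iic T _) (hT.nonempty_Iic s)
    (inter_subset_inter_right _ (Iic_subset_Iic.2 (max_le_max_right 0 hst)))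

lemma measurable_floor (hT : IsTimeScale T) : Measurable (floorTS T) := hT.floor_mono.measurable

lemma lt_sigma_floor (hT : IsTimeScale T) {s : ℝ} (hs : floorTS T s < s) :
    s < sigma T (floorTS T s) := by
  by_contra! h
  have h1 := le_floor (hT.sigma_mem (floorTS T s)) h
  have h2 : sigma T (floorTS T s) = floorTS T s := le_antisymm h1 (hT.le_sigma _)
  obtain ⟨r, hr, h3, h4⟩ := hT.exists_mem_Ioo_of_sigma_eq h2 hs
  exact absurd (le_floor hr h4.le) (not_le.2 h3)

lemma le_sigma_floor (hT : IsTimeScale T) {s : ℝ} (hs : 0 ≤ s) : s ≤ sigma T (floorTS T s) := by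
  rcases (hT.floor_le hs).lt_or_eq with h | h
  · exact (hT.lt_sigma_floor h).le
  · exact h.symm.le.trans (hT.le_sigma _)

lemma floor_eq (hT : IsTimeScale T) {t s : ℝ} (ht : t ∈ T) (h0 : 0 ≤ t) (hts : t ≤ s)
    (hs : s < sigma T t) : floorTS T s = t := by
  refine le_antisymm ?_ (le_floor ht hts)
  by_contra! h
  have := hT.sigma_le (hT.floor_mem s) h
  linarith [hT.floor_le (h0.trans hts)]

lemma floor_lt_iff (hT : IsTimeScale T) {b s : ℝ} (hb : b ∈ T) (hs : 0 ≤ s) :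
    floorTS T s < b ↔ s < b := by
  constructor
  · intro h
    by_contra! h'
    exact absurd (le_floor hb h') (not_le.2 h)
  · exact fun h => (hT.floor_le hs).trans_lt h

lemma sigma_floor_le (hT : IsTimeScale T) {b s : ℝ} (hb : b ∈ T) (hs : 0 ≤ s) (hsb : s < b) :
    sigma T (floorTS T s) ≤ b :=
  hT.sigma_le hb ((hT.floor_lt_iff hb hs).2 hsb)

/-! ### The delta measure as an image of Lebesgue measure -/

lemma countable_scattered (hT : IsTimeScale T) : {t | t ∈ T ∧ t < sigma T t}.Countable := by
  refine Set.PairwiseDisjoint.countable_of_Ioo (y := sigma T) ?_ fun t ht => ht.2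
  intro s hs t ht hst
  refine disjoint_left.2 fun x hx hx' => ?_
  rcases hst.lt_or_gt with h | h
  · linarith [hT.sigma_le ht.1 h, hx.2, hx'.1]
  · linarith [hT.sigma_le hs.1 h, hx.1, hx'.2]

lemma countable_gaps (hT : IsTimeScale T) : Countable {t : ℝ // t ∈ T ∧ t < sigma T t} :=
  hT.countable_scattered.to_subtype

/-- On `[0, ∞)` the `Δ`-measure is the image of Lebesgue measure under the retraction `floorTS`.
This turns `Δ`-integrals into integrals over intervals of the real line. -/
lemma deltaMeasure_restrict (hT : IsTimeScale T) :
    (deltaMeasure T).restrict (Ici 0) = (volume.restrict (Ici 0)).map (floorTS T) := by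
  classical
  have := hT.countable_gaps
  ext A hA
  have hTm : MeasurableSet T := hT.isClosed.measurableSet
  rw [Measure.map_apply hT.measurable_floor hA, Measure.restrict_apply hA,
    Measure.restrict_apply (hT.measurable_floor hA)]
  have hset : floorTS T ⁻¹' A ∩ Ici 0 = (A ∩ Ici 0 ∩ T) ∪
      ⋃ i : {t : ℝ // t ∈ T ∧ t < sigma T t},
        (if (i : ℝ) ∈ A ∩ Ici 0 then Ioo (i : ℝ) (sigma T i) else ∅) := by
    ext s
    simp only [mem_inter_iff, mem_preimage, mem_Ici, mem_union, mem_iUnion]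
    constructor
    · rintro ⟨h1, h2⟩
      rcases (hT.floor_le h2).lt_or_eq with h | h
      · right
        refine ⟨⟨floorTS T s, hT.floor_mem s, h.trans (hT.lt_sigma_floor h)⟩, ?_⟩
        rw [if_pos ⟨h1, hT.floor_nonneg s⟩]
        exact ⟨h, hT.lt_sigma_floor h⟩
      · left
        rw [h] at h1
        exact ⟨⟨h1, h2⟩, h ▸ hT.floor_mem s⟩
    · rintro (⟨⟨h1, h2⟩, h3⟩ | ⟨i, hi⟩)
      · exact ⟨by rwa [hT.floor_eq_self h3 h2], h2⟩
      · split_ifs at hi with h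
        · have h4 : floorTS T s = i := hT.floor_eq i.2.1 h.2 hi.1.le hi.2
          exact ⟨by rw [h4]; exact h.1, h.2.trans hi.1.le⟩
        · exact hi.elim
  have hgap : ∀ i : {t : ℝ // t ∈ T ∧ t < sigma T t}, Disjoint T (Ioo (i : ℝ) (sigma T i)) := by
    intro i
    refine disjoint_left.2 fun x hx hx' => ?_
    linarith [hT.sigma_le hx hx'.1, hx'.2]
  rw [hset, measure_union, measure_iUnion]
  · rw [deltaMeasure, Measure.add_apply, Measure.restrict_apply (hA.inter measurableSet_Ici),
      Measure.sum_apply _ (hA.inter measurableSet_Ici)]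
    congr 2
    ext i
    rw [Measure.smul_apply, Measure.dirac_apply' _ (hA.inter measurableSet_Ici)]
    by_cases h : (i : ℝ) ∈ A ∩ Ici 0
    · rw [if_pos h, Real.volume_Ioo, indicator_of_mem h]
      simp [graininess]
    · rw [if_neg h, indicator_of_notMem h]
      simp
  · intro i j hij
    refine disjoint_left.2 fun x hx hx' => ?_
    simp only at hx hx'
    split_ifs at hx hx' with h h'
    · have hne : (i : ℝ) ≠ j := fun h => hij (Subtype.ext h)
      rcases hne.lt_or_gt with h | h
      · linarith [hT.sigma_le j.2.1 h, hx.2, hx'.1]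
      · linarith [hT.sigma_le i.2.1 h, hx.1, hx'.2]
    all_goals first | exact hx.elim | exact hx'.elim
  · intro i
    split_ifs
    · exact measurableSet_Ioo
    · exact MeasurableSet.empty
  · rw [disjoint_iUnion_right]
    intro i
    split_ifs
    · exact (hgap i).mono_left inter_subset_right
    · exact disjoint_empty _
  · exact MeasurableSet.iUnion fun i => by
      split_ifs
      · exact measurableSet_Ioo
      · exact MeasurableSet.empty

lemma deltaMeasure_restrict_Ico (hT : IsTimeScale T) {a b : ℝ} (ha : a ∈ T) (h0a : 0 ≤ a)
    (hb : b ∈ T) :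
    (deltaMeasure T).restrict (Ico a b) = (volume.restrict (Ico a b)).map (floorTS T) := by
  have h1 : Ico a b = Ico a b ∩ Ici 0 :=
    (inter_eq_left.2 fun x hx => h0a.trans hx.1).symm
  have h2 : floorTS T ⁻¹' (Ico a b) ∩ Ici 0 = Ico a b := by
    ext s
    simp only [mem_inter_iff, mem_preimage, mem_Ico, mem_Ici]
    constructor
    · rintro ⟨⟨h1, h2⟩, h3⟩
      exact ⟨h1.trans (hT.floor_le h3), (hT.floor_lt_iff hb h3).1 h2⟩
    · rintro ⟨h1, h2⟩
      exact ⟨⟨le_floor ha h1, (hT.floor_lt_iff hb (h0a.trans h1)).2 h2⟩, h0a.trans h1⟩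
  rw [h1, ← Measure.restrict_restrict measurableSet_Ico, hT.deltaMeasure_restrict,
    Measure.restrict_map hT.measurable_floor measurableSet_Ico,
    Measure.restrict_restrict (hT.measurable_floor measurableSet_Ico), h2, ← h1]

lemma setIntegral_deltaMeasure (hT : IsTimeScale T) {f : ℝ → ℂ} {a b : ℝ} (ha : a ∈ T)
    (h0a : 0 ≤ a) (hb : b ∈ T) (hab : a ≤ b)
    (hf : AEStronglyMeasurable f ((deltaMeasure T).restrict (Ico a b))) :
    ∫ t in Ico a b, f t ∂(deltaMeasure T) = ∫ s in a..b, f (floorTS T s) := by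
  rw [hT.deltaMeasure_restrict_Ico ha h0a hb] at hf ⊢
  rw [integral_map hT.measurable_floor.aemeasurable hf, intervalIntegral.integral_of_le hab,
    integral_Ico_eq_integral_Ioo, integral_Ioc_eq_integral_Ioo]

lemma intervalIntegrable_comp_floor (hT : IsTimeScale T) {f : ℝ → ℂ} {a b : ℝ} (ha : a ∈ T)
    (h0a : 0 ≤ a) (hb : b ∈ T) (hab : a ≤ b) (hf : IntegrableOn f (Ico a b) (deltaMeasure T)) :
    IntervalIntegrable (fun s => f (floorTS T s)) volume a b := by
  rw [intervalIntegrable_iff_integrableOn_Ico_of_le hab]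
  rw [IntegrableOn, hT.deltaMeasure_restrict_Ico ha h0a hb] at hf
  exact hf.comp_measurable hT.measurable_floor

lemma deltaIntegral_eq (hT : IsTimeScale T) {f : ℝ → ℂ} {a b : ℝ} (ha : a ∈ T)
    (h0a : 0 ≤ a) (hb : b ∈ T) (hab : a ≤ b)
    (hf : AEStronglyMeasurable f ((deltaMeasure T).restrict (Ico a b))) :
    deltaIntegral T f a b = ∫ s in a..b, f (floorTS T s) := by
  rw [deltaIntegral, Ico_eq_empty (not_lt.2 hab), hT.setIntegral_deltaMeasure ha h0a hb hab hf]
  simp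

end IsTimeScale

/-! ### The principal branch of `Log (1 + h z) / h` in the right half-plane -/

lemma cylinder_zero (z : ℂ) : cylinder 0 z = z := by simp [cylinder]

lemma cylinder_of_ne {h : ℝ} (hh : h ≠ 0) (z : ℂ) :
    cylinder h z = Complex.log (1 + h * z) / h := by simp [cylinder, hh]

lemma one_le_re_one_add_mul {h : ℝ} (hh : 0 ≤ h) {z : ℂ} (hz : 0 ≤ z.re) :
    1 ≤ (1 + h * z : ℂ).re := by
  simp [mul_nonneg hh hz]

lemma one_add_mul_ne_zero {h : ℝ} (hh : 0 ≤ h) {z : ℂ} (hz : 0 ≤ z.re) :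
    (1 + h * z : ℂ) ≠ 0 := by
  intro h0
  have := one_le_re_one_add_mul hh hz
  rw [h0] at this
  norm_num at this

lemma exp_mul_cylinder {h : ℝ} (hh : 0 ≤ h) {z : ℂ} (hz : 0 ≤ z.re) :
    Complex.exp (h * cylinder h z) = 1 + h * z := by
  rcases eq_or_ne h 0 with rfl | h0
  · simp
  · rw [cylinder_of_ne h0, mul_div_cancel₀ _ (Complex.ofReal_ne_zero.2 h0),
      Complex.exp_log (one_add_mul_ne_zero hh hz)]

lemma norm_log_one_add_le_of_re_nonneg {z : ℂ} (hz : 0 ≤ z.re) : ‖Complex.log (1 + z)‖ ≤ ‖z‖ := by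
  have hconv : Convex ℝ {w : ℂ | 0 ≤ w.re} := convex_halfSpace_re_ge 0
  have h := hconv.norm_image_sub_le_of_norm_hasDerivWithin_le (C := 1)
    (f := fun w : ℂ => Complex.log (1 + w)) (f' := fun w => 1 / (1 + w)) (x := 0) (y := z) ?_ ?_
    (by simp) hz
  · simpa using h
  · intro w hw
    have hw' : 0 ≤ w.re := hw
    have : (1 + w) ∈ Complex.slitPlane := Or.inl (by simp; linarith)
    exact (((hasDerivAt_id w).const_add 1).clog this).hasDerivWithinAt
  · intro w hw
    have hw' : 0 ≤ w.re := hw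
    rw [norm_div, norm_one]
    have h1 : (1 : ℝ) ≤ ‖1 + w‖ := by
      refine le_trans ?_ (Complex.re_le_norm _)
      simpa using hw'
    exact (div_le_one (by linarith)).2 h1

lemma norm_cylinder_le {h : ℝ} (hh : 0 ≤ h) {z : ℂ} (hz : 0 ≤ z.re) : ‖cylinder h z‖ ≤ ‖z‖ := by
  rcases hh.eq_or_lt with rfl | h0
  · rw [cylinder_zero]
  · rw [cylinder_of_ne h0.ne', norm_div, Complex.norm_of_nonneg hh, div_le_iff₀ h0]
    refine (norm_log_one_add_le_of_re_nonneg (by simp; positivity)).trans ?_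
    rw [norm_mul, Complex.norm_of_nonneg hh, mul_comm]

lemma re_cylinder {h : ℝ} (hh : 0 < h) (z : ℂ) :
    (cylinder h z).re = Real.log ‖1 + h * z‖ / h := by
  rw [cylinder_of_ne hh.ne', Complex.div_ofReal_re, Complex.log_re]

/-- A lower bound for the logarithmic growth rate which is uniform for graininess at most `M`. -/
lemma log_div_le_re_cylinder {h M : ℝ} (hh : 0 ≤ h) (hM : 0 < M) (hhM : h ≤ M) {z : ℂ}
    (hz : 0 ≤ z.re) : Real.log (1 + M * z.re) / M ≤ (cylinder h z).re := by
  have hMz : 0 ≤ M * z.re := mul_nonneg hM.le hz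
  rcases hh.eq_or_lt with rfl | h0
  · rw [cylinder_zero, div_le_iff₀ hM]
    linarith [Real.log_le_sub_one_of_pos (show 0 < 1 + M * z.re by linarith)]
  · rw [re_cylinder h0, le_div_iff₀ h0]
    -- Bernoulli's inequality for the exponent `h / M ≤ 1`
    have h1 : (1 + M * z.re) ^ (h / M) ≤ 1 + h / M * (M * z.re) :=
      rpow_one_add_le_one_add_mul_self (by linarith) (by positivity)
        ((div_le_one hM).2 hhM)
    have h2 : 1 + h / M * (M * z.re) ≤ ‖1 + h * z‖ := by
      refine le_trans (le_of_eq ?_) (Complex.re_le_norm _)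
      simp
      field_simp
    have h3 := Real.log_le_log (by positivity) (h1.trans h2)
    rw [Real.log_rpow (by linarith)] at h3
    calc _ = h / M * Real.log (1 + M * z.re) := by ring
      _ ≤ _ := h3

lemma div_le_re_cylinder {h : ℝ} (hh : 0 ≤ h) {z : ℂ} (hz : 0 ≤ z.re) :
    z.re / (1 + h * z.re) ≤ (cylinder h z).re := by
  rcases hh.eq_or_lt with rfl | h0
  · simp [cylinder_zero]
  · rw [re_cylinder h0, le_div_iff₀ h0]
    have hp : 0 < 1 + h * z.re := by positivity
    have h1 := Real.one_sub_inv_le_log_of_pos hp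
    have h2 : 1 + h * z.re ≤ ‖1 + h * z‖ := by
      refine le_trans (le_of_eq ?_) (Complex.re_le_norm _)
      simp
    calc z.re / (1 + h * z.re) * h = 1 - (1 + h * z.re)⁻¹ := by field_simp; ring
      _ ≤ _ := h1.trans (Real.log_le_log hp h2)

/-- Passing from `w` to `z` rescales the graininess: `(1 + h z) / (1 + h w) = 1 + ν (z - w)` with
`ν = h / (1 + h w)`. -/
lemma cylinder_sub {h : ℝ} (hh : 0 ≤ h) {w : ℝ} (hw : 0 ≤ w) {z : ℂ} (hz : w ≤ z.re) :
    cylinder h z - cylinder h w = cylinder (h / (1 + h * w)) (z - w) / (1 + h * w) := by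
  rcases hh.eq_or_lt with rfl | h0
  · simp [cylinder_zero]
  · have hp : 0 < 1 + h * w := by positivity
    have hpc : (1 + h * w : ℂ) ≠ 0 := by exact_mod_cast hp.ne'
    have hhc : (h : ℂ) ≠ 0 := by exact_mod_cast h0.ne'
    have hν : h / (1 + h * w) ≠ 0 := (div_pos h0 hp).ne'
    rw [cylinder_of_ne h0.ne', cylinder_of_ne h0.ne', cylinder_of_ne hν]
    have h1 : (1 + h * z : ℂ) = ((1 + h * w : ℝ) : ℂ) *
        (1 + ((h / (1 + h * w) : ℝ) : ℂ) * (z - w)) := by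
      push_cast
      field_simp
      ring
    have h2 : (1 + ((h / (1 + h * w) : ℝ) : ℂ) * (z - w)) ≠ 0 :=
      one_add_mul_ne_zero (div_pos h0 hp).le (by simpa using hz)
    have h3 : Complex.log (1 + h * w) = (Real.log (1 + h * w) : ℂ) := by
      rw [Complex.ofReal_log hp.le]
      push_cast
      rfl
    rw [h1, Complex.log_ofReal_mul hp h2, h3]
    push_cast
    field_simp
    ring

lemma norm_cylinder_sub_le {h : ℝ} (hh : 0 ≤ h) {w : ℝ} (hw : 0 ≤ w) {z : ℂ} (hz : w ≤ z.re) :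
    ‖cylinder h z - cylinder h w‖ ≤ ‖z - w‖ / (1 + h * w) := by
  have hp : 0 < 1 + h * w := by positivity
  have hpc : ‖(1 + h * w : ℂ)‖ = 1 + h * w := by
    have := Complex.norm_of_nonneg hp.le
    push_cast at this
    exact this
  rw [cylinder_sub hh hw hz, norm_div, hpc]
  gcongr
  exact norm_cylinder_le (by positivity) (by simpa using hz)

lemma le_re_cylinder_sub {h : ℝ} (hh : 0 ≤ h) {w : ℝ} (hw : 0 < w) {z : ℂ} (hz : w ≤ z.re) :
    ((z.re - w) / (1 + (z.re - w) / w)) / (1 + h * w) ≤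
      (cylinder h z - cylinder h w).re := by
  have hp : 0 < 1 + h * w := by positivity
  have hx : 0 ≤ z.re - w := by linarith
  have hre : (z - w : ℂ).re = z.re - w := by simp
  have h1 := div_le_re_cylinder (h := h / (1 + h * w)) (by positivity)
    (z := z - w) (by rw [hre]; exact hx)
  have h2 : (cylinder (h / (1 + h * w)) (z - w) / (1 + h * w)).re =
      (cylinder (h / (1 + h * w)) (z - w)).re / (1 + h * w) := by
    rw [← Complex.div_ofReal_re]
    push_cast
    rfl
  rw [cylinder_sub hh hw.le hz, h2]
  rw [hre] at h1
  gcongr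
  refine le_trans ?_ h1
  have h3 : h / (1 + h * w) * (z.re - w) ≤ (z.re - w) / w := by
    rw [le_div_iff₀ hw]
    have : h / (1 + h * w) * w ≤ 1 := by
      rw [div_mul_eq_mul_div, div_le_one hp]; linarith
    nlinarith
  exact div_le_div_of_nonneg_left hx (by positivity) (by linarith)

lemma cylinder_ominus (T : Set ℝ) {z : ℂ} (hz : 0 ≤ z.re) {t : ℝ} (ht : 0 ≤ graininess T t) :
    cylinder (graininess T t) (ominus T z t) = -cylinder (graininess T t) z := by
  rcases ht.eq_or_lt with h | h
  · rw [← h, cylinder_zero, cylinder_zero, ominus, ← h]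
    simp
  · have h1 := one_add_mul_ne_zero h.le hz
    rw [cylinder_of_ne h.ne', cylinder_of_ne h.ne', ominus]
    have h2 : (1 + (graininess T t : ℂ) * (-z / (1 + graininess T t * z))) =
        (1 + graininess T t * z)⁻¹ := by
      field_simp
      ring
    rw [h2, Complex.log_inv, neg_div]
    intro harg
    have := (Complex.arg_eq_pi_iff.1 harg).1
    linarith [one_le_re_one_add_mul h.le hz]

lemma measurable_cylinder (z : ℂ) : Measurable fun h : ℝ => cylinder h z := by
  classical
  unfold cylinder
  refine Measurable.ite (measurableSet_eq) measurable_const ?_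
  fun_prop

lemma tendsto_cylinder_zero (z : ℂ) :
    Tendsto (fun h : ℝ => cylinder h z) (𝓝 0) (𝓝 z) := by
  have h1 : HasDerivAt (fun h : ℝ => Complex.log (1 + h * z)) z 0 := by
    have h2 : HasDerivAt (fun h : ℝ => (1 + h * z : ℂ)) z 0 := by
      simpa using ((Complex.ofRealCLM.hasDerivAt (x := (0 : ℝ))).mul_const z).const_add 1
    have := h2.clog_real (by simp)
    simpa using this
  rw [hasDerivAt_iff_tendsto_slope] at h1
  have h3 : Tendsto (fun h : ℝ => cylinder h z) (𝓝[≠] 0) (𝓝 z) := by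
    refine h1.congr' ?_
    filter_upwards [self_mem_nhdsWithin] with h hh
    rw [cylinder_of_ne hh, slope_def_module]
    simp [div_eq_inv_mul]
  have h4 : Tendsto (fun h : ℝ => cylinder h z) (pure 0) (𝓝 z) := by
    rw [tendsto_pure_left]
    intro s hs
    rw [cylinder_zero]
    exact mem_of_mem_nhds hs
  rw [← nhdsNE_sup_pure]
  exact h3.sup h4

/-! ### The exponential function -/

/-- The rate `ξ_{μ(t)}(z)` with `t` the point of `T` to which `s` is retracted. -/
noncomputable def rate (T : Set ℝ) (z : ℂ) (s : ℝ) : ℂ := cylinder (graininess T (floorTS T s)) z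

/-- The quotient `e_{⊖z}(s, 0) / e_{⊖w}(s, 0)`, extended from `T` to the line by continuing the
integral in the exponent. For `w = 0` it is `e_{⊖z}(s, 0)` itself. -/
noncomputable def expRatio (T : Set ℝ) (w : ℝ) (z : ℂ) (s : ℝ) : ℂ :=
  Complex.exp (-∫ u in (0 : ℝ)..s, (rate T z u - rate T w u))

namespace IsTimeScale

lemma measurable_rate (hT : IsTimeScale T) (z : ℂ) : Measurable (rate T z) :=
  (measurable_cylinder z).comp (hT.measurable_graininess.comp hT.measurable_floor)

lemma norm_rate_le (hT : IsTimeScale T) {z : ℂ} (hz : 0 ≤ z.re) (s : ℝ) : ‖rate T z s‖ ≤ ‖z‖ :=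
  norm_cylinder_le (hT.graininess_nonneg _) hz

lemma intervalIntegrable_of_bound {f : ℝ → ℂ} (hf : Measurable f) {C : ℝ} {a b : ℝ}
    (h : ∀ s ∈ uIoc a b, ‖f s‖ ≤ C) : IntervalIntegrable f volume a b := by
  rw [intervalIntegrable_iff]
  refine Measure.integrableOn_of_bounded (M := C) (by simp [uIoc]) hf.aestronglyMeasurable ?_
  exact (ae_restrict_iff' measurableSet_uIoc).2 (Eventually.of_forall h)

lemma intervalIntegrable_rate (hT : IsTimeScale T) {z : ℂ} (hz : 0 ≤ z.re) (a b : ℝ) :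
    IntervalIntegrable (rate T z) volume a b :=
  intervalIntegrable_of_bound (hT.measurable_rate z) fun s _ => hT.norm_rate_le hz s

lemma rate_zero (s : ℝ) : rate T 0 s = 0 := by
  simp [rate, cylinder]

lemma floor_eq_of_lt_sigma_floor (hT : IsTimeScale T) {s u : ℝ} (hs : 0 ≤ s) (hsu : s ≤ u)
    (hu : u < sigma T (floorTS T s)) : floorTS T u = floorTS T s :=
  hT.floor_eq (hT.floor_mem s) (hT.floor_nonneg s) ((hT.floor_le hs).trans hsu) hu

/-- A point is either the start of an interval on which `floorTS` is constant, or right-dense. -/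
lemma lt_sigma_or_rightDense (hT : IsTimeScale T) {s : ℝ} (hs : 0 ≤ s) :
    s < sigma T (floorTS T s) ∨ (s ∈ T ∧ floorTS T s = s ∧ sigma T s = s) := by
  rcases (hT.floor_le hs).lt_or_eq with h | h
  · exact Or.inl (hT.lt_sigma_floor h)
  · rcases (hT.le_sigma s).lt_or_eq with h' | h'
    · exact Or.inl (by rwa [h])
    · exact Or.inr ⟨h ▸ hT.floor_mem s, h, h'.symm⟩

lemma tendsto_sigma_floor_right (hT : IsTimeScale T) {s : ℝ} (hs : 0 ≤ s) (hd : sigma T s = s) :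
    Tendsto (fun u => sigma T (floorTS T u)) (𝓝[≥] s) (𝓝 s) := by
  rw [tendsto_order]
  constructor
  · intro a ha
    filter_upwards [self_mem_nhdsWithin] with u hu
    exact ha.trans_le ((mem_Ici.1 hu).trans (hT.le_sigma_floor (hs.trans hu)))
  · intro a ha
    obtain ⟨r, hr, h1, h2⟩ := hT.exists_mem_Ioo_of_sigma_eq hd ha
    filter_upwards [Ico_mem_nhdsGE h1] with u hu
    exact (hT.sigma_floor_le hr (hs.trans hu.1) hu.2).trans_lt h2

lemma tendsto_floor_right (hT : IsTimeScale T) {s : ℝ} (hs : 0 ≤ s) (hmem : s ∈ T) :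
    Tendsto (floorTS T) (𝓝[≥] s) (𝓝 s) := by
  refine tendsto_of_tendsto_of_tendsto_of_le_of_le' tendsto_const_nhds
    (tendsto_id.mono_left nhdsWithin_le_nhds) ?_ ?_
  · filter_upwards [self_mem_nhdsWithin] with u hu
    exact le_floor hmem hu
  · filter_upwards [self_mem_nhdsWithin] with u hu
    exact hT.floor_le (hs.trans hu)

lemma continuousWithinAt_rate (hT : IsTimeScale T) (z : ℂ) {s : ℝ} (hs : 0 ≤ s) :
    ContinuousWithinAt (rate T z) (Ici s) s := by
  rcases hT.lt_sigma_or_rightDense hs with h | ⟨hmem, hfl, hd⟩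
  · have : Tendsto (fun _ : ℝ => rate T z s) (𝓝[≥] s) (𝓝 (rate T z s)) := tendsto_const_nhds
    refine this.congr' ?_
    filter_upwards [Ico_mem_nhdsGE h] with u hu
    rw [rate, rate, hT.floor_eq_of_lt_sigma_floor hs hu.1 hu.2]
  · have h1 : rate T z s = z := by
      rw [rate, hfl, graininess, hd, sub_self, cylinder_zero]
    rw [ContinuousWithinAt, h1]
    refine (tendsto_cylinder_zero z).comp ?_
    have := (hT.tendsto_sigma_floor_right hs hd).sub (hT.tendsto_floor_right hs hmem)
    rwa [sub_self] at this

lemma expRatio_zero (w : ℝ) (z : ℂ) : expRatio T w z 0 = 1 := by simp [expRatio]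

lemma intervalIntegrable_rate_sub (hT : IsTimeScale T) {w : ℝ} (hw : 0 ≤ w) {z : ℂ}
    (hz : 0 ≤ z.re) (a b : ℝ) :
    IntervalIntegrable (fun u => rate T z u - rate T w u) volume a b :=
  (hT.intervalIntegrable_rate hz a b).sub (hT.intervalIntegrable_rate (by simpa using hw) a b)

lemma continuous_expRatio (hT : IsTimeScale T) {w : ℝ} (hw : 0 ≤ w) {z : ℂ} (hz : 0 ≤ z.re) :
    Continuous (expRatio T w z) :=
  Complex.continuous_exp.comp (intervalIntegral.continuous_primitive
    (fun a b => hT.intervalIntegrable_rate_sub hw hz a b) 0).neg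

lemma expRatio_eq_mul (hT : IsTimeScale T) {w : ℝ} (hw : 0 ≤ w) {z : ℂ} (hz : 0 ≤ z.re)
    (s t : ℝ) : expRatio T w z t =
      expRatio T w z s * Complex.exp (-∫ u in s..t, (rate T z u - rate T w u)) := by
  have := intervalIntegral.integral_add_adjacent_intervals
    (hT.intervalIntegrable_rate_sub hw hz 0 s) (hT.intervalIntegrable_rate_sub hw hz s t)
  rw [expRatio, expRatio, ← Complex.exp_add, ← this]
  ring_nf

lemma hasDerivWithinAt_expRatio (hT : IsTimeScale T) {w : ℝ} (hw : 0 ≤ w) {z : ℂ}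
    (hz : 0 ≤ z.re) {s : ℝ} (hs : 0 ≤ s) :
    HasDerivWithinAt (expRatio T w z) (-(rate T z s - rate T w s) * expRatio T w z s)
      (Ici s) s := by
  have hm : Measurable fun u => rate T z u - rate T w u :=
    (hT.measurable_rate z).sub (hT.measurable_rate w)
  have h1 : HasDerivWithinAt (fun t => ∫ u in (0 : ℝ)..t, (rate T z u - rate T w u))
      (rate T z s - rate T w s) (Ici s) s :=
    intervalIntegral.integral_hasDerivWithinAt_right
      (hT.intervalIntegrable_rate_sub hw hz 0 s) (hm.stronglyMeasurable.stronglyMeasurableAtFilter)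
      ((((hT.continuousWithinAt_rate z hs).sub
        (hT.continuousWithinAt_rate w hs))).mono Ioi_subset_Ici_self)
  have := h1.neg.cexp
  rw [mul_comm] at this
  exact this

/-- On `T` the auxiliary function `expRatio` with `w = 0` is the time scale exponential. -/
lemma expTS_ominus (hT : IsTimeScale T) {z : ℂ} (hz : 0 ≤ z.re) {t : ℝ} (ht : t ∈ T)
    (h0 : 0 ≤ t) : expTS T (ominus T z) t 0 = expRatio T 0 z t := by
  have hfun : (fun τ => cylinder (graininess T τ) (ominus T z τ)) =
      fun τ => -cylinder (graininess T τ) z :=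
    funext fun τ => cylinder_ominus T hz (hT.graininess_nonneg τ)
  have hm : Measurable fun τ => -cylinder (graininess T τ) z :=
    ((measurable_cylinder z).comp hT.measurable_graininess).neg
  rw [expTS, hfun, hT.deltaIntegral_eq hT.zero_mem le_rfl ht h0 hm.aestronglyMeasurable,
    intervalIntegral.integral_neg, expRatio]
  simp only [Complex.ofReal_zero, rate_zero, sub_zero]
  rfl

lemma norm_expRatio_eq (hT : IsTimeScale T) {w : ℝ} (hw : 0 ≤ w) {z : ℂ} (hz : 0 ≤ z.re)
    (s : ℝ) : ‖expRatio T w z s‖ = Real.exp (-∫ u in (0 : ℝ)..s, (rate T z u - rate T w u).re) := by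
  rw [expRatio, Complex.norm_exp, Complex.neg_re]
  congr 2
  exact (Complex.reCLM.intervalIntegral_comp_comm (hT.intervalIntegrable_rate_sub hw hz 0 s)).symm

/-! ### The fundamental theorem of calculus on a time scale -/

/-- The affine interpolation of `F` over the gaps of `T`, with slopes `k`, at a point `v` is a
convex combination of the values of `F` at the end points of the gap around `v`. -/
lemma exists_convex_combination (hT : IsTimeScale T) {F k : ℝ → ℂ} {v : ℝ} (hv : 0 ≤ v)
    (hjump : floorTS T v < sigma T (floorTS T v) → F (sigma T (floorTS T v)) - F (floorTS T v) =
      graininess T (floorTS T v) * k (floorTS T v)) :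
    ∃ l : ℝ, 0 ≤ l ∧ l ≤ 1 ∧ v = (1 - l) * floorTS T v + l * sigma T (floorTS T v) ∧
      F (floorTS T v) + (v - floorTS T v : ℝ) * k (floorTS T v) =
        (1 - l) * F (floorTS T v) + l * F (sigma T (floorTS T v)) := by
  have h1 := hT.floor_le hv
  have h2 := hT.le_sigma_floor hv
  rcases (h1.trans h2).lt_or_eq with h | h
  · have hμ : 0 < graininess T (floorTS T v) := sub_pos.2 h
    have hj := hjump h
    refine ⟨(v - floorTS T v) / graininess T (floorTS T v),
      div_nonneg (by linarith) hμ.le, (div_le_one hμ).2 (by simp only [graininess]; linarith),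
      ?_, ?_⟩
    · have : sigma T (floorTS T v) = floorTS T v + graininess T (floorTS T v) := by
        simp [graininess]
      rw [this]
      field_simp
      ring
    · have hμc : (graininess T (floorTS T v) : ℂ) ≠ 0 := by exact_mod_cast hμ.ne'
      have : F (sigma T (floorTS T v)) =
        F (floorTS T v) + graininess T (floorTS T v) * k (floorTS T v) := by rw [← hj]; ring
      rw [this]
      push_cast
      field_simp
      ring
  · have h3 : v = floorTS T v := by linarith
    refine ⟨0, le_rfl, zero_le_one, by simp [← h3], ?_⟩
    rw [← h3]; simp

/-- If `F` is continuous on `T ∩ [a, b]` and `k` is its `Δ`-derivative on `T ∩ [a, b)` (only the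
derivative from the right is needed at right-dense points), then the `Δ`-integral of `k` is the
increment of `F`. -/
theorem integral_comp_floor_eq_sub (hT : IsTimeScale T) {F k : ℝ → ℂ} {a b : ℝ} (ha : a ∈ T)
    (h0a : 0 ≤ a) (hb : b ∈ T) (hab : a ≤ b) (hcont : ContinuousOn F (T ∩ Icc a b))
    (hjump : ∀ t ∈ T, a ≤ t → t < b → t < sigma T t →
      F (sigma T t) - F t = graininess T t * k t)
    (hderiv : ∀ t ∈ T, a ≤ t → t < b → sigma T t = t → HasDerivWithinAt F (k t) (T ∩ Ici t) t)
    (hint : IntervalIntegrable (fun s => k (floorTS T s)) volume a b) :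
    ∫ s in a..b, k (floorTS T s) = F b - F a := by
  set G : ℝ → ℂ := fun s => F (floorTS T s) + (s - floorTS T s : ℝ) * k (floorTS T s) with hG
  have hGT : ∀ t ∈ T, 0 ≤ t → G t = F t := by
    intro t ht h0
    simp [hG, hT.floor_eq_self ht h0]
  have hj : ∀ v, a ≤ v → v < b → floorTS T v < sigma T (floorTS T v) →
      F (sigma T (floorTS T v)) - F (floorTS T v) =
        graininess T (floorTS T v) * k (floorTS T v) := fun v hv hvb =>
    hjump _ (hT.floor_mem v) (le_floor ha hv) ((hT.floor_lt_iff hb (h0a.trans hv)).2 hvb)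
  have hright : ∀ s, a ≤ s → s < b → HasDerivWithinAt G (k (floorTS T s)) (Ici s) s := by
    intro s has hsb
    have h0s := h0a.trans has
    rcases hT.lt_sigma_or_rightDense h0s with h | ⟨hmem, hfl, hd⟩
    · have h1 : HasDerivWithinAt (fun u : ℝ => F (floorTS T s) +
          (u - floorTS T s : ℝ) * k (floorTS T s)) (k (floorTS T s)) (Ici s) s := by
        have h2 : HasDerivAt (fun u : ℝ => ((u - floorTS T s : ℝ) : ℂ)) 1 s :=
          ((hasDerivAt_id s).sub_const (floorTS T s)).ofReal_comp
        simpa using ((h2.mul_const (k (floorTS T s))).const_add (F (floorTS T s))).hasDerivWithinAt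
      refine h1.congr_of_eventuallyEq ?_ rfl
      filter_upwards [Ico_mem_nhdsGE h] with u hu
      simp only [hG]
      rw [hT.floor_eq_of_lt_sigma_floor h0s hu.1 hu.2]
    · rw [hfl, hasDerivWithinAt_iff_isLittleO, Asymptotics.isLittleO_iff]
      intro ε hε
      have hF := hderiv s hmem has hsb hd
      rw [hasDerivWithinAt_iff_isLittleO, Asymptotics.isLittleO_iff] at hF
      have hF := hF hε
      have hfl1 : Tendsto (floorTS T) (𝓝[≥] s) (𝓝[T ∩ Ici s] s) := by
        refine tendsto_nhdsWithin_iff.2 ⟨hT.tendsto_floor_right h0s hmem, ?_⟩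
        filter_upwards [self_mem_nhdsWithin] with u hu
        exact ⟨hT.floor_mem u, le_floor hmem hu⟩
      have hfl2 : Tendsto (fun u => sigma T (floorTS T u)) (𝓝[≥] s) (𝓝[T ∩ Ici s] s) := by
        refine tendsto_nhdsWithin_iff.2 ⟨hT.tendsto_sigma_floor_right h0s hd, ?_⟩
        filter_upwards [self_mem_nhdsWithin] with u hu
        exact ⟨hT.sigma_mem _, (mem_Ici.1 hu).trans (hT.le_sigma_floor (h0s.trans hu))⟩
      filter_upwards [hfl1.eventually hF, hfl2.eventually hF, Ico_mem_nhdsGE hsb] with v h1 h2 hv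
      obtain ⟨l, hl0, hl1, hvl, hGl⟩ :=
        hT.exists_convex_combination (F := F) (k := k) (h0s.trans hv.1) (hj v (has.trans hv.1) hv.2)
      have hGs : G s = F s := hGT s hmem h0s
      have e1 : G v - G s - (v - s) • k s =
          (1 - l) * (F (floorTS T v) - F s - (floorTS T v - s) • k s) +
          l * (F (sigma T (floorTS T v)) - F s - (sigma T (floorTS T v) - s) • k s) := by
        have hvc : (v : ℂ) = (1 - l) * floorTS T v + l * sigma T (floorTS T v) := by
          exact_mod_cast hvl
        rw [hGs]
        simp only [hG]
        rw [hGl]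
        simp only [Complex.real_smul]
        push_cast
        rw [hvc]
        ring
      have h3 : s ≤ floorTS T v := le_floor hmem hv.1
      have h4 : s ≤ sigma T (floorTS T v) := h3.trans (hT.le_sigma _)
      rw [Real.norm_of_nonneg (by linarith)] at h1 h2
      rw [e1, Real.norm_of_nonneg (by linarith [hv.1])]
      have hn1 : ‖(1 - l : ℂ)‖ = 1 - l := by
        have := Complex.norm_of_nonneg (show 0 ≤ 1 - l by linarith)
        push_cast at this
        exact this
      calc _ ≤ (1 - l) * (ε * (floorTS T v - s)) + l * (ε * (sigma T (floorTS T v) - s)) := by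
            refine (norm_add_le _ _).trans ?_
            rw [norm_mul, norm_mul, hn1, Complex.norm_of_nonneg hl0]
            gcongr
        _ = ε * (((1 - l) * floorTS T v + l * sigma T (floorTS T v)) - s) := by ring
        _ = ε * (v - s) := by rw [← hvl]
  have hleft : ∀ s, a < s → s ≤ b → ContinuousWithinAt G (Icc a s) s := by
    intro s has hsb
    have h0s : 0 ≤ s := h0a.trans has.le
    by_cases hcase : ∃ u, a ≤ u ∧ u < s ∧ s ≤ sigma T (floorTS T u)
    · obtain ⟨u, hau, hus, hsu⟩ := hcase
      have h0u := h0a.trans hau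
      have hlt : floorTS T u < sigma T (floorTS T u) := by
        linarith [hT.floor_le h0u]
      have h1 : ∀ v, u ≤ v → v < s → floorTS T v = floorTS T u := fun v h1 h2 =>
        hT.floor_eq_of_lt_sigma_floor h0u h1 (h2.trans_le hsu)
      have h2 : G s = F (floorTS T u) + (s - floorTS T u : ℝ) * k (floorTS T u) := by
        rcases hsu.lt_or_eq with h | h
        · simp only [hG]
          rw [hT.floor_eq_of_lt_sigma_floor h0u hus.le h]
        · have hsT : s ∈ T := h ▸ hT.sigma_mem _
          rw [hGT s hsT h0s]
          have := hj u hau (hus.trans_le hsb) hlt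
          rw [graininess, ← h] at this
          rw [← this]; ring
      have h3 : ContinuousWithinAt (fun v : ℝ => F (floorTS T u) +
          (v - floorTS T u : ℝ) * k (floorTS T u)) (Icc a s) s := by
        refine Continuous.continuousWithinAt ?_
        fun_prop
      refine h3.congr_of_eventuallyEq ?_ h2
      filter_upwards [self_mem_nhdsWithin, mem_nhdsWithin_of_mem_nhds (Ioi_mem_nhds hus)]
        with v hv huv
      rcases hv.2.lt_or_eq with h | h
      · simp only [hG]
        rw [h1 v huv.le h]
      · rw [h, h2]
    · push Not at hcase
      have hflt : Tendsto (floorTS T) (𝓝[Icc a s] s) (𝓝 s) := by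
        rw [tendsto_order]
        constructor
        · intro r hr
          -- the jump of a point strictly between `r` and `s` stays below `s`
          have h1 := hcase (max a ((r + s) / 2)) (le_max_left _ _) (max_lt has (by linarith))
          have h2 := hT.le_sigma_floor (h0a.trans (le_max_left a ((r + s) / 2)))
          filter_upwards [mem_nhdsWithin_of_mem_nhds (Ioi_mem_nhds h1)] with v hv
          have h3 := le_floor (hT.sigma_mem (floorTS T (max a ((r + s) / 2)))) (le_of_lt hv)
          linarith [le_max_right a ((r + s) / 2)]
        · intro r hr
          filter_upwards [self_mem_nhdsWithin] with v hv
          exact ((hT.floor_le (h0a.trans hv.1)).trans hv.2).trans_lt hr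
      have hsT : s ∈ T := by
        have : (𝓝[Icc a s] s).NeBot := by
          rw [← mem_closure_iff_nhdsWithin_neBot, closure_Icc]
          exact right_mem_Icc.2 has.le
        exact hT.isClosed.mem_of_tendsto hflt (Eventually.of_forall hT.floor_mem)
      have hsub : Icc a s ⊆ Icc a b := Icc_subset_Icc_right hsb
      rw [ContinuousWithinAt, hGT s hsT h0s]
      have hsF : Tendsto F (𝓝[T ∩ Icc a b] s) (𝓝 (F s)) := hcont s ⟨hsT, has.le, hsb⟩
      have h1 : Tendsto (floorTS T) (𝓝[Icc a s] s) (𝓝[T ∩ Icc a b] s) := by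
        refine tendsto_nhdsWithin_iff.2 ⟨hflt, ?_⟩
        filter_upwards [self_mem_nhdsWithin] with v hv
        exact ⟨hT.floor_mem v, le_floor ha hv.1, (hT.floor_le (h0a.trans hv.1)).trans
          (hv.2.trans hsb)⟩
      have h2 : Tendsto (fun v => if v < s then sigma T (floorTS T v) else s) (𝓝[Icc a s] s)
          (𝓝[T ∩ Icc a b] s) := by
        refine tendsto_nhdsWithin_iff.2 ⟨?_, ?_⟩
        · refine tendsto_of_tendsto_of_tendsto_of_le_of_le'
            (tendsto_id.mono_left nhdsWithin_le_nhds) tendsto_const_nhds ?_ ?_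
          · filter_upwards [self_mem_nhdsWithin] with v hv
            split_ifs
            · exact hT.le_sigma_floor (h0a.trans hv.1)
            · exact hv.2
          · filter_upwards [self_mem_nhdsWithin] with v hv
            split_ifs with h
            · exact (hcase v hv.1 h).le
            · exact le_rfl
        · filter_upwards [self_mem_nhdsWithin] with v hv
          split_ifs with h
          · exact ⟨hT.sigma_mem _, hv.1.trans (hT.le_sigma_floor (h0a.trans hv.1)),
              ((hcase v hv.1 h).le).trans hsb⟩
          · exact ⟨hsT, has.le, hsb⟩
      have h3 := ((hsF.comp h1).sub_const (F s)).norm.add ((hsF.comp h2).sub_const (F s)).norm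
      simp only [sub_self, norm_zero, add_zero] at h3
      rw [tendsto_iff_norm_sub_tendsto_zero]
      refine squeeze_zero' (Eventually.of_forall fun _ => norm_nonneg _) ?_ h3
      filter_upwards [self_mem_nhdsWithin] with v hv
      simp only [Function.comp]
      rcases hv.2.lt_or_eq with h | h
      · rw [if_pos h]
        obtain ⟨l, hl0, hl1, -, hGl⟩ := hT.exists_convex_combination (F := F) (k := k)
          (h0a.trans hv.1) (hj v hv.1 (h.trans_le hsb))
        have e1 : G v - F s = (1 - l) * (F (floorTS T v) - F s) +
            l * (F (sigma T (floorTS T v)) - F s) := by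
          simp only [hG]
          rw [hGl]
          ring
        have hn1 : ‖(1 - l : ℂ)‖ = 1 - l := by
          have := Complex.norm_of_nonneg (show 0 ≤ 1 - l by linarith)
          push_cast at this
          exact this
        rw [e1]
        refine (norm_add_le _ _).trans ?_
        rw [norm_mul, norm_mul, hn1, Complex.norm_of_nonneg hl0]
        gcongr
        · exact mul_le_of_le_one_left (norm_nonneg _) (by linarith)
        · exact mul_le_of_le_one_left (norm_nonneg _) hl1
      · rw [h, hGT s hsT h0s]
        simp only [sub_self, norm_zero]
        positivity
  have hGcont : ContinuousOn G (Icc a b) := by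
    intro s hs
    have hsplit : Icc a b = Icc a s ∪ Icc s b := (Icc_union_Icc_eq_Icc hs.1 hs.2).symm
    rw [hsplit]
    refine ContinuousWithinAt.union ?_ ?_
    · rcases hs.1.lt_or_eq with h | h
      · exact hleft s h hs.2
      · rw [← h, Icc_self]
        exact continuousWithinAt_singleton
    · rcases hs.2.lt_or_eq with h | h
      · exact (hright s hs.1 h).continuousWithinAt.mono Icc_subset_Ici_self
      · rw [h, Icc_self]
        exact continuousWithinAt_singleton
  rw [← hGT b hb (h0a.trans hab), ← hGT a ha h0a]
  exact intervalIntegral.integral_eq_sub_of_hasDeriv_right_of_le hab hGcont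
    (fun s hs => (hright s hs.1.le hs.2).mono Ioi_subset_Ici_self) hint

end IsTimeScale

/-! ### Delta derivatives -/

lemma DeltaDifferentiableAt.hasDeltaDeriv {f : ℝ → ℂ} {t : ℝ} (h : DeltaDifferentiableAt T f t) :
    HasDeltaDeriv T f (deltaDeriv T f t) t := by
  rw [deltaDeriv, dif_pos h]
  exact h.choose_spec

lemma HasDeltaDeriv.jump {f : ℝ → ℂ} {d : ℂ} {t : ℝ} (h : HasDeltaDeriv T f d t) (ht : t ∈ T) :
    f (sigma T t) - f t = graininess T t * d := by
  have h1 : ∀ ε : ℝ, 0 < ε →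
      ‖f (sigma T t) - f t - d * ((sigma T t - t : ℝ) : ℂ)‖ ≤ ε * |sigma T t - t| := fun ε hε =>
    (h ε hε).self_of_nhdsWithin ht
  have h2 : ‖f (sigma T t) - f t - d * ((sigma T t - t : ℝ) : ℂ)‖ ≤ 0 := by
    have h3 : Tendsto (fun ε : ℝ => ε * |sigma T t - t|) (𝓝[>] 0) (𝓝 (0 * |sigma T t - t|)) :=
      (tendsto_id.mono_left nhdsWithin_le_nhds).mul_const _
    rw [zero_mul] at h3
    refine ge_of_tendsto h3 ?_
    filter_upwards [self_mem_nhdsWithin] with ε hε using h1 ε hε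
  have h3 := norm_le_zero_iff.1 h2
  rw [sub_eq_zero.1 h3, graininess, mul_comm]

lemma HasDeltaDeriv.hasDerivWithinAt {f : ℝ → ℂ} {d : ℂ} {t : ℝ} (h : HasDeltaDeriv T f d t)
    (hd : sigma T t = t) : HasDerivWithinAt f d T t := by
  rw [hasDerivWithinAt_iff_isLittleO, Asymptotics.isLittleO_iff]
  intro ε hε
  filter_upwards [h ε hε] with s hs
  rw [hd] at hs
  have e : f s - f t - (s - t) • d = -(f t - f s - d * ((t - s : ℝ) : ℂ)) := by
    rw [Complex.real_smul]
    push_cast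
    ring
  rw [e, norm_neg, Real.norm_eq_abs, abs_sub_comm]
  exact hs

lemma HasDeltaDeriv.continuousWithinAt {f : ℝ → ℂ} {d : ℂ} {t : ℝ} (h : HasDeltaDeriv T f d t)
    (ht : t ∈ T) : ContinuousWithinAt f T t := by
  have hj := h.jump ht
  rw [ContinuousWithinAt, tendsto_iff_norm_sub_tendsto_zero]
  have hid : Tendsto (fun s : ℝ => s) (𝓝[T] t) (𝓝 t) := tendsto_id.mono_left nhdsWithin_le_nhds
  rw [tendsto_order]
  refine ⟨fun a ha => Eventually.of_forall fun _ => ha.trans_le (norm_nonneg _), fun a ha => ?_⟩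
  obtain ⟨ε, hε, hεa⟩ : ∃ ε : ℝ, 0 < ε ∧ ε * |sigma T t - t| < a := by
    refine ⟨a / (2 * (|sigma T t - t| + 1)), by positivity, ?_⟩
    rw [div_mul_eq_mul_div, div_lt_iff₀ (by positivity)]
    nlinarith [abs_nonneg (sigma T t - t)]
  have hlim : Tendsto (fun s : ℝ => ‖d‖ * |s - t| + ε * |sigma T t - s|) (𝓝[T] t)
      (𝓝 (‖d‖ * |t - t| + ε * |sigma T t - t|)) :=
    ((hid.sub_const t).abs.const_mul _).add (((tendsto_const_nhds).sub hid).abs.const_mul _)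
  have hlt : ‖d‖ * |t - t| + ε * |sigma T t - t| < a := by simpa using hεa
  filter_upwards [h ε hε, hlim.eventually (gt_mem_nhds hlt)] with s hs hs2
  refine lt_of_le_of_lt ?_ hs2
  have e : f s - f t = d * ((s - t : ℝ) : ℂ) -
      (f (sigma T t) - f s - d * ((sigma T t - s : ℝ) : ℂ)) := by
    have : f t = f (sigma T t) - graininess T t * d := by rw [← hj]; ring
    rw [this, graininess]
    push_cast
    ring
  rw [e]
  refine (norm_sub_le _ _).trans ?_
  rw [norm_mul, Complex.norm_real, Real.norm_eq_abs]
  gcongr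

namespace IsTimeScale

/-! ### Decay of the exponential -/

lemma re_rate_sub_nonneg (hT : IsTimeScale T) {w : ℝ} (hw : 0 ≤ w) {z : ℂ} (hz : w ≤ z.re)
    (s : ℝ) : 0 ≤ (rate T z s - rate T w s).re := by
  have hh := hT.graininess_nonneg (floorTS T s)
  have hp : 0 < 1 + graininess T (floorTS T s) * w := by positivity
  have hx : 0 ≤ (z - w : ℂ).re := by simpa using hz
  have h1 : 0 ≤ (cylinder (graininess T (floorTS T s) / (1 + graininess T (floorTS T s) * w))
      (z - w)).re := le_trans (by positivity) (div_le_re_cylinder (by positivity) hx)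
  rw [rate, rate, cylinder_sub hh hw hz]
  have h2 := Complex.div_ofReal_re
    (cylinder (graininess T (floorTS T s) / (1 + graininess T (floorTS T s) * w)) (z - w))
    (1 + graininess T (floorTS T s) * w)
  push_cast at h2
  rw [h2]
  positivity

lemma intervalIntegrable_re_rate_sub (hT : IsTimeScale T) {w : ℝ} (hw : 0 ≤ w) {z : ℂ}
    (hz : 0 ≤ z.re) (a b : ℝ) :
    IntervalIntegrable (fun u => (rate T z u - rate T w u).re) volume a b := by
  have h := hT.intervalIntegrable_rate_sub hw hz a b
  exact ⟨h.1.re, h.2.re⟩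

lemma antitone_norm_expRatio (hT : IsTimeScale T) {w : ℝ} (hw : 0 ≤ w) {z : ℂ} (hz : w ≤ z.re) :
    Antitone fun s => ‖expRatio T w z s‖ := by
  intro a b hab
  simp only
  rw [hT.norm_expRatio_eq hw (hw.trans hz), hT.norm_expRatio_eq hw (hw.trans hz)]
  refine Real.exp_le_exp.2 (neg_le_neg ?_)
  rw [← sub_nonneg, intervalIntegral.integral_interval_sub_left
    (hT.intervalIntegrable_re_rate_sub hw (hw.trans hz) 0 b)
    (hT.intervalIntegrable_re_rate_sub hw (hw.trans hz) 0 a)]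
  exact intervalIntegral.integral_nonneg hab fun u _ => hT.re_rate_sub_nonneg hw hz u

lemma norm_expRatio_le_one (hT : IsTimeScale T) {w : ℝ} (hw : 0 ≤ w) {z : ℂ} (hz : w ≤ z.re)
    {s : ℝ} (hs : 0 ≤ s) : ‖expRatio T w z s‖ ≤ 1 := by
  have := hT.antitone_norm_expRatio hw hz hs
  simpa [expRatio_zero] using this

lemma expRatio_ne_zero (w : ℝ) (z : ℂ) (s : ℝ) : expRatio T w z s ≠ 0 := Complex.exp_ne_zero _

/-- `e_{⊖z}` is the solution of `y^Δ = -z y^σ`, in integrated form. -/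
lemma integral_mul_expRatio_sigma (hT : IsTimeScale T) {z : ℂ} (hz : 0 ≤ z.re) {a b : ℝ}
    (ha : a ∈ T) (h0a : 0 ≤ a) (hb : b ∈ T) (hab : a ≤ b) :
    ∫ s in a..b, z * expRatio T 0 z (sigma T (floorTS T s)) =
      expRatio T 0 z a - expRatio T 0 z b := by
  have hcont := hT.continuous_expRatio le_rfl hz
  have h := hT.integral_comp_floor_eq_sub (F := expRatio T 0 z)
    (k := fun t => -(z * expRatio T 0 z (sigma T t))) ha h0a hb hab hcont.continuousOn ?_ ?_ ?_
  · rw [intervalIntegral.integral_neg] at h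
    linear_combination -h
  · intro t ht hat htb hσ
    have h0t := h0a.trans hat
    have h1 : ∫ u in t..sigma T t, (rate T z u - rate T ((0 : ℝ) : ℂ) u) =
        graininess T t * cylinder (graininess T t) z := by
      have : ∫ u in t..sigma T t, (rate T z u - rate T ((0 : ℝ) : ℂ) u) =
          ∫ u in t..sigma T t, cylinder (graininess T t) z := by
        rw [intervalIntegral.integral_of_le hσ.le, intervalIntegral.integral_of_le hσ.le,
          integral_Ioc_eq_integral_Ioo, integral_Ioc_eq_integral_Ioo]
        refine setIntegral_congr_fun measurableSet_Ioo fun u hu => ?_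
        simp only [Complex.ofReal_zero, rate_zero, sub_zero]
        rw [rate, hT.floor_eq ht h0t hu.1.le hu.2]
      rw [this, intervalIntegral.integral_const, Complex.real_smul]
      rfl
    have h2 := hT.expRatio_eq_mul le_rfl hz t (sigma T t)
    rw [h1, Complex.exp_neg, exp_mul_cylinder (hT.graininess_nonneg t) hz] at h2
    have h3 := one_add_mul_ne_zero (hT.graininess_nonneg t) hz
    rw [h2]
    field_simp
    ring
  · intro t ht hat htb hσ
    have h1 := hT.hasDerivWithinAt_expRatio le_rfl hz (h0a.trans hat)
    rw [Complex.ofReal_zero, rate_zero, sub_zero, rate, hT.floor_eq_self ht (h0a.trans hat),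
      graininess, hσ, sub_self, cylinder_zero] at h1
    rw [hσ, ← neg_mul]
    exact h1.mono inter_subset_right
  · refine intervalIntegrable_of_bound (C := ‖z‖) ?_ ?_
    · exact ((hcont.measurable.comp (hT.measurable_sigma.comp hT.measurable_floor)).const_mul
        z).neg
    · intro s hs
      rw [norm_neg, norm_mul]
      exact mul_le_of_le_one_right (norm_nonneg _) (hT.norm_expRatio_le_one le_rfl hz
        ((hT.floor_nonneg s).trans (hT.le_sigma _)))

/-- Every stretch of `T` of length at least one contributes a fixed amount to `∫ 1 / (1 + μ w)`:
either it contains a gap of length at least one, or the graininess is less than one on it. -/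
lemma exists_le_integral_inv (hT : IsTimeScale T) {w : ℝ} (hw : 0 ≤ w) {t : ℝ} (ht : t ∈ T)
    (h0 : 0 ≤ t) : ∃ t' ∈ T, t ≤ t' ∧
      1 / (1 + w) ≤ ∫ u in t..t', 1 / (1 + graininess T (floorTS T u) * w) := by
  have hpos : ∀ u, 0 < 1 + graininess T (floorTS T u) * w := fun u => by
    have := hT.graininess_nonneg (floorTS T u)
    positivity
  have hmeas : Measurable fun u => 1 / (1 + graininess T (floorTS T u) * w) :=
    (((hT.measurable_graininess.comp hT.measurable_floor).mul_const w).const_add 1).const_div 1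
  have hint : ∀ a b, IntervalIntegrable
      (fun u => 1 / (1 + graininess T (floorTS T u) * w)) volume a b := by
    intro a b
    rw [intervalIntegrable_iff]
    refine Measure.integrableOn_of_bounded (M := 1) (by simp [uIoc]) hmeas.aestronglyMeasurable ?_
    refine Eventually.of_forall fun u => ?_
    rw [Real.norm_of_nonneg (by have := hpos u; positivity), div_le_one (hpos u)]
    have := hT.graininess_nonneg (floorTS T u)
    nlinarith
  have h0t1 : 0 ≤ t + 1 := by linarith
  refine ⟨sigma T (floorTS T (t + 1)), hT.sigma_mem _, ?_, ?_⟩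
  · linarith [hT.le_sigma_floor h0t1]
  have htt' : t + 1 ≤ sigma T (floorTS T (t + 1)) := hT.le_sigma_floor h0t1
  by_cases hcase : ∃ u ∈ T, t ≤ u ∧ u ≤ t + 1 ∧ 1 ≤ graininess T u
  · obtain ⟨u, hu, htu, hut, hgr⟩ := hcase
    have h0u := h0.trans htu
    have huσ : u ≤ sigma T u := hT.le_sigma u
    have hσ : sigma T u ≤ sigma T (floorTS T (t + 1)) := hT.sigma_mono (le_floor hu hut)
    have h1 : ∫ v in u..sigma T u, 1 / (1 + graininess T (floorTS T v) * w) =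
        ∫ v in u..sigma T u, 1 / (1 + graininess T u * w) := by
      rw [intervalIntegral.integral_of_le huσ, intervalIntegral.integral_of_le huσ,
        integral_Ioc_eq_integral_Ioo, integral_Ioc_eq_integral_Ioo]
      refine setIntegral_congr_fun measurableSet_Ioo fun v hv => ?_
      rw [hT.floor_eq hu h0u hv.1.le hv.2]
    have h2 : ∫ v in u..sigma T u, 1 / (1 + graininess T (floorTS T v) * w) ≤
        ∫ v in t..sigma T (floorTS T (t + 1)), 1 / (1 + graininess T (floorTS T v) * w) :=
      intervalIntegral.integral_mono_interval htu huσ hσ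
        (Eventually.of_forall fun v => by have := hpos v; simp only [Pi.zero_apply]; positivity)
        (hint _ _)
    refine le_trans ?_ h2
    rw [h1, intervalIntegral.integral_const, smul_eq_mul]
    change _ ≤ graininess T u * _
    rw [mul_one_div, div_le_div_iff₀ (by positivity) (by positivity)]
    nlinarith
  · push Not at hcase
    have h2 : ∫ v in t..t + 1, 1 / (1 + graininess T (floorTS T v) * w) ≤
        ∫ v in t..sigma T (floorTS T (t + 1)), 1 / (1 + graininess T (floorTS T v) * w) :=
      intervalIntegral.integral_mono_interval le_rfl (by linarith) htt'
        (Eventually.of_forall fun v => by have := hpos v; simp only [Pi.zero_apply]; positivity)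
        (hint _ _)
    refine le_trans ?_ h2
    have h3 : ∫ v in t..t + 1, 1 / (1 + w) ≤
        ∫ v in t..t + 1, 1 / (1 + graininess T (floorTS T v) * w) := by
      refine intervalIntegral.integral_mono_on (by linarith) (by simp) (hint _ _) fun v hv => ?_
      have h4 := hcase (floorTS T v) (hT.floor_mem v) (le_floor ht hv.1)
        ((hT.floor_le (h0.trans hv.1)).trans hv.2)
      have h5 := hpos v
      exact one_div_le_one_div_of_le h5 (by nlinarith)
    simpa using h3

/-- The logarithm of the absolute value of the ratio is at most `-κ ∫ 1 / (1 + μ w)` for some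
`κ > 0`, and that integral diverges. -/
lemma tendsto_expRatio (hT : IsTimeScale T) {w : ℝ} (hw : 0 < w) {z : ℂ} (hz : w < z.re) :
    Tendsto (expRatio T w z) atTop (𝓝 0) := by
  have h0z : 0 ≤ z.re := hw.le.trans hz.le
  have hint := hT.intervalIntegrable_re_rate_sub hw.le h0z
  set κ := (z.re - w) / (1 + (z.re - w) / w) with hκ
  have hκ0 : 0 < κ := by
    have : 0 < z.re - w := by linarith
    positivity
  rw [tendsto_zero_iff_norm_tendsto_zero]
  simp_rw [hT.norm_expRatio_eq hw.le h0z]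
  refine Real.tendsto_exp_atBot.comp (tendsto_neg_atTop_atBot.comp ?_)
  have hη : 0 < κ * (1 / (1 + w)) := by positivity
  have hstep : ∀ n : ℕ, ∃ t ∈ T, 0 ≤ t ∧
      n * (κ * (1 / (1 + w))) ≤ ∫ u in (0 : ℝ)..t, (rate T z u - rate T w u).re := by
    intro n
    induction n with
    | zero => exact ⟨0, hT.zero_mem, le_rfl, by simp⟩
    | succ n ih =>
      obtain ⟨t, ht, h0, hn⟩ := ih
      obtain ⟨t', ht', htt', h1⟩ := hT.exists_le_integral_inv hw.le ht h0
      refine ⟨t', ht', h0.trans htt', ?_⟩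
      rw [← intervalIntegral.integral_add_adjacent_intervals (hint 0 t) (hint t t')]
      have h2 : ∫ u in t..t', κ * (1 / (1 + graininess T (floorTS T u) * w)) ≤
          ∫ u in t..t', (rate T z u - rate T w u).re := by
        refine intervalIntegral.integral_mono_on_of_le_Ioo htt' ?_ (hint _ _) fun u _ => ?_
        · by_contra h3
          rw [intervalIntegral.integral_undef] at h1
          · have : 0 < 1 / (1 + w) := by positivity
            linarith
          · exact fun h4 => h3 (h4.const_mul κ)
        · rw [mul_one_div]
          exact le_re_cylinder_sub (hT.graininess_nonneg _) hw hz.le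
      rw [intervalIntegral.integral_const_mul] at h2
      have h3 := mul_le_mul_of_nonneg_left h1 hκ0.le
      push_cast
      linarith
  have hmono : Monotone fun b => ∫ u in (0 : ℝ)..b, (rate T z u - rate T w u).re := by
    intro a b hab
    simp only
    rw [← sub_nonneg, intervalIntegral.integral_interval_sub_left (hint 0 b) (hint 0 a)]
    exact intervalIntegral.integral_nonneg hab fun u _ => hT.re_rate_sub_nonneg hw.le hz.le u
  refine tendsto_atTop_atTop_of_monotone hmono fun B => ?_
  obtain ⟨n, hn⟩ := exists_nat_ge (B / (κ * (1 / (1 + w))))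
  obtain ⟨t, -, -, h⟩ := hstep n
  exact ⟨t, le_trans ((div_le_iff₀ hη).1 hn) h⟩

/-! ### Integration by parts -/

/-- Integration by parts on the time scale, as an instance of Fubini's theorem for the triangle
`σ(ρ(u)) ≤ v`, which up to null sets is the triangle `u < ρ(v)`, where `ρ` is the retraction. -/
lemma integral_mul_integral_sigma (hT : IsTimeScale T) {γ κ : ℝ → ℂ} {a b : ℝ}
    (ha : a ∈ T) (h0a : 0 ≤ a) (hb : b ∈ T) (hab : a ≤ b)
    (hγ : IntervalIntegrable γ volume a b) (hκ : IntervalIntegrable κ volume a b) :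
    ∫ u in a..b, γ u * ∫ v in sigma T (floorTS T u)..b, κ v =
      ∫ v in a..b, κ v * ∫ u in a..floorTS T v, γ u := by
  set D : Set (ℝ × ℝ) := {p | sigma T (floorTS T p.1) ≤ p.2} with hD
  have hDm : MeasurableSet D := measurableSet_le
    ((hT.measurable_sigma.comp hT.measurable_floor).comp measurable_fst) measurable_snd
  set μ : Measure ℝ := volume.restrict (Ioo a b) with hμ
  have hγ' : Integrable γ μ := (intervalIntegrable_iff_integrableOn_Ioo_of_le hab).1 hγ
  have hκ' : Integrable κ μ := (intervalIntegrable_iff_integrableOn_Ioo_of_le hab).1 hκ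
  have hint : Integrable (D.indicator fun p : ℝ × ℝ => γ p.1 * κ p.2) (μ.prod μ) :=
    (hγ'.mul_prod hκ').indicator hDm
  have hswap := integral_integral_swap (f := fun u v =>
    D.indicator (fun p : ℝ × ℝ => γ p.1 * κ p.2) (u, v)) hint
  rw [intervalIntegral.integral_of_le hab, intervalIntegral.integral_of_le hab,
    integral_Ioc_eq_integral_Ioo, integral_Ioc_eq_integral_Ioo]
  have hL : ∫ u in Ioo a b, (γ u * ∫ v in sigma T (floorTS T u)..b, κ v) =
      ∫ u, ∫ v, D.indicator (fun p : ℝ × ℝ => γ p.1 * κ p.2) (u, v) ∂μ ∂μ := by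
    refine setIntegral_congr_fun measurableSet_Ioo fun u hu => ?_
    have h0u := h0a.trans hu.1.le
    have h1 : a < sigma T (floorTS T u) := hu.1.trans_le (hT.le_sigma_floor h0u)
    have h2 : sigma T (floorTS T u) ≤ b := hT.sigma_floor_le hb h0u hu.2
    have h3 : (fun v => D.indicator (fun p : ℝ × ℝ => γ p.1 * κ p.2) (u, v)) =
        (Ici (sigma T (floorTS T u))).indicator fun v => γ u * κ v := by
      ext v
      simp only [indicator, hD, mem_ofPred_eq, mem_Ici]
    rw [h3, integral_indicator measurableSet_Ici, Measure.restrict_restrict measurableSet_Ici,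
      integral_const_mul, intervalIntegral.integral_of_le h2, integral_Ioc_eq_integral_Ioo,
      ← integral_Ico_eq_integral_Ioo]
    congr 3
    ext v
    simp only [mem_Ico, mem_inter_iff, mem_Ici, mem_Ioo]
    exact ⟨fun h => ⟨h.1, h1.trans_le h.1, h.2⟩, fun h => ⟨h.1, h.2.2⟩⟩
  have hR : ∫ v in Ioo a b, (κ v * ∫ u in a..floorTS T v, γ u) =
      ∫ v, ∫ u, D.indicator (fun p : ℝ × ℝ => γ p.1 * κ p.2) (u, v) ∂μ ∂μ := by
    refine setIntegral_congr_fun measurableSet_Ioo fun v hv => ?_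
    have h0v := h0a.trans hv.1.le
    have h1 : a ≤ floorTS T v := le_floor ha hv.1.le
    have hsm : MeasurableSet {u | sigma T (floorTS T u) ≤ v} := measurableSet_le
      (hT.measurable_sigma.comp hT.measurable_floor) measurable_const
    have h3 : (fun u => D.indicator (fun p : ℝ × ℝ => γ p.1 * κ p.2) (u, v)) =
        {u | sigma T (floorTS T u) ≤ v}.indicator fun u => κ v * γ u := by
      ext u
      simp only [indicator, hD, mem_ofPred_eq, mul_comm]
    rw [h3, integral_indicator hsm, Measure.restrict_restrict hsm,
      integral_const_mul, intervalIntegral.integral_of_le h1]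
    congr 1
    refine setIntegral_congr_set ?_
    have hne : ∀ᵐ u : ℝ, u ≠ floorTS T v := by
      simp [ae_iff, measure_singleton]
    filter_upwards [hne] with u hu
    refine propext ?_
    change (a < u ∧ u ≤ floorTS T v) ↔ (sigma T (floorTS T u) ≤ v ∧ a < u ∧ u < b)
    constructor
    · rintro ⟨h4, h5⟩
      have h6 : u < floorTS T v := lt_of_le_of_ne h5 hu
      have h7 := hT.floor_le h0v
      exact ⟨(hT.sigma_floor_le (hT.floor_mem v) (h0a.trans h4.le) h6).trans h7, h4,
        (h6.trans_le h7).trans hv.2⟩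
    · rintro ⟨h4, h5, -⟩
      exact ⟨h5, (hT.le_sigma_floor (h0a.trans h5.le)).trans (le_floor (hT.sigma_mem _) h4)⟩
  rw [hL, hR, hswap]

/-- A bound for integrals against `expRatio` by Abel summation: if the partial integrals of `γ`
over `T` are bounded by `S`, and the total variation of the ratio is controlled by its absolute
value through the constant `C`, then no absolute integrability at infinity is needed. -/
lemma norm_integral_mul_expRatio_le (hT : IsTimeScale T) {γ : ℝ → ℂ} {a b w C S : ℝ} {z : ℂ}
    (hw : 0 ≤ w) (hz : w ≤ z.re) (ha : a ∈ T) (h0a : 0 ≤ a) (hb : b ∈ T) (hab : a ≤ b)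
    (hγ : IntervalIntegrable γ volume a b)
    (hC : ∀ s, ‖rate T z s - rate T w s‖ ≤ C * (rate T z s - rate T w s).re) (hC0 : 0 ≤ C)
    (hS : ∀ r ∈ T, a ≤ r → r ≤ b → ‖∫ u in a..r, γ u‖ ≤ S) :
    ‖∫ u in a..b, γ u * expRatio T w z (sigma T (floorTS T u))‖ ≤
      S * (1 + C) * ‖expRatio T w z a‖ := by
  have h0z := hw.trans hz
  have hcont := hT.continuous_expRatio hw h0z
  have hθm : Measurable fun v => rate T z v - rate T w v :=
    (hT.measurable_rate z).sub (hT.measurable_rate w)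
  set q := expRatio T w z with hq
  set κ : ℝ → ℂ := fun v => (rate T z v - rate T w v) * q v with hκ
  have hκint : ∀ c d, IntervalIntegrable κ volume c d := fun c d =>
    (hT.intervalIntegrable_rate_sub hw h0z c d).mul_continuousOn hcont.continuousOn
  have hftc : ∀ c, 0 ≤ c → c ≤ b → ∫ v in c..b, κ v = q c - q b := by
    intro c h0c hcb
    have h := intervalIntegral.integral_eq_sub_of_hasDeriv_right_of_le hcb
      (hcont.continuousOn) (f' := fun v => -κ v) (fun s hs => ?_) (hκint c b).neg
    · rw [intervalIntegral.integral_neg] at h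
      linear_combination -h
    · have := (hT.hasDerivWithinAt_expRatio hw h0z (h0c.trans hs.1.le)).mono Ioi_subset_Ici_self
      rw [neg_mul] at this
      exact this
  have hS0 : 0 ≤ S := le_trans (norm_nonneg _) (hS a ha le_rfl hab)
  -- the same computation for the absolute value of the ratio bounds its total variation
  have hvar : ∫ v in a..b, ‖κ v‖ ≤ C * ‖q a‖ := by
    set N : ℝ → ℝ := fun s => Real.exp (-∫ u in (0 : ℝ)..s, (rate T z u - rate T w u).re) with hN
    have hNq : ∀ s, ‖q s‖ = N s := hT.norm_expRatio_eq hw h0z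
    have hre := hT.intervalIntegrable_re_rate_sub hw h0z
    have hNcont : Continuous N := by
      have : N = fun s => ‖q s‖ := funext fun s => (hNq s).symm
      rw [this]
      exact hcont.norm
    have hNd : ∀ s ∈ Ioo a b, HasDerivWithinAt N
        (-((rate T z s - rate T w s).re * N s)) (Ioi s) s := by
      intro s hs
      have h0s := h0a.trans hs.1.le
      have h1 : HasDerivWithinAt (fun t => ∫ u in (0 : ℝ)..t, (rate T z u - rate T w u).re)
          (rate T z s - rate T w s).re (Ici s) s :=
        intervalIntegral.integral_hasDerivWithinAt_right (hre 0 s)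
          ((Complex.measurable_re.comp hθm).stronglyMeasurable.stronglyMeasurableAtFilter)
          ((Complex.continuous_re.continuousAt.comp_continuousWithinAt
            ((hT.continuousWithinAt_rate z h0s).sub (hT.continuousWithinAt_rate w h0s))).mono
              Ioi_subset_Ici_self)
      have := h1.neg.exp.mono Ioi_subset_Ici_self
      have e : -((rate T z s - rate T w s).re * N s) = N s * -(rate T z s - rate T w s).re := by
        ring
      rw [e]
      exact this
    have hNint : IntervalIntegrable (fun s => (rate T z s - rate T w s).re * N s) volume a b :=
      (hre a b).mul_continuousOn hNcont.continuousOn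
    have hNftc := intervalIntegral.integral_eq_sub_of_hasDeriv_right_of_le hab
      hNcont.continuousOn hNd hNint.neg
    rw [intervalIntegral.integral_neg] at hNftc
    have h1 : ∫ v in a..b, ‖κ v‖ ≤ ∫ v in a..b, C * ((rate T z v - rate T w v).re * N v) := by
      refine intervalIntegral.integral_mono_on hab (hκint a b).norm (hNint.const_mul C)
        fun v _ => ?_
      rw [hκ, norm_mul, hNq, ← mul_assoc]
      exact mul_le_mul_of_nonneg_right (hC v) (Real.exp_pos _).le
    rw [intervalIntegral.integral_const_mul] at h1
    refine h1.trans (mul_le_mul_of_nonneg_left ?_ hC0)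
    have : 0 ≤ N b := (Real.exp_pos _).le
    rw [hNq a]
    linarith
  have hsplit : ∫ u in a..b, γ u * q (sigma T (floorTS T u)) =
      q b * (∫ u in a..b, γ u) + ∫ v in a..b, κ v * ∫ u in a..floorTS T v, γ u := by
    rw [← hT.integral_mul_integral_sigma ha h0a hb hab hγ (hκint a b),
      ← intervalIntegral.integral_const_mul]
    have hqm : Measurable fun u => q (sigma T (floorTS T u)) :=
      hcont.measurable.comp (hT.measurable_sigma.comp hT.measurable_floor)
    have e1 : ∫ u in a..b, γ u * ∫ v in sigma T (floorTS T u)..b, κ v =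
        ∫ u in a..b, (γ u * q (sigma T (floorTS T u)) - q b * γ u) := by
      rw [intervalIntegral.integral_of_le hab, intervalIntegral.integral_of_le hab,
        integral_Ioc_eq_integral_Ioo, integral_Ioc_eq_integral_Ioo]
      refine setIntegral_congr_fun measurableSet_Ioo fun u hu => ?_
      have h0u := h0a.trans hu.1.le
      rw [hftc _ (h0u.trans (hT.le_sigma_floor h0u)) (hT.sigma_floor_le hb h0u hu.2)]
      ring
    have hi : IntervalIntegrable (fun u => γ u * q (sigma T (floorTS T u))) volume a b := by
      rw [intervalIntegrable_iff] at hγ ⊢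
      refine hγ.mul_bdd (c := 1) hqm.aestronglyMeasurable (Eventually.of_forall fun u => ?_)
      exact hT.norm_expRatio_le_one hw hz ((hT.floor_nonneg u).trans (hT.le_sigma _))
    rw [e1, intervalIntegral.integral_sub hi (hγ.const_mul _)]
    ring
  rw [hsplit]
  have hqb : ‖q b‖ ≤ ‖q a‖ := hT.antitone_norm_expRatio hw hz hab
  have h1 : ‖q b * (∫ u in a..b, γ u)‖ ≤ ‖q a‖ * S := by
    rw [norm_mul]
    exact mul_le_mul hqb (hS b hb hab le_rfl) (norm_nonneg _) (norm_nonneg _)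
  have h2 : ‖∫ v in a..b, κ v * ∫ u in a..floorTS T v, γ u‖ ≤ S * (C * ‖q a‖) := by
    have h3 : ‖∫ v in a..b, κ v * ∫ u in a..floorTS T v, γ u‖ ≤ ∫ v in a..b, S * ‖κ v‖ := by
      refine intervalIntegral.norm_integral_le_of_norm_le hab (Eventually.of_forall fun v hv => ?_)
        ((hκint a b).norm.const_mul S)
      rw [norm_mul, mul_comm]
      exact mul_le_mul_of_nonneg_right (hS _ (hT.floor_mem v) (le_floor ha hv.1.le)
        ((hT.floor_le (h0a.trans hv.1.le)).trans hv.2)) (norm_nonneg _)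
    rw [intervalIntegral.integral_const_mul] at h3
    exact h3.trans (mul_le_mul_of_nonneg_left hvar hS0)
  calc _ ≤ ‖q a‖ * S + S * (C * ‖q a‖) := (norm_add_le _ _).trans (add_le_add h1 h2)
    _ = _ := by ring

/-! ### The Laplace transform of a delta derivative -/

lemma laplacePartial_eq (hT : IsTimeScale T) {f : ℝ → ℂ} {z : ℂ} (hz : 0 ≤ z.re) {b : ℝ}
    (hb : b ∈ T) (h0 : 0 ≤ b) (hf : IntegrableOn f (Ico 0 b) (deltaMeasure T)) :
    laplacePartial T f z b =
      ∫ s in (0 : ℝ)..b, f (floorTS T s) * expRatio T 0 z (sigma T (floorTS T s)) := by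
  have hE : Measurable fun t => expRatio T 0 z (sigma T t) :=
    (hT.continuous_expRatio le_rfl hz).measurable.comp hT.measurable_sigma
  have hexp : ∀ t, 0 ≤ t → expTS T (ominus T z) (sigma T t) 0 = expRatio T 0 z (sigma T t) :=
    fun t ht => hT.expTS_ominus hz (hT.sigma_mem t) (ht.trans (hT.le_sigma t))
  have hm : AEStronglyMeasurable (fun t => f t * expTS T (ominus T z) (sigma T t) 0)
      ((deltaMeasure T).restrict (Ico 0 b)) := by
    refine (hf.aestronglyMeasurable.mul hE.aestronglyMeasurable).congr ?_
    filter_upwards [ae_restrict_mem measurableSet_Ico] with t ht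
    simp only [Pi.mul_apply]
    rw [hexp t ht.1]
  rw [laplacePartial, hT.deltaIntegral_eq hT.zero_mem le_rfl hb h0 hm]
  simp_rw [hexp _ (hT.floor_nonneg _)]

lemma intervalIntegrable_mul_expRatio_sigma (hT : IsTimeScale T) {γ : ℝ → ℂ} {a b w : ℝ} {z : ℂ}
    (hw : 0 ≤ w) (hz : w ≤ z.re) (hγ : IntervalIntegrable γ volume a b) :
    IntervalIntegrable (fun u => γ u * expRatio T w z (sigma T (floorTS T u))) volume a b := by
  have hqm : Measurable fun u => expRatio T w z (sigma T (floorTS T u)) :=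
    (hT.continuous_expRatio hw (hw.trans hz)).measurable.comp
      (hT.measurable_sigma.comp hT.measurable_floor)
  rw [intervalIntegrable_iff] at hγ ⊢
  refine hγ.mul_bdd (c := 1) hqm.aestronglyMeasurable (Eventually.of_forall fun u => ?_)
  exact hT.norm_expRatio_le_one hw hz ((hT.floor_nonneg u).trans (hT.le_sigma _))

lemma neBot_atTop_inf (hT : IsTimeScale T) : (atTop ⊓ 𝓟 T : Filter ℝ).NeBot := by
  rw [← frequently_mem_iff_neBot, frequently_atTop]
  intro a
  obtain ⟨t, ht, hat⟩ := hT.nonempty_Ioi a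
  exact ⟨t, hat.le, ht⟩

lemma eventually_atTop_inf (T : Set ℝ) : ∀ᶠ b : ℝ in atTop ⊓ 𝓟 T, b ∈ T ∧ 0 ≤ b :=
  ((eventually_principal.2 fun _ h => h).filter_mono inf_le_right).and
    ((eventually_ge_atTop 0).filter_mono inf_le_left)

lemma tendsto_laplacePartial {f : ℝ → ℂ} {z : ℂ} (hz : z ∈ laplaceDomain T f) :
    Tendsto (laplacePartial T f z) (atTop ⊓ 𝓟 T) (𝓝 (laplace T f z)) :=
  tendsto_nhds_limUnder hz.2.2

lemma laplace_eq (hT : IsTimeScale T) {f : ℝ → ℂ} {z w : ℂ}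
    (h : Tendsto (laplacePartial T f z) (atTop ⊓ 𝓟 T) (𝓝 w)) : laplace T f z = w := by
  have := hT.neBot_atTop_inf
  exact h.limUnder_eq

lemma integral_deltaDeriv (hT : IsTimeScale T) {f : ℝ → ℂ}
    (hf : ∀ t ∈ T, 0 ≤ t → DeltaDifferentiableAt T f t)
    {a b : ℝ} (ha : a ∈ T) (h0a : 0 ≤ a) (hb : b ∈ T) (hab : a ≤ b)
    (hint : IntegrableOn (deltaDeriv T f) (Ico a b) (deltaMeasure T)) :
    ∫ s in a..b, deltaDeriv T f (floorTS T s) = f b - f a := by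
  refine hT.integral_comp_floor_eq_sub ha h0a hb hab ?_ ?_ ?_
    (hT.intervalIntegrable_comp_floor ha h0a hb hab hint)
  · intro t ht
    exact ((hf t ht.1 (h0a.trans ht.2.1)).hasDeltaDeriv.continuousWithinAt ht.1).mono
      inter_subset_left
  · intro t ht hat _ _
    exact (hf t ht (h0a.trans hat)).hasDeltaDeriv.jump ht
  · intro t ht hat _ hd
    exact ((hf t ht (h0a.trans hat)).hasDeltaDeriv.hasDerivWithinAt hd).mono inter_subset_left

/-- Integration by parts for the partial Laplace integrals. -/
lemma mul_laplacePartial (hT : IsTimeScale T) {f : ℝ → ℂ} {z : ℂ} (hz : 0 ≤ z.re)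
    (hf : ∀ t ∈ T, 0 ≤ t → DeltaDifferentiableAt T f t)
    {b : ℝ} (hb : b ∈ T) (h0 : 0 ≤ b) (hfi : IntegrableOn f (Ico 0 b) (deltaMeasure T))
    (hint : IntegrableOn (deltaDeriv T f) (Ico 0 b) (deltaMeasure T)) :
    z * laplacePartial T f z b =
      f 0 - f b * expRatio T 0 z b + laplacePartial T (deltaDeriv T f) z b := by
  set q := expRatio T 0 z with hq
  set g := deltaDeriv T f with hg
  have hgi := hT.intervalIntegrable_comp_floor hT.zero_mem le_rfl hb h0 hint
  have hftc : ∀ t ∈ T, 0 ≤ t → t ≤ b → ∫ s in (0 : ℝ)..t, g (floorTS T s) = f t - f 0 :=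
    fun t ht h0t htb => hT.integral_deltaDeriv hf hT.zero_mem le_rfl ht h0t
      (hint.mono_set (Ico_subset_Ico_right htb))
  have hκ : IntervalIntegrable (fun v => z * q (sigma T (floorTS T v))) volume 0 b :=
    hT.intervalIntegrable_mul_expRatio_sigma le_rfl hz intervalIntegrable_const
  have hgq := hT.intervalIntegrable_mul_expRatio_sigma (z := z) le_rfl hz hgi
  have hpart := hT.integral_mul_integral_sigma hT.zero_mem le_rfl hb h0 hgi hκ
  have hL : ∫ u in (0 : ℝ)..b, (g (floorTS T u) *
      ∫ v in sigma T (floorTS T u)..b, z * q (sigma T (floorTS T v))) =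
      ∫ u in (0 : ℝ)..b, (g (floorTS T u) * q (sigma T (floorTS T u)) -
        q b * g (floorTS T u)) := by
    rw [intervalIntegral.integral_of_le h0, intervalIntegral.integral_of_le h0,
      integral_Ioc_eq_integral_Ioo, integral_Ioc_eq_integral_Ioo]
    refine setIntegral_congr_fun measurableSet_Ioo fun u hu => ?_
    rw [hT.integral_mul_expRatio_sigma hz (hT.sigma_mem _)
      (hu.1.le.trans (hT.le_sigma_floor hu.1.le)) hb (hT.sigma_floor_le hb hu.1.le hu.2)]
    ring
  have hR : ∫ v in (0 : ℝ)..b, (z * q (sigma T (floorTS T v)) *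
      ∫ u in (0 : ℝ)..floorTS T v, g (floorTS T u)) =
      ∫ v in (0 : ℝ)..b, (z * (f (floorTS T v) * q (sigma T (floorTS T v))) -
        f 0 * (z * q (sigma T (floorTS T v)))) := by
    refine intervalIntegral.integral_congr fun v hv => ?_
    rw [uIcc_of_le h0] at hv
    rw [hftc _ (hT.floor_mem v) (hT.floor_nonneg v) ((hT.floor_le hv.1).trans hv.2)]
    ring
  have hfq : IntervalIntegrable (fun v => f (floorTS T v) * q (sigma T (floorTS T v)))
      volume 0 b :=
    hT.intervalIntegrable_mul_expRatio_sigma le_rfl hz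
      (hT.intervalIntegrable_comp_floor hT.zero_mem le_rfl hb h0 hfi)
  rw [hL, hR, intervalIntegral.integral_sub hgq (hgi.const_mul _),
    intervalIntegral.integral_sub (hfq.const_mul _) (hκ.const_mul _),
    intervalIntegral.integral_const_mul, intervalIntegral.integral_const_mul,
    intervalIntegral.integral_const_mul, hftc b hb h0 le_rfl,
    hT.integral_mul_expRatio_sigma hz hT.zero_mem le_rfl hb h0, expRatio_zero] at hpart
  rw [hT.laplacePartial_eq hz hb h0 hfi, hT.laplacePartial_eq hz hb h0 hint]
  linear_combination -hpart

lemma expRatio_eq_div (hT : IsTimeScale T) {w : ℝ} (hw : 0 ≤ w) {z : ℂ} (hz : 0 ≤ z.re) (s : ℝ) :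
    expRatio T 0 z s = expRatio T 0 w s * expRatio T w z s := by
  have h1 := hT.intervalIntegrable_rate hz 0 s
  have h2 := hT.intervalIntegrable_rate (z := w) (by simpa using hw) 0 s
  rw [expRatio, expRatio, expRatio, ← Complex.exp_add]
  simp only [Complex.ofReal_zero, rate_zero, sub_zero]
  rw [intervalIntegral.integral_sub h1 h2]
  ring_nf

/-- The boundary term in the integration by parts vanishes at infinity: at a smaller real argument
it converges, hence is bounded, and the ratio of the two exponentials tends to zero. -/
theorem exists_laplace_deltaDeriv (hT : IsTimeScale T) {f : ℝ → ℂ}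
    (hf : ∀ t ∈ T, 0 ≤ t → DeltaDifferentiableAt T f t) (hL : LaplaceTransformable T f)
    (hL' : LaplaceTransformable T (deltaDeriv T f)) :
    ∃ c : ℝ, ∀ z : ℂ, c < z.re → laplace T (deltaDeriv T f) z = z * laplace T f z - f 0 := by
  obtain ⟨c₁, h₁⟩ := hL
  obtain ⟨c₂, h₂⟩ := hL'
  set w : ℝ := max 0 (max c₁ c₂) + 1 with hw
  have hw0 : 0 < w := by positivity
  have hwc₁ : c₁ < w := by
    have := (le_max_left c₁ c₂).trans (le_max_right 0 _)
    linarith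
  have hwc₂ : c₂ < w := by
    have := (le_max_right c₁ c₂).trans (le_max_right 0 _)
    linarith
  have hev := eventually_atTop_inf T
  have hlim : ∀ z : ℂ, w ≤ z.re → Tendsto (fun b => f b * expRatio T 0 z b) (atTop ⊓ 𝓟 T)
      (𝓝 (f 0 + laplace T (deltaDeriv T f) z - z * laplace T f z)) := by
    intro z hz
    have d₁ := h₁ z (hwc₁.trans_le hz)
    have d₂ := h₂ z (hwc₂.trans_le hz)
    have := (tendsto_const_nhds (x := f 0)).add (tendsto_laplacePartial d₂)
    refine (this.sub ((tendsto_laplacePartial d₁).const_mul z)).congr' ?_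
    filter_upwards [hev] with b hb
    rw [hT.mul_laplacePartial (hw0.le.trans hz) hf hb.1 hb.2 (d₁.1 b) (d₂.1 b)]
    ring
  refine ⟨w, fun z hz => ?_⟩
  have hz0 : 0 ≤ z.re := hw0.le.trans hz.le
  have l1 := hlim z hz.le
  have l2 := (hlim w (by simp)).mul ((hT.tendsto_expRatio hw0 hz).mono_left inf_le_left)
  rw [mul_zero] at l2
  have := hT.neBot_atTop_inf
  have h0 := tendsto_nhds_unique (l1.congr fun b => by
    rw [hT.expRatio_eq_div hw0.le hz0, ← mul_assoc]) l2
  linear_combination h0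

end IsTimeScale

/-! ### Entire functions of exponential type -/

/-- A Phragmén–Lindelöf principle in the half-plane `re z ≤ c`: subexponential growth along one
horizontal ray is enough for the bound on the boundary line to extend to the half-plane. -/
lemma bounded_re_le_of_subexponential {G : ℂ → ℂ} {A B c M : ℝ} (hd : Differentiable ℂ G)
    (hexp : ∀ z, ‖G z‖ ≤ A * Real.exp (B * ‖z‖))
    (hsub : ∀ ε : ℝ, 0 < ε → ∃ C, ∀ x : ℝ, 0 ≤ x → ‖G (c - x)‖ ≤ C * Real.exp (ε * x))
    (hline : ∀ z : ℂ, z.re = c → ‖G z‖ ≤ M) {z : ℂ} (hz : z.re ≤ c) : ‖G z‖ ≤ M := by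
  -- after reflection to the right half-plane, damp by `exp (-ε ζ)` and let `ε → 0`
  set ζ : ℂ := c - z with hζ
  have hζre : 0 ≤ ζ.re := by simp [hζ, hz]
  have hzζ : z = c - ζ := by simp [hζ]
  have hA : 0 ≤ A := by simpa using (norm_nonneg _).trans (hexp 0)
  have key : ∀ ε : ℝ, 0 < ε → ‖Complex.exp (-ε * ζ) * G (c - ζ)‖ ≤ M := by
    intro ε hε
    have hdF : Differentiable ℂ fun ζ : ℂ => Complex.exp (-ε * ζ) * G (c - ζ) :=
      (by fun_prop : Differentiable ℂ fun ζ : ℂ => Complex.exp (-ε * ζ)).mul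
        (hd.comp (by fun_prop : Differentiable ℂ fun ζ : ℂ => (c - ζ : ℂ)))
    refine PhragmenLindelof.right_half_plane_of_bounded_on_real
      (f := fun ζ : ℂ => Complex.exp (-ε * ζ) * G (c - ζ)) hdF.diffContOnCl ?_ ?_ ?_ hζre
    · refine ⟨1, by norm_num, |B|, ?_⟩
      refine Asymptotics.IsBigO.of_bound (A * Real.exp (|B| * |c|)) ?_
      have hmem : {z : ℂ | 0 < z.re} ∈ Bornology.cobounded ℂ ⊓ 𝓟 {z : ℂ | 0 < z.re} :=
        mem_inf_of_right (mem_principal_self _)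
      filter_upwards [hmem] with u hu
      have hu' : 0 < u.re := hu
      rw [Real.rpow_one, Real.norm_of_nonneg (Real.exp_pos _).le, norm_mul, Complex.norm_exp]
      have h1 : Real.exp (-ε * u).re ≤ 1 := by
        rw [Real.exp_le_one_iff]
        have : ((-ε : ℂ) * u).re = -ε * u.re := by
          rw [← Complex.ofReal_neg, Complex.re_ofReal_mul]
        rw [this]
        nlinarith
      have h2 : B * ‖(c - u : ℂ)‖ ≤ |B| * |c| + |B| * ‖u‖ := by
        have h3 : ‖(c - u : ℂ)‖ ≤ |c| + ‖u‖ := by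
          simpa using norm_sub_le (c : ℂ) u
        calc B * ‖(c - u : ℂ)‖ ≤ |B| * ‖(c - u : ℂ)‖ :=
              mul_le_mul_of_nonneg_right (le_abs_self B) (norm_nonneg _)
          _ ≤ |B| * (|c| + ‖u‖) := mul_le_mul_of_nonneg_left h3 (abs_nonneg B)
          _ = _ := by ring
      calc _ ≤ 1 * (A * Real.exp (B * ‖(c - u : ℂ)‖)) :=
            mul_le_mul h1 (hexp _) (norm_nonneg _) zero_le_one
        _ ≤ A * (Real.exp (|B| * |c|) * Real.exp (|B| * ‖u‖)) := by
            rw [one_mul, ← Real.exp_add]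
            exact mul_le_mul_of_nonneg_left (Real.exp_le_exp.2 h2) hA
        _ = _ := by ring
    · obtain ⟨C, hC⟩ := hsub ε hε
      refine ⟨C, ?_⟩
      rw [eventually_map]
      filter_upwards [eventually_ge_atTop 0] with x hx
      rw [norm_mul, Complex.norm_exp]
      have : ((-ε : ℂ) * x).re = -(ε * x) := by simp
      rw [this, Real.exp_neg, inv_mul_le_iff₀ (Real.exp_pos _), mul_comm]
      exact hC x hx
    · intro x
      rw [norm_mul, Complex.norm_exp]
      have : ((-ε : ℂ) * (x * Complex.I)).re = 0 := by simp
      rw [this, Real.exp_zero, one_mul]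
      exact hline _ (by simp)
  have hlim : Tendsto (fun ε : ℝ => ‖Complex.exp (-ε * ζ) * G (c - ζ)‖) (𝓝[>] 0)
      (𝓝 ‖G (c - ζ)‖) := by
    refine Tendsto.mono_left ?_ nhdsWithin_le_nhds
    exact Continuous.tendsto' (by fun_prop) _ _ (by simp)
  rw [hzζ]
  refine le_of_tendsto hlim ?_
  filter_upwards [self_mem_nhdsWithin] with ε hε using key ε hε

/-- An entire function of exponential type, of subexponential growth along the negative real axis
and of at most linear growth in a right half-plane, vanishes if it tends to zero along the positive
real axis: by Phragmén–Lindelöf its difference quotient at a point is bounded. -/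
theorem eq_zero_of_subexponential {H : ℂ → ℂ} {A B c K : ℝ} (hd : Differentiable ℂ H)
    (hB : 0 ≤ B) (hexp : ∀ z, ‖H z‖ ≤ A * Real.exp (B * ‖z‖))
    (hsub : ∀ ε : ℝ, 0 < ε → ∃ C, ∀ x : ℝ, 0 ≤ x → ‖H (-x)‖ ≤ C * Real.exp (ε * x))
    (hc : 0 ≤ c) (hright : ∀ z : ℂ, c ≤ z.re → ‖H z‖ ≤ K * (1 + ‖z‖))
    (hlim : Tendsto (fun x : ℝ => H x) atTop (𝓝 0)) (z : ℂ) : H z = 0 := by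
  have hA : 0 ≤ A := by simpa using (norm_nonneg _).trans (hexp 0)
  -- the difference quotient is taken at a point at distance one from the half-plane `c ≤ re z`
  set p : ℂ := ((c - 1 : ℝ) : ℂ) with hp
  set G : ℂ → ℂ := dslope H p with hG
  have hGd : Differentiable ℂ G := by
    rw [← differentiableOn_univ, hG, Complex.differentiableOn_dslope univ_mem]
    exact hd.differentiableOn
  have hGeq : ∀ z, z ≠ p → G z = (H z - H p) / (z - p) := by
    intro z hz
    rw [hG, dslope_of_ne _ hz, slope_def_field]
  have hGle : ∀ z, 1 ≤ ‖z - p‖ → ‖G z‖ ≤ (‖H z‖ + ‖H p‖) / ‖z - p‖ := by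
    intro z hz
    have hne : z ≠ p := by
      rintro rfl
      simp at hz
      linarith
    rw [hGeq z hne, norm_div]
    gcongr
    exact norm_sub_le _ _
  have hGle' : ∀ z, 1 ≤ ‖z - p‖ → ‖G z‖ ≤ ‖H z‖ + ‖H p‖ := fun z hz =>
    (hGle z hz).trans (div_le_self (by positivity) hz)
  have hfar : ∀ z : ℂ, c ≤ z.re → 1 ≤ ‖z - p‖ := by
    intro z hz
    refine le_trans ?_ (Complex.re_le_norm _)
    simp [hp]
    linarith
  have hK : 0 ≤ K := by
    have h1 := (norm_nonneg _).trans (hright c (by simp))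
    have h2 : 0 < 1 + ‖(c : ℂ)‖ := by positivity
    exact nonneg_of_mul_nonneg_left h1 h2
  set M := K * (2 + ‖p‖) + ‖H p‖ with hM
  have hGright : ∀ z : ℂ, c ≤ z.re → ‖G z‖ ≤ M := by
    intro z hz
    have h1 := hfar z hz
    have h2 : ‖z‖ ≤ ‖z - p‖ + ‖p‖ := by simpa using norm_add_le (z - p) p
    refine (hGle z h1).trans ?_
    rw [div_le_iff₀ (by linarith), hM]
    have h3 := hright z hz
    have h4 : K * (1 + ‖z‖) ≤ K * (2 + ‖p‖) * ‖z - p‖ := by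
      rw [mul_assoc]
      refine mul_le_mul_of_nonneg_left ?_ hK
      nlinarith [norm_nonneg p]
    nlinarith [norm_nonneg (H p)]
  have hGexp : ∃ A', ∀ z, ‖G z‖ ≤ A' * Real.exp (B * ‖z‖) := by
    obtain ⟨C, hC⟩ := (isCompact_closedBall p 1).exists_bound_of_continuousOn
      hGd.continuous.continuousOn
    have hC0 : 0 ≤ C := (norm_nonneg _).trans (hC p (by simp))
    refine ⟨A + ‖H p‖ + C, fun z => ?_⟩
    have h1 : 1 ≤ Real.exp (B * ‖z‖) := Real.one_le_exp (by positivity)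
    by_cases hz : 1 ≤ ‖z - p‖
    · have := (hGle' z hz).trans (add_le_add_left (hexp z) _)
      nlinarith [norm_nonneg (H p)]
    · have := hC z (by rw [mem_closedBall_iff_norm]; linarith)
      nlinarith [norm_nonneg (H p)]
  obtain ⟨A', hA'⟩ := hGexp
  have hGsub : ∀ ε : ℝ, 0 < ε → ∃ C, ∀ x : ℝ, 0 ≤ x → ‖G (c - x)‖ ≤ C * Real.exp (ε * x) := by
    intro ε hε
    obtain ⟨C, hC⟩ := hsub ε hε
    have hC0 : 0 ≤ C := by simpa using (norm_nonneg _).trans (hC 0 le_rfl)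
    obtain ⟨D, hD⟩ := (isCompact_closedBall (0 : ℂ) (c + 2)).exists_bound_of_continuousOn
      hGd.continuous.continuousOn
    have hD0 : 0 ≤ D := (norm_nonneg _).trans (hD 0 (by simp; linarith))
    refine ⟨C + ‖H p‖ + D, fun x hx => ?_⟩
    have h1 : 1 ≤ Real.exp (ε * x) := Real.one_le_exp (by positivity)
    by_cases hxc : c + 2 ≤ x
    · have e : (c - x : ℂ) = -((x - c : ℝ) : ℂ) := by push_cast; ring
      have h2 := hC (x - c) (by linarith)
      rw [← e] at h2
      have h3 : Real.exp (ε * (x - c)) ≤ Real.exp (ε * x) :=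
        Real.exp_le_exp.2 (by nlinarith)
      have h4 : 1 ≤ ‖(c - x : ℂ) - p‖ := by
        have e2 : (c - x : ℂ) - p = ((1 - x : ℝ) : ℂ) := by rw [hp]; push_cast; ring
        rw [e2, Complex.norm_real, Real.norm_eq_abs, abs_of_nonpos (by linarith)]
        linarith
      have h5 := hGle' _ h4
      nlinarith [norm_nonneg (H p), mul_le_mul_of_nonneg_left h3 hC0]
    · have h2 := hD (c - x) (by
        rw [mem_closedBall_zero_iff, ← Complex.ofReal_sub, Complex.norm_real, Real.norm_eq_abs,
          abs_le]
        push Not at hxc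
        constructor <;> linarith)
      nlinarith [norm_nonneg (H p)]
  have hGbdd : ∀ z, ‖G z‖ ≤ M := by
    intro z
    rcases le_total c z.re with h | h
    · exact hGright z h
    · exact bounded_re_le_of_subexponential hGd hA' hGsub (fun w hw => hGright w hw.ge) h
  have hconst : ∀ z w, G z = G w := hGd.apply_eq_apply_of_bounded
    ((isBounded_iff_forall_norm_le).2 ⟨M, by rintro _ ⟨z, rfl⟩; exact hGbdd z⟩)
  have hinv : Tendsto (fun x : ℝ => ((x : ℂ) - p)⁻¹) atTop (𝓝 0) := by
    have h1 : Tendsto (fun x : ℝ => (x - (c - 1))⁻¹) atTop (𝓝 0) :=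
      tendsto_inv_atTop_zero.comp (tendsto_atTop_add_const_right _ _ tendsto_id)
    have h2 := (Complex.continuous_ofReal.tendsto 0).comp h1
    simp only [Complex.ofReal_zero] at h2
    refine h2.congr fun x => ?_
    simp [hp]
  have hG0 : ∀ z, G z = 0 := by
    intro z
    have h1 : Tendsto (fun x : ℝ => G x) atTop (𝓝 0) := by
      have h2 := (hlim.sub_const (H p)).mul hinv
      rw [mul_zero] at h2
      refine h2.congr' ?_
      filter_upwards [eventually_ge_atTop c] with x hx
      have hne : (x : ℂ) ≠ p := by
        intro h
        have := hfar x (by simpa using hx)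
        rw [h] at this
        simp at this
        linarith
      rw [hGeq _ hne, div_eq_mul_inv]
    have h3 : Tendsto (fun _ : ℝ => G z) atTop (𝓝 0) := h1.congr fun x => hconst _ _
    exact tendsto_nhds_unique tendsto_const_nhds h3
  have hHp : ∀ z, H z = H p := by
    intro z
    by_cases hz : z = p
    · rw [hz]
    · have h1 := hGeq z hz
      rw [hG0, eq_comm, div_eq_zero_iff] at h1
      exact sub_eq_zero.1 (h1.resolve_right (sub_ne_zero.2 hz))
  have h4 : Tendsto (fun _ : ℝ => H z) atTop (𝓝 0) :=
    hlim.congr fun x => (hHp x).trans (hHp z).symm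
  exact tendsto_nhds_unique tendsto_const_nhds h4

/-- An integral of entire functions, dominated by one exponential, is entire. -/
lemma differentiable_integral_mul {α : Type*} [MeasurableSpace α] {μ : Measure α} {γ : α → ℂ}
    {K : ℂ → α → ℂ} {B : ℝ} (hγ : Integrable γ μ) (hK : ∀ z, Measurable (K z))
    (hd : ∀ s, Differentiable ℂ fun z => K z s) (hB : 0 ≤ B)
    (hbd : ∀ z s, ‖K z s‖ ≤ Real.exp (B * ‖z‖)) :
    Differentiable ℂ fun z => ∫ s, γ s * K z s ∂μ := by
  intro z₀
  have hint : ∀ z, Integrable (fun s => γ s * K z s) μ := fun z =>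
    hγ.mul_bdd (hK z).aestronglyMeasurable (Eventually.of_forall (hbd z))
  set R := Real.exp (B * (‖z₀‖ + 2)) with hR
  have hderiv : ∀ s, ∀ z ∈ Metric.ball z₀ 1, ‖deriv (fun z => K z s) z‖ ≤ R := by
    intro s z hz
    have h1 := Complex.norm_deriv_le_of_forall_mem_sphere_norm_le (c := z) (R := 1) (C := R)
      one_pos (hd s).diffContOnCl (fun u hu => by
        refine (hbd u s).trans (Real.exp_le_exp.2 (mul_le_mul_of_nonneg_left ?_ hB))
        rw [mem_sphere_iff_norm] at hu
        rw [mem_ball_iff_norm] at hz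
        have h2 : ‖u‖ ≤ ‖u - z‖ + ‖z‖ := by simpa using norm_add_le (u - z) z
        have h3 : ‖z‖ ≤ ‖z - z₀‖ + ‖z₀‖ := by simpa using norm_add_le (z - z₀) z₀
        linarith)
    simpa using h1
  have hdm : AEStronglyMeasurable (fun s => γ s * deriv (fun z => K z s) z₀) μ := by
    refine hγ.aestronglyMeasurable.mul (Measurable.aestronglyMeasurable ?_)
    refine measurable_of_tendsto_metrizable' (𝓝[≠] z₀)
      (f := fun z s => slope (fun u => K u s) z₀ z) (fun z => ?_) ?_
    · simp only [slope_def_field]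
      exact ((hK z).sub (hK z₀)).div_const _
    · rw [tendsto_pi_nhds]
      exact fun s => hasDerivAt_iff_tendsto_slope.1 (hd s z₀).hasDerivAt
  have := hasDerivAt_integral_of_dominated_loc_of_deriv_le (μ := μ) (x₀ := z₀)
    (F := fun z s => γ s * K z s) (F' := fun z s => γ s * deriv (fun z => K z s) z)
    (bound := fun s => ‖γ s‖ * R) (Metric.ball_mem_nhds z₀ one_pos)
    (Eventually.of_forall fun z => (hint z).aestronglyMeasurable) (hint z₀) hdm
    (Eventually.of_forall fun s z hz => by
      rw [norm_mul]
      exact mul_le_mul_of_nonneg_left (hderiv s z hz) (norm_nonneg _))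
    (hγ.norm.mul_const R)
    (Eventually.of_forall fun s z _ => ((hd s z).hasDerivAt.const_mul (γ s)))
  exact this.2.differentiableAt

/-! ### Infinite products of genus zero -/

section Product

variable {ι : Type*} {u w : ι → ℝ}

lemma multipliable_one_add_mul (hu : Summable u) (hw0 : ∀ i, 0 ≤ w i) (hwu : ∀ i, w i ≤ u i)
    (z : ℂ) : Multipliable fun i => 1 + (w i : ℂ) * z := by
  refine Complex.multipliable_one_add_of_summable ?_
  have hw : Summable w := Summable.of_nonneg_of_le hw0 hwu hu
  exact (Complex.summable_ofReal.2 hw).mul_right z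

lemma differentiable_tprod_one_add_mul (hu : Summable u) (hw0 : ∀ i, 0 ≤ w i)
    (hwu : ∀ i, w i ≤ u i) : Differentiable ℂ fun z : ℂ => ∏' i, (1 + (w i : ℂ) * z) := by
  intro z₀
  have hw : Summable w := Summable.of_nonneg_of_le hw0 hwu hu
  have h := (hw.mul_right (‖z₀‖ + 1)).hasProdLocallyUniformlyOn_one_add
    (f := fun i (z : ℂ) => (w i : ℂ) * z) (Metric.isOpen_ball (x := z₀) (ε := 1))
    (Eventually.of_forall fun i z hz => by
      rw [norm_mul, Complex.norm_of_nonneg (hw0 i)]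
      refine mul_le_mul_of_nonneg_left ?_ (hw0 i)
      rw [mem_ball_iff_norm] at hz
      have h3 : ‖z‖ ≤ ‖z - z₀‖ + ‖z₀‖ := by simpa using norm_add_le (z - z₀) z₀
      linarith) (fun i => by fun_prop)
  have h2 := h.differentiableOn (Eventually.of_forall fun s => by
    simpa [Finset.prod_fn] using DifferentiableOn.finsetProd (fun i _ => by fun_prop))
    Metric.isOpen_ball
  exact h2.differentiableAt (Metric.ball_mem_nhds z₀ one_pos)

lemma norm_tprod_le_of_forall_prod_le (hu : Summable u) (hw0 : ∀ i, 0 ≤ w i)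
    (hwu : ∀ i, w i ≤ u i) {z : ℂ} {C : ℝ} (h : ∀ s : Finset ι, ∏ i ∈ s, (1 + u i * ‖z‖) ≤ C) :
    ‖∏' i, (1 + (w i : ℂ) * z)‖ ≤ C := by
  refine le_of_tendsto (multipliable_one_add_mul hu hw0 hwu z).hasProd.norm
    (Eventually.of_forall fun s => ?_)
  refine le_trans (Finset.prod_le_prod (fun i _ => norm_nonneg _) fun i _ => ?_) (h s)
  refine (norm_add_le _ _).trans ?_
  rw [norm_one, norm_mul, Complex.norm_of_nonneg (hw0 i)]
  gcongr
  exact hwu i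

lemma norm_tprod_le_exp (hu : Summable u) (hw0 : ∀ i, 0 ≤ w i)
    (hwu : ∀ i, w i ≤ u i) (z : ℂ) :
    ‖∏' i, (1 + (w i : ℂ) * z)‖ ≤ Real.exp ((∑' i, u i) * ‖z‖) := by
  have hu0 : ∀ i, 0 ≤ u i := fun i => (hw0 i).trans (hwu i)
  refine norm_tprod_le_of_forall_prod_le hu hw0 hwu fun s => ?_
  calc ∏ i ∈ s, (1 + u i * ‖z‖) ≤ ∏ i ∈ s, Real.exp (u i * ‖z‖) := by
        refine Finset.prod_le_prod (fun i _ => ?_) fun i _ => ?_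
        · have := hu0 i; positivity
        · rw [add_comm]; exact Real.add_one_le_exp _
    _ = Real.exp ((∑ i ∈ s, u i) * ‖z‖) := by rw [← Real.exp_sum, Finset.sum_mul]
    _ ≤ _ := Real.exp_le_exp.2 (mul_le_mul_of_nonneg_right (hu.sum_le_tsum s fun i _ => hu0 i)
        (norm_nonneg _))

/-- A product of genus zero is of minimal exponential type, uniformly in its zeros as long as these
are dominated: finitely many factors grow polynomially, and the others contribute as little to the
exponential type as desired. -/
lemma exists_norm_tprod_le_exp (hu : Summable u) (hu0 : ∀ i, 0 ≤ u i) {ε : ℝ} (hε : 0 < ε) :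
    ∃ C, 0 ≤ C ∧ ∀ (w : ι → ℝ), (∀ i, 0 ≤ w i) → (∀ i, w i ≤ u i) → ∀ z : ℂ,
      ‖∏' i, (1 + (w i : ℂ) * z)‖ ≤ C * Real.exp (ε * ‖z‖) := by
  classical
  obtain ⟨F, hF⟩ : ∃ F : Finset ι, ∀ t : Finset ι, Disjoint t F → ∑ i ∈ t, u i < ε / 2 := by
    obtain ⟨F, hF⟩ := summable_iff_vanishing_norm.1 hu (ε / 2) (by positivity)
    exact ⟨F, fun t ht => (le_abs_self _).trans_lt (hF t ht)⟩
  set δ := ε / (2 * (F.card + 1)) with hδ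
  have hδ0 : 0 < δ := by positivity
  have hone : ∀ i, 1 ≤ max 1 (u i / δ) := fun i => le_max_left _ _
  refine ⟨∏ i ∈ F, max 1 (u i / δ), Finset.prod_nonneg fun i _ => zero_le_one.trans (hone i),
    fun w hw0 hwu z => norm_tprod_le_of_forall_prod_le hu hw0 hwu fun s => ?_⟩
  have hfac : ∀ i, 0 ≤ 1 + u i * ‖z‖ := fun i => by
    have := hu0 i; positivity
  have hfac1 : ∀ i, 1 ≤ 1 + u i * ‖z‖ := fun i => by
    have := mul_nonneg (hu0 i) (norm_nonneg z); linarith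
  have h1 : ∏ i ∈ F, (1 + u i * ‖z‖) ≤ (∏ i ∈ F, max 1 (u i / δ)) * Real.exp (ε / 2 * ‖z‖) := by
    calc ∏ i ∈ F, (1 + u i * ‖z‖) ≤ ∏ i ∈ F, (max 1 (u i / δ) * Real.exp (δ * ‖z‖)) := by
          refine Finset.prod_le_prod (fun i _ => hfac i) fun i _ => ?_
          have h2 : δ * ‖z‖ + 1 ≤ Real.exp (δ * ‖z‖) := Real.add_one_le_exp _
          have h3 : u i ≤ max 1 (u i / δ) * δ := by
            rw [← div_le_iff₀ hδ0]; exact le_max_right _ _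
          calc 1 + u i * ‖z‖ ≤ max 1 (u i / δ) * 1 + max 1 (u i / δ) * δ * ‖z‖ := by
                have := mul_le_mul_of_nonneg_right h3 (norm_nonneg z)
                linarith [hone i]
            _ = max 1 (u i / δ) * (δ * ‖z‖ + 1) := by ring
            _ ≤ _ := mul_le_mul_of_nonneg_left h2 (zero_le_one.trans (hone i))
      _ = (∏ i ∈ F, max 1 (u i / δ)) * Real.exp (F.card * (δ * ‖z‖)) := by
          rw [Finset.prod_mul_distrib, Finset.prod_const, ← Real.exp_nat_mul]
      _ ≤ _ := by
          refine mul_le_mul_of_nonneg_left (Real.exp_le_exp.2 ?_)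
            (Finset.prod_nonneg fun i _ => zero_le_one.trans (hone i))
          have h4 : F.card * δ ≤ ε / 2 := by
            rw [hδ, mul_div_assoc', div_le_div_iff₀ (by positivity) (by norm_num)]
            nlinarith
          nlinarith [norm_nonneg z]
  have h2 : ∏ i ∈ s \ F, (1 + u i * ‖z‖) ≤ Real.exp (ε / 2 * ‖z‖) := by
    calc ∏ i ∈ s \ F, (1 + u i * ‖z‖) ≤ ∏ i ∈ s \ F, Real.exp (u i * ‖z‖) := by
          refine Finset.prod_le_prod (fun i _ => hfac i) fun i _ => ?_
          rw [add_comm]; exact Real.add_one_le_exp _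
      _ = Real.exp ((∑ i ∈ s \ F, u i) * ‖z‖) := by rw [← Real.exp_sum, Finset.sum_mul]
      _ ≤ _ := Real.exp_le_exp.2 (mul_le_mul_of_nonneg_right (hF _ Finset.sdiff_disjoint).le
          (norm_nonneg _))
  calc ∏ i ∈ s, (1 + u i * ‖z‖) ≤ ∏ i ∈ F ∪ s \ F, (1 + u i * ‖z‖) := by
        have h3 : ∏ i ∈ F \ s, (1 : ℝ) ≤ ∏ i ∈ F \ s, (1 + u i * ‖z‖) :=
          Finset.prod_le_prod (fun _ _ => zero_le_one) fun i _ => hfac1 i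
        rw [Finset.prod_const_one] at h3
        rw [Finset.union_sdiff_self_eq_union, Finset.union_comm, ← Finset.union_sdiff_self_eq_union,
          Finset.prod_union Finset.disjoint_sdiff]
        exact le_mul_of_one_le_right (Finset.prod_nonneg fun i _ => hfac i) h3
    _ = (∏ i ∈ F, (1 + u i * ‖z‖)) * ∏ i ∈ s \ F, (1 + u i * ‖z‖) :=
        Finset.prod_union Finset.disjoint_sdiff
    _ ≤ ((∏ i ∈ F, max 1 (u i / δ)) * Real.exp (ε / 2 * ‖z‖)) * Real.exp (ε / 2 * ‖z‖) :=
        mul_le_mul h1 h2 (Finset.prod_nonneg fun i _ => hfac i) (by positivity)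
    _ = _ := by
        rw [mul_assoc, ← Real.exp_add, ← add_mul, add_halves]

end Product

/-! ### The entire continuation of the exponential -/

/-- The graininess at the right-scattered point `i` if `i` lies in `[s, a)`, and zero otherwise. -/
noncomputable def gapWeight (T : Set ℝ) (a s : ℝ) (i : {t : ℝ // t ∈ T ∧ t < sigma T t}) : ℝ :=
  open Classical in if s ≤ i ∧ (i : ℝ) < a then graininess T i else 0

/-- The exponential `e_z(a, s)` as an entire function of `z`: every gap of `T ∩ [s, a)` contributes
a factor `1 + μ z`, and the rest contributes `exp (λ z)`, where `λ` is its Lebesgue measure. -/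
noncomputable def expEntire (T : Set ℝ) (a : ℝ) (z : ℂ) (s : ℝ) : ℂ :=
  Complex.exp (volume.real (T ∩ Ico s a) * z) * ∏' i, (1 + (gapWeight T a s i : ℂ) * z)

namespace IsTimeScale

lemma integrableOn_of_bound (hT : IsTimeScale T) {f : ℝ → ℂ} {s a C : ℝ} (hs : s ∈ T)
    (h0 : 0 ≤ s) (ha : a ∈ T) (hf : Measurable f) (hC : ∀ t, ‖f t‖ ≤ C) :
    IntegrableOn f (Ico s a) (deltaMeasure T) := by
  refine Measure.integrableOn_of_bounded (M := C) ?_ hf.aestronglyMeasurable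
    (Eventually.of_forall hC)
  rw [← Measure.restrict_apply_univ, hT.deltaMeasure_restrict_Ico hs h0 ha,
    Measure.map_apply hT.measurable_floor MeasurableSet.univ]
  simp

/-- A `Δ`-integral of a function of the graininess splits into a Lebesgue part and a sum over the
gaps. -/
lemma hasSum_gapWeight (hT : IsTimeScale T) {h : ℝ → ℂ} {s a C : ℝ} (hs : s ∈ T)
    (h0 : 0 ≤ s) (ha : a ∈ T) (hsa : s ≤ a) (hm : Measurable h)
    (hC : ∀ m, 0 ≤ m → ‖h m‖ ≤ C) :
    HasSum (fun i => (gapWeight T a s i : ℂ) * h (graininess T i))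
      ((∫ u in s..a, h (graininess T (floorTS T u))) - volume.real (T ∩ Ico s a) * h 0) := by
  classical
  have hfm : Measurable fun t => h (graininess T t) := hm.comp hT.measurable_graininess
  have hint := hT.integrableOn_of_bound hs h0 ha hfm fun t => hC _ (hT.graininess_nonneg t)
  have hTm : MeasurableSet T := hT.isClosed.measurableSet
  rw [← hT.setIntegral_deltaMeasure (f := fun t => h (graininess T t)) hs h0 ha hsa
    hfm.aestronglyMeasurable]
  rw [IntegrableOn, deltaMeasure, Measure.restrict_add, Measure.restrict_sum _ measurableSet_Ico]
    at hint
  rw [deltaMeasure, Measure.restrict_add, Measure.restrict_sum _ measurableSet_Ico,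
    integral_add_measure hint.left_of_add_measure hint.right_of_add_measure]
  have hleb : ∫ t, h (graininess T t) ∂((volume.restrict T).restrict (Ico s a)) =
      volume.real (T ∩ Ico s a) * h 0 := by
    have hnull : ∀ᵐ t : ℝ, t ∉ {t | t ∈ T ∧ t < sigma T t} :=
      measure_eq_zero_iff_ae_notMem.1 (hT.countable_scattered.measure_zero volume)
    have : ∀ᵐ t ∂((volume.restrict T).restrict (Ico s a)), h (graininess T t) = h 0 := by
      rw [Measure.restrict_restrict measurableSet_Ico]
      refine (ae_restrict_iff' (measurableSet_Ico.inter hTm)).2 ?_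
      filter_upwards [hnull] with t ht htT
      have h1 : sigma T t = t :=
        le_antisymm (not_lt.1 fun h => ht ⟨htT.2, h⟩) (hT.le_sigma t)
      rw [graininess, h1, sub_self]
    rw [integral_congr_ae this, integral_const, Measure.restrict_restrict measurableSet_Ico,
      measureReal_restrict_apply_univ, inter_comm, Complex.real_smul]
  rw [hleb, add_sub_cancel_left]
  suffices e : (fun i => (gapWeight T a s i : ℂ) * h (graininess T i)) =
      fun i : {t : ℝ // t ∈ T ∧ t < sigma T t} => ∫ t, h (graininess T t)
        ∂((ENNReal.ofReal (graininess T i) • Measure.dirac (i : ℝ)).restrict (Ico s a)) by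
    rw [e]
    exact hasSum_integral_measure hint.right_of_add_measure
  ext i
  rw [Measure.restrict_smul, restrict_dirac' measurableSet_Ico, integral_smul_measure,
    ENNReal.toReal_ofReal (hT.graininess_nonneg _), gapWeight]
  by_cases hi : s ≤ (i : ℝ) ∧ (i : ℝ) < a
  · rw [if_pos hi, if_pos (show (i : ℝ) ∈ Ico s a from hi), integral_dirac, Complex.real_smul]
  · rw [if_neg hi, if_neg (show (i : ℝ) ∉ Ico s a from hi)]
    simp

lemma gapWeight_nonneg (hT : IsTimeScale T) (a s : ℝ) (i : {t : ℝ // t ∈ T ∧ t < sigma T t}) :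
    0 ≤ gapWeight T a s i := by
  rw [gapWeight]
  split_ifs
  · exact hT.graininess_nonneg _
  · exact le_rfl

lemma gapWeight_le (hT : IsTimeScale T) (a : ℝ) {s : ℝ} (hs : 0 ≤ s)
    (i : {t : ℝ // t ∈ T ∧ t < sigma T t}) : gapWeight T a s i ≤ gapWeight T a 0 i := by
  by_cases h : s ≤ (i : ℝ) ∧ (i : ℝ) < a
  · rw [gapWeight, gapWeight, if_pos h, if_pos ⟨hs.trans h.1, h.2⟩]
  · rw [gapWeight, if_neg h]
    exact hT.gapWeight_nonneg a 0 i

lemma summable_gapWeight (hT : IsTimeScale T) {a : ℝ} (ha : a ∈ T) (h0 : 0 ≤ a) :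
    Summable (gapWeight T a 0) := by
  have h := (hT.hasSum_gapWeight (h := fun _ => 1) (C := 1) hT.zero_mem le_rfl ha h0
    measurable_const (fun _ _ => by simp)).summable
  simp only [mul_one] at h
  exact Complex.summable_ofReal.1 h

/-- For `z` in the right half-plane the entire continuation is the exponential of the rate. -/
lemma expEntire_eq (hT : IsTimeScale T) {s a : ℝ} (hs : s ∈ T) (h0 : 0 ≤ s) (ha : a ∈ T)
    (hsa : s ≤ a) {z : ℂ} (hz : 0 ≤ z.re) :
    expEntire T a z s = Complex.exp (∫ u in s..a, rate T z u) := by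
  have h := hT.hasSum_gapWeight (h := fun m => cylinder m z) (C := ‖z‖) hs h0 ha hsa
    (measurable_cylinder z) (fun m hm => norm_cylinder_le hm hz)
  have hp := h.cexp
  have he : (Complex.exp ∘ fun i => (gapWeight T a s i : ℂ) * cylinder (graininess T i) z) =
      fun i => 1 + (gapWeight T a s i : ℂ) * z := by
    ext i
    simp only [Function.comp]
    by_cases hi : s ≤ (i : ℝ) ∧ (i : ℝ) < a
    · rw [gapWeight, if_pos hi, exp_mul_cylinder (hT.graininess_nonneg _) hz]
    · rw [gapWeight, if_neg hi]
      simp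
  rw [he] at hp
  rw [expEntire, hp.tprod_eq, ← Complex.exp_add, cylinder_zero]
  congr 1
  simp only [rate]
  ring

lemma expEntire_zero (a s : ℝ) : expEntire T a 0 s = 1 := by simp [expEntire]

lemma differentiable_expEntire (hT : IsTimeScale T) {a : ℝ} (ha : a ∈ T) (h0a : 0 ≤ a) {s : ℝ}
    (hs : 0 ≤ s) : Differentiable ℂ fun z => expEntire T a z s := by
  unfold expEntire
  exact (by fun_prop : Differentiable ℂ fun z : ℂ =>
    Complex.exp (volume.real (T ∩ Ico s a) * z)).mul
    (differentiable_tprod_one_add_mul (hT.summable_gapWeight ha h0a) (hT.gapWeight_nonneg a s)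
      (hT.gapWeight_le a hs))

lemma measurable_expEntire (hT : IsTimeScale T) {a : ℝ} (ha : a ∈ T) (h0a : 0 ≤ a) (z : ℂ) :
    Measurable fun s => expEntire T a z (max s 0) := by
  classical
  have := hT.countable_gaps
  have hvol : Measurable fun s : ℝ => volume.real (T ∩ Ico s a) := by
    refine Antitone.measurable fun s t hst => ?_
    refine measureReal_mono (inter_subset_inter_right _ (Ico_subset_Ico_left hst)) ?_
    exact ((measure_mono inter_subset_right).trans_lt (by simp)).ne
  have hw : ∀ i, Measurable fun s => gapWeight T a s i := by
    intro i
    unfold gapWeight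
    refine Measurable.ite ?_ measurable_const measurable_const
    exact measurableSet_Iic.inter (MeasurableSet.const _)
  have hmax : Measurable fun s : ℝ => max s 0 := by fun_prop
  unfold expEntire
  refine Measurable.mul ?_ ?_
  · have := hvol.comp hmax
    exact Complex.measurable_exp.comp ((Complex.measurable_ofReal.comp this).mul_const z)
  · refine measurable_of_tendsto_metrizable' (atTop : Filter (Finset _))
      (f := fun F s => ∏ i ∈ F, (1 + (gapWeight T a (max s 0) i : ℂ) * z)) (fun F => ?_) ?_
    · refine Finset.measurable_fun_prod _ fun i _ => ?_
      exact ((Complex.measurable_ofReal.comp ((hw i).comp hmax)).mul_const z).const_add 1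
    · rw [tendsto_pi_nhds]
      intro s
      exact (multipliable_one_add_mul (hT.summable_gapWeight ha h0a) (hT.gapWeight_nonneg a _)
        (hT.gapWeight_le a (le_max_right s 0)) z).hasProd

lemma volume_real_inter_Ico_le (T : Set ℝ) {a s : ℝ} (h0a : 0 ≤ a) (hs : 0 ≤ s) :
    volume.real (T ∩ Ico s a) ≤ a := by
  calc volume.real (T ∩ Ico s a) ≤ volume.real (Ico 0 a) :=
        measureReal_mono (inter_subset_right.trans (Ico_subset_Ico_left hs)) (by simp)
    _ = a := by simp [h0a]

lemma norm_expEntire_le (hT : IsTimeScale T) {a : ℝ} (ha : a ∈ T) (h0a : 0 ≤ a) {s : ℝ}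
    (hs : 0 ≤ s) (z : ℂ) :
    ‖expEntire T a z s‖ ≤ Real.exp ((a + ∑' i, gapWeight T a 0 i) * ‖z‖) := by
  rw [expEntire, norm_mul, add_mul, Real.exp_add]
  refine mul_le_mul ?_ (norm_tprod_le_exp (hT.summable_gapWeight ha h0a)
    (hT.gapWeight_nonneg a s) (hT.gapWeight_le a hs) z) (norm_nonneg _) (Real.exp_pos _).le
  rw [Complex.norm_exp]
  refine Real.exp_le_exp.2 ((Complex.re_le_norm _).trans ?_)
  rw [norm_mul, Complex.norm_of_nonneg measureReal_nonneg]
  exact mul_le_mul_of_nonneg_right (volume_real_inter_Ico_le T h0a hs) (norm_nonneg _)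

/-- Along the negative real axis the factor `exp (λ z)` is bounded, and only the product of minimal
exponential type remains. -/
lemma exists_norm_expEntire_neg_le (hT : IsTimeScale T) {a : ℝ} (ha : a ∈ T) (h0a : 0 ≤ a)
    {ε : ℝ} (hε : 0 < ε) : ∃ C, 0 ≤ C ∧ ∀ s x : ℝ, 0 ≤ s → 0 ≤ x →
      ‖expEntire T a (-x) s‖ ≤ C * Real.exp (ε * x) := by
  obtain ⟨C, hC0, hC⟩ := exists_norm_tprod_le_exp (hT.summable_gapWeight ha h0a)
    (hT.gapWeight_nonneg a 0) hε
  refine ⟨C, hC0, fun s x hs hx => ?_⟩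
  have h := hC _ (hT.gapWeight_nonneg a s) (hT.gapWeight_le a hs) (-x)
  rw [norm_neg, Complex.norm_of_nonneg hx] at h
  rw [expEntire, norm_mul, Complex.norm_exp]
  refine (mul_le_of_le_one_left (norm_nonneg _) ?_).trans h
  rw [Real.exp_le_one_iff, Complex.re_ofReal_mul]
  have : (0 : ℝ) ≤ volume.real (T ∩ Ico s a) := measureReal_nonneg
  simp only [Complex.neg_re, Complex.ofReal_re]
  nlinarith

/-! ### Uniqueness of the Laplace transform -/

lemma norm_exp_neg_integral_rate_le (hT : IsTimeScale T) {a b : ℝ} (ha : a ∈ T) (h0a : 0 ≤ a)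
    (hb : b ∈ T) (hab : a < b) {x : ℝ} (hx : 0 ≤ x) :
    ‖Complex.exp (-∫ u in a..b, rate T x u)‖ ≤ (1 + (b - a) * x)⁻¹ := by
  have hM : 0 < b - a := by linarith
  have hint := hT.intervalIntegrable_rate (z := x) (by simpa using hx) a b
  have hp : 0 < 1 + (b - a) * x := by positivity
  rw [Complex.norm_exp, ← Real.exp_log hp, ← Real.exp_neg]
  refine Real.exp_le_exp.2 ?_
  rw [Complex.neg_re]
  refine neg_le_neg ?_
  have e : (∫ u in a..b, rate T x u).re = ∫ u in a..b, (rate T x u).re :=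
    (Complex.reCLM.intervalIntegral_comp_comm hint).symm
  rw [e]
  have h1 : ∫ u in a..b, Real.log (1 + (b - a) * x) / (b - a) ≤ ∫ u in a..b, (rate T x u).re := by
    refine intervalIntegral.integral_mono_on_of_le_Ioo hab.le (by simp) ⟨hint.1.re, hint.2.re⟩
      fun u hu => ?_
    have h2 := hT.sigma_floor_le hb (h0a.trans hu.1.le) hu.2
    have h3 : a ≤ floorTS T u := le_floor ha hu.1.le
    have h4 : graininess T (floorTS T u) ≤ b - a := by
      rw [graininess]; linarith
    have := log_div_le_re_cylinder (hT.graininess_nonneg _) hM h4 (z := x) (by simpa using hx)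
    simpa [rate] using this
  rw [intervalIntegral.integral_const, smul_eq_mul, mul_div_cancel₀ _ hM.ne'] at h1
  exact h1

/-- On the real axis the hypothesis of the Abel summation bound holds with constant one. -/
lemma norm_rate_ofReal_sub (hT : IsTimeScale T) {x w : ℝ} (hw : 0 ≤ w) (hx : w ≤ x) (s : ℝ) :
    ‖rate T x s - rate T w s‖ = (rate T x s - rate T w s).re := by
  have him : ∀ y : ℝ, 0 ≤ y → (rate T y s).im = 0 := by
    intro y hy
    have hg := hT.graininess_nonneg (floorTS T s)
    rcases hg.eq_or_lt with h | h
    · rw [rate, ← h, cylinder_zero, Complex.ofReal_im]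
    · rw [rate, cylinder_of_ne h.ne', Complex.div_ofReal_im, Complex.log_im]
      have : (1 + graininess T (floorTS T s) * y : ℂ) =
          ((1 + graininess T (floorTS T s) * y : ℝ) : ℂ) := by push_cast; rfl
      rw [this, Complex.arg_ofReal_of_nonneg (by positivity), zero_div]
  have h1 := hT.re_rate_sub_nonneg hw (z := x) (by simpa using hx) s
  have h2 : (rate T x s - rate T w s).im = 0 := by
    rw [Complex.sub_im, him x (hw.trans hx), him w hw, sub_zero]
  have h3 : rate T x s - rate T w s = (((rate T x s - rate T w s).re : ℝ) : ℂ) :=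
    Complex.ext (by simp) (by rw [h2, Complex.ofReal_im])
  rw [h3, Complex.norm_of_nonneg h1, Complex.ofReal_re]

/-- The hypothesis of the Abel summation bound, with a constant that is linear in `‖z - w‖`. -/
lemma norm_rate_sub_le (hT : IsTimeScale T) {w : ℝ} (hw : 0 < w) {z : ℂ} (hz : w + 1 ≤ z.re)
    (s : ℝ) : ‖rate T z s - rate T w s‖ ≤
      ‖z - w‖ * (1 + 1 / w) * (rate T z s - rate T w s).re := by
  have hg := hT.graininess_nonneg (floorTS T s)
  have h1 := norm_cylinder_sub_le hg hw.le (z := z) (by linarith)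
  have h2 := le_re_cylinder_sub hg hw (z := z) (by linarith)
  have hp : 0 < 1 + graininess T (floorTS T s) * w := by positivity
  have hκ : 1 ≤ (1 + 1 / w) * ((z.re - w) / (1 + (z.re - w) / w)) := by
    have hx : 1 ≤ z.re - w := by linarith
    have hq : 0 < 1 + (z.re - w) / w := by positivity
    rw [mul_div_assoc', le_div_iff₀ hq, one_mul, add_mul, one_mul, one_div_mul_eq_div]
    linarith
  rw [rate, rate]
  calc _ ≤ ‖z - w‖ / (1 + graininess T (floorTS T s) * w) := h1
    _ = ‖z - w‖ * (1 / (1 + graininess T (floorTS T s) * w)) := by ring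
    _ ≤ ‖z - w‖ * ((1 + 1 / w) * ((z.re - w) / (1 + (z.re - w) / w)) *
        (1 / (1 + graininess T (floorTS T s) * w))) :=
        mul_le_mul_of_nonneg_left (le_mul_of_one_le_left (by positivity) hκ) (norm_nonneg _)
    _ = ‖z - w‖ * (1 + 1 / w) * ((z.re - w) / (1 + (z.re - w) / w) /
        (1 + graininess T (floorTS T s) * w)) := by ring
    _ ≤ _ := mul_le_mul_of_nonneg_left h2 (by positivity)

lemma norm_laplacePartial_bounded (hT : IsTimeScale T) {g : ℝ → ℂ} {w : ℝ} (hw : 0 ≤ w)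
    (hg : ∀ b : ℝ, IntegrableOn g (Ico 0 b) (deltaMeasure T))
    (hlim : Tendsto (laplacePartial T g w) (atTop ⊓ 𝓟 T) (𝓝 0)) :
    ∃ S, ∀ r ∈ T, 0 ≤ r →
      ‖∫ s in (0 : ℝ)..r, g (floorTS T s) * expRatio T 0 w (sigma T (floorTS T s))‖ ≤ S := by
  have hw' : 0 ≤ (w : ℂ).re := by simpa using hw
  set γ : ℝ → ℂ := fun s => g (floorTS T s) * expRatio T 0 w (sigma T (floorTS T s)) with hγ
  have hγi : ∀ r ∈ T, 0 ≤ r → IntervalIntegrable γ volume 0 r := fun r hr h0 =>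
    hT.intervalIntegrable_mul_expRatio_sigma le_rfl hw'
      (hT.intervalIntegrable_comp_floor hT.zero_mem le_rfl hr h0 (hg r))
  have hev : ∀ᶠ b in atTop ⊓ 𝓟 T, ‖laplacePartial T g w b‖ ≤ 1 := by
    have := hlim.norm
    rw [norm_zero] at this
    exact (this.eventually_lt_const zero_lt_one).mono fun _ h => h.le
  rw [eventually_inf_principal, eventually_atTop] at hev
  obtain ⟨R, hR⟩ := hev
  obtain ⟨R', hR', hRR'⟩ := hT.nonempty_Ioi (max R 0)
  have hRR' : max R 0 < R' := hRR'
  have h0R' : 0 ≤ R' := (le_max_right R 0).trans hRR'.le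
  have hcont : ContinuousOn (fun r => ∫ s in (0 : ℝ)..r, γ s) (Icc 0 R') := by
    have := intervalIntegral.continuousOn_primitive_interval'
      (hγi R' hR' h0R') (left_mem_uIcc)
    rwa [uIcc_of_le h0R'] at this
  obtain ⟨C, hC⟩ := isCompact_Icc.exists_bound_of_continuousOn hcont
  refine ⟨max C 1, fun r hr h0 => ?_⟩
  rcases le_total r R' with h | h
  · exact (hC r ⟨h0, h⟩).trans (le_max_left _ _)
  · have := hR r (((le_max_left R 0).trans hRR'.le).trans h) hr
    rw [hT.laplacePartial_eq hw' hr h0 (hg r)] at this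
    exact this.trans (le_max_right _ _)

/-- If the Laplace transform of `g` vanishes in a right half-plane, then so do all `Δ`-integrals of
`g` from `0` to a point `a` of the time scale. Indeed
`H(z) = ∫_0^a g(t) e_z(a, σ(t)) Δt` is entire, and in the half-plane it is also minus the tail
`∫_a^∞ g(t) e_{⊖z}(σ(t), a) Δt`, which Abel summation controls; these two descriptions force
`H = 0`, and `H(0)` is the integral in question. -/
theorem integral_eq_zero_of_laplace_eq_zero (hT : IsTimeScale T) {g : ℝ → ℂ} {c : ℝ}
    (hg : ∀ b : ℝ, IntegrableOn g (Ico 0 b) (deltaMeasure T))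
    (hlim : ∀ z : ℂ, c < z.re → Tendsto (laplacePartial T g z) (atTop ⊓ 𝓟 T) (𝓝 0))
    {a : ℝ} (ha : a ∈ T) (h0a : 0 ≤ a) : ∫ s in (0 : ℝ)..a, g (floorTS T s) = 0 := by
  set w : ℝ := max 0 c + 1 with hw
  have hw0 : 0 < w := by positivity
  have hcw : c < w := by linarith [le_max_right 0 c]
  have hww : (0 : ℝ) ≤ (w : ℂ).re := by simpa using hw0.le
  have hgi : ∀ r ∈ T, 0 ≤ r → IntervalIntegrable (fun s => g (floorTS T s)) volume 0 r :=
    fun r hr h0 => hT.intervalIntegrable_comp_floor hT.zero_mem le_rfl hr h0 (hg r)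
  have hgi' : ∀ p ∈ T, 0 ≤ p → ∀ r ∈ T, 0 ≤ r →
      IntervalIntegrable (fun s => g (floorTS T s)) volume p r :=
    fun p hp h0p r hr h0 => (hgi p hp h0p).symm.trans (hgi r hr h0)
  set L : ℂ → ℝ → ℂ := fun z b =>
    ∫ s in (0 : ℝ)..b, g (floorTS T s) * expRatio T 0 z (sigma T (floorTS T s)) with hL
  have hLlim : ∀ z : ℂ, w ≤ z.re → Tendsto (L z) (atTop ⊓ 𝓟 T) (𝓝 0) := by
    intro z hz
    refine (hlim z (hcw.trans_le hz)).congr' ?_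
    filter_upwards [eventually_atTop_inf T] with b hb
    exact hT.laplacePartial_eq (hw0.le.trans hz) hb.1 hb.2 (hg b)
  have hLsub : ∀ z : ℂ, 0 ≤ z.re → ∀ p ∈ T, 0 ≤ p → ∀ r ∈ T, 0 ≤ r → L z r - L z p =
      ∫ s in p..r, g (floorTS T s) * expRatio T 0 z (sigma T (floorTS T s)) := by
    intro z hz p hp h0p r hr h0r
    exact intervalIntegral.integral_interval_sub_left
      (hT.intervalIntegrable_mul_expRatio_sigma le_rfl hz (hgi r hr h0r))
      (hT.intervalIntegrable_mul_expRatio_sigma le_rfl hz (hgi p hp h0p))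
  obtain ⟨S, hS⟩ := hT.norm_laplacePartial_bounded hw0.le hg (hlim w (by simpa using hcw))
  have hS0 : 0 ≤ S := (norm_nonneg _).trans (hS 0 hT.zero_mem le_rfl)
  -- tails of the Laplace integral, bounded by Abel summation relative to the point `w`
  have htail : ∀ z : ℂ, w ≤ z.re → ∀ C : ℝ, 0 ≤ C →
      (∀ s, ‖rate T z s - rate T w s‖ ≤ C * (rate T z s - rate T w s).re) →
      ∀ p ∈ T, 0 ≤ p → ‖L z p‖ ≤ 2 * S * (1 + C) * ‖expRatio T w z p‖ := by
    intro z hz C hC0 hC p hp h0p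
    have hz0 : 0 ≤ z.re := hw0.le.trans hz
    have h1 : Tendsto (fun b => ‖L z b - L z p‖) (atTop ⊓ 𝓟 T) (𝓝 ‖L z p‖) := by
      have := ((hLlim z hz).sub_const (L z p)).norm
      rwa [zero_sub, norm_neg] at this
    have := hT.neBot_atTop_inf
    refine le_of_tendsto h1 ?_
    filter_upwards [eventually_atTop_inf T, (eventually_ge_atTop p).filter_mono inf_le_left]
      with b hb hpb
    rw [hLsub z hz0 p hp h0p b hb.1 hb.2]
    have e : (fun s => g (floorTS T s) * expRatio T 0 z (sigma T (floorTS T s))) =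
        fun s => (g (floorTS T s) * expRatio T 0 w (sigma T (floorTS T s))) *
          expRatio T w z (sigma T (floorTS T s)) := by
      ext s
      rw [hT.expRatio_eq_div hw0.le hz0, mul_assoc]
    rw [e]
    refine hT.norm_integral_mul_expRatio_le hw0.le hz hp h0p hb.1 hpb
      (hT.intervalIntegrable_mul_expRatio_sigma le_rfl hww (hgi' p hp h0p b hb.1 hb.2)) hC hC0
      fun r hr hpr _ => ?_
    have h0r := h0p.trans hpr
    have h2 := hLsub w hww p hp h0p r hr h0r
    rw [← h2]
    calc ‖L w r - L w p‖ ≤ ‖L w r‖ + ‖L w p‖ := norm_sub_le _ _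
      _ ≤ S + S := add_le_add (hS r hr h0r) (hS p hp h0p)
      _ = 2 * S := by ring
  set K : ℂ → ℝ → ℂ := fun z s => expEntire T a z (max (sigma T (floorTS T s)) 0) with hK
  set H : ℂ → ℂ := fun z => ∫ s in Ioc 0 a, g (floorTS T s) * K z s with hH
  have hgI : Integrable (fun s => g (floorTS T s)) (volume.restrict (Ioc 0 a)) :=
    (intervalIntegrable_iff_integrableOn_Ioc_of_le h0a).1 (hgi a ha h0a)
  have hKm : ∀ z, Measurable (K z) := fun z =>
    (hT.measurable_expEntire ha h0a z).comp (hT.measurable_sigma.comp hT.measurable_floor)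
  set B := a + ∑' i, gapWeight T a 0 i with hB
  have hB0 : 0 ≤ B := add_nonneg h0a (tsum_nonneg (hT.gapWeight_nonneg a 0))
  have hKB : ∀ z s, ‖K z s‖ ≤ Real.exp (B * ‖z‖) := fun z s =>
    hT.norm_expEntire_le ha h0a (le_max_right _ _) z
  have hHd : Differentiable ℂ H := differentiable_integral_mul hgI hKm
    (fun s => hT.differentiable_expEntire ha h0a (le_max_right _ _)) hB0 hKB
  set A := ∫ s in Ioc 0 a, ‖g (floorTS T s)‖ with hA
  have hHle : ∀ z M, (∀ s, ‖K z s‖ ≤ M) → ‖H z‖ ≤ A * M := by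
    intro z M hM
    rw [hA, ← integral_mul_const]
    refine norm_integral_le_of_norm_le (hgI.norm.mul_const M) (Eventually.of_forall fun s => ?_)
    rw [norm_mul]
    exact mul_le_mul_of_nonneg_left (hM s) (norm_nonneg _)
  -- in the right half-plane `H` is the partial Laplace integral divided by the exponential at `a`
  have hHL : ∀ z : ℂ, 0 ≤ z.re → H z * expRatio T 0 z a = L z a := by
    intro z hz
    simp only [hH, hL]
    rw [intervalIntegral.integral_of_le h0a, ← integral_mul_const,
      integral_Ioc_eq_integral_Ioo, integral_Ioc_eq_integral_Ioo]
    refine setIntegral_congr_fun measurableSet_Ioo fun s hs => ?_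
    have h1 : 0 ≤ sigma T (floorTS T s) := (hT.floor_nonneg s).trans (hT.le_sigma _)
    have h2 := hT.sigma_floor_le ha hs.1.le hs.2
    have h3 := hT.expRatio_eq_mul le_rfl hz (sigma T (floorTS T s)) a
    simp only [Complex.ofReal_zero, rate_zero, sub_zero] at h3
    have h4 : K z s = Complex.exp (∫ u in sigma T (floorTS T s)..a, rate T z u) := by
      simp only [hK]
      rw [max_eq_left h1, hT.expEntire_eq (hT.sigma_mem _) h1 ha h2 hz]
    rw [h3, h4, Complex.exp_neg]
    field_simp [Complex.exp_ne_zero]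
  have hEw : 0 < ‖expRatio T 0 w a‖ := norm_pos_iff.2 (expRatio_ne_zero _ _ _)
  have hHright : ∀ z : ℂ, w ≤ z.re → ∀ C : ℝ, 0 ≤ C →
      (∀ s, ‖rate T z s - rate T w s‖ ≤ C * (rate T z s - rate T w s).re) →
      ‖H z‖ ≤ 2 * S * (1 + C) / ‖expRatio T 0 w a‖ := by
    intro z hz C hC0 hC
    have hz0 := hw0.le.trans hz
    have h1 := htail z hz C hC0 hC a ha h0a
    rw [← hHL z hz0, hT.expRatio_eq_div hw0.le hz0, norm_mul, norm_mul, ← mul_assoc] at h1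
    rw [le_div_iff₀ hEw]
    exact le_of_mul_le_mul_right h1 (norm_pos_iff.2 (expRatio_ne_zero _ _ _))
  have hlin : ∀ z : ℂ, w + 1 ≤ z.re →
      ‖H z‖ ≤ 2 * S * (1 + (1 + w) * (1 + 1 / w)) / ‖expRatio T 0 w a‖ * (1 + ‖z‖) := by
    intro z hz
    have h1 := hHright z (by linarith) (‖z - w‖ * (1 + 1 / w)) (by positivity)
      (hT.norm_rate_sub_le hw0 hz)
    rw [div_mul_eq_mul_div]
    refine h1.trans ?_
    gcongr ?_ / _
    have h2 : ‖z - w‖ ≤ (1 + w) * (1 + ‖z‖) := by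
      have h3 := norm_sub_le z w
      rw [Complex.norm_of_nonneg hw0.le] at h3
      nlinarith [norm_nonneg z]
    have h4 : 0 ≤ 1 + 1 / w := by positivity
    have h5 : 1 + ‖z - w‖ * (1 + 1 / w) ≤ (1 + (1 + w) * (1 + 1 / w)) * (1 + ‖z‖) := by
      nlinarith [mul_le_mul_of_nonneg_right h2 h4, norm_nonneg z]
    calc 2 * S * (1 + ‖z - w‖ * (1 + 1 / w)) ≤
        2 * S * ((1 + (1 + w) * (1 + 1 / w)) * (1 + ‖z‖)) :=
          mul_le_mul_of_nonneg_left h5 (by positivity)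
      _ = _ := by ring
  have hHlim : Tendsto (fun x : ℝ => H x) atTop (𝓝 0) := by
    obtain ⟨b, hb, hab⟩ := hT.nonempty_Ioi a
    have hab : a < b := hab
    have h0b := h0a.trans hab.le
    -- `r x t = e_{⊖x}(t, a)`
    set r : ℝ → ℝ → ℂ := fun x t => Complex.exp (-∫ u in a..t, rate T x u) with hr
    have hrE : ∀ x : ℝ, 0 ≤ x → ∀ t, expRatio T 0 x t = expRatio T 0 x a * r x t := by
      intro x hx t
      have := hT.expRatio_eq_mul le_rfl (z := x) (by simpa using hx) a t
      simpa only [Complex.ofReal_zero, rate_zero, sub_zero] using this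
    have hr0 : ∀ t ∈ T, a < t → Tendsto (fun x => r x t) atTop (𝓝 0) := by
      intro t ht hat
      rw [tendsto_zero_iff_norm_tendsto_zero]
      have h1 : Tendsto (fun x : ℝ => (1 + (t - a) * x)⁻¹) atTop (𝓝 0) :=
        tendsto_inv_atTop_zero.comp (tendsto_atTop_add_const_left _ _
          (tendsto_id.const_mul_atTop (by linarith)))
      refine squeeze_zero' (Eventually.of_forall fun _ => norm_nonneg _) ?_ h1
      filter_upwards [eventually_ge_atTop 0] with x hx
      exact hT.norm_exp_neg_integral_rate_le ha h0a ht hat hx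
    have hH_eq : ∀ x : ℝ, w ≤ x → H x = L x b / expRatio T 0 x a -
        ∫ s in a..b, g (floorTS T s) * r x (sigma T (floorTS T s)) := by
      intro x hx
      have hx0 := hw0.le.trans hx
      have hx0' : 0 ≤ (x : ℂ).re := by simpa using hx0
      have hne := expRatio_ne_zero (T := T) 0 x a
      have h1 := hLsub x hx0' a ha h0a b hb h0b
      have e : (fun s => g (floorTS T s) * expRatio T 0 x (sigma T (floorTS T s))) =
          fun s => expRatio T 0 x a * (g (floorTS T s) * r x (sigma T (floorTS T s))) := by
        ext s
        rw [hrE x hx0]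
        ring
      rw [e, intervalIntegral.integral_const_mul] at h1
      have h2 := hHL x hx0'
      field_simp
      linear_combination h2 - h1
    have hlim1 : Tendsto (fun x : ℝ => L x b / expRatio T 0 x a) atTop (𝓝 0) := by
      rw [tendsto_zero_iff_norm_tendsto_zero]
      have h1 : Tendsto (fun x : ℝ => 2 * S * (1 + 1) / ‖expRatio T 0 w b‖ * ‖r x b‖) atTop
          (𝓝 0) := by
        have := ((hr0 b hb hab).norm).const_mul (2 * S * (1 + 1) / ‖expRatio T 0 w b‖)
        rwa [norm_zero, mul_zero] at this
      refine squeeze_zero' (Eventually.of_forall fun _ => norm_nonneg _) ?_ h1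
      filter_upwards [eventually_ge_atTop w] with x hx
      have hx0 := hw0.le.trans hx
      have h2 := htail x (by simpa using hx) 1 zero_le_one
        (fun s => by rw [one_mul]; exact (hT.norm_rate_ofReal_sub hw0.le hx s).le) b hb h0b
      have h3 := hT.expRatio_eq_div hw0.le (z := x) (by simpa using hx0) b
      rw [hrE x hx0] at h3
      have h4 : 0 < ‖expRatio T 0 w b‖ := norm_pos_iff.2 (expRatio_ne_zero _ _ _)
      have h5 : 0 < ‖expRatio T 0 x a‖ := norm_pos_iff.2 (expRatio_ne_zero _ _ _)
      have h6 : ‖expRatio T w x b‖ = ‖expRatio T 0 x a‖ * ‖r x b‖ / ‖expRatio T 0 w b‖ := by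
        rw [eq_div_iff h4.ne', ← norm_mul, ← norm_mul, h3, mul_comm]
      rw [norm_div, div_le_iff₀ h5]
      refine h2.trans (le_of_eq ?_)
      rw [h6]
      ring
    have hlim2 : Tendsto (fun x : ℝ => ∫ s in a..b, g (floorTS T s) *
        r x (sigma T (floorTS T s))) atTop (𝓝 0) := by
      have hgab := hgi' a ha h0a b hb h0b
      have h0 : ∫ s in a..b, (0 : ℂ) = 0 := by simp
      rw [← h0]
      refine intervalIntegral.tendsto_integral_filter_of_dominated_convergence
        (fun s => ‖g (floorTS T s)‖) ?_ ?_ hgab.norm ?_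
      · filter_upwards [eventually_ge_atTop 0] with x hx
        have h1 : (fun s => g (floorTS T s) * r x (sigma T (floorTS T s))) =
            fun s => (expRatio T 0 x a)⁻¹ *
              (g (floorTS T s) * expRatio T 0 x (sigma T (floorTS T s))) := by
          ext s
          rw [hrE x hx (sigma T (floorTS T s)), mul_left_comm,
            inv_mul_cancel_left₀ (expRatio_ne_zero 0 x a)]
        rw [h1]
        exact (intervalIntegrable_iff.1 ((hT.intervalIntegrable_mul_expRatio_sigma (z := x) le_rfl
          (by simpa using hx) hgab).const_mul _)).aestronglyMeasurable
      · filter_upwards [eventually_ge_atTop 0] with x hx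
        refine Eventually.of_forall fun s hs => ?_
        rw [uIoc_of_le hab.le] at hs
        rw [norm_mul]
        refine mul_le_of_le_one_right (norm_nonneg _) ?_
        have h1 : a < sigma T (floorTS T s) :=
          hs.1.trans_le (hT.le_sigma_floor (h0a.trans hs.1.le))
        refine (hT.norm_exp_neg_integral_rate_le ha h0a (hT.sigma_mem _) h1 hx).trans ?_
        refine inv_le_one_of_one_le₀ ?_
        nlinarith
      · refine Eventually.of_forall fun s hs => ?_
        rw [uIoc_of_le hab.le] at hs
        have h1 : a < sigma T (floorTS T s) :=
          hs.1.trans_le (hT.le_sigma_floor (h0a.trans hs.1.le))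
        have := (hr0 _ (hT.sigma_mem _) h1).const_mul (g (floorTS T s))
        rwa [mul_zero] at this
    have := hlim1.sub hlim2
    rw [sub_zero] at this
    refine this.congr' ?_
    filter_upwards [eventually_ge_atTop w] with x hx
    exact (hH_eq x hx).symm
  have hH0 := eq_zero_of_subexponential hHd hB0 (fun z => hHle z _ (hKB z)) (fun ε hε => by
    obtain ⟨C, hC0, hC⟩ := hT.exists_norm_expEntire_neg_le ha h0a hε
    refine ⟨A * C, fun x hx => ?_⟩
    rw [mul_assoc]
    exact hHle (-x) _ fun s => hC _ x (le_max_right _ _) hx)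
    (show 0 ≤ w + 1 by linarith) hlin hHlim 0
  simp only [hH, hK, expEntire_zero, mul_one] at hH0
  rwa [intervalIntegral.integral_of_le h0a]

/-- A transformable function with vanishing Laplace transform vanishes `Δ`-almost everywhere. -/
theorem ae_eq_zero_of_laplace_eq_zero (hT : IsTimeScale T) {g : ℝ → ℂ} {c : ℝ}
    (hg : ∀ b : ℝ, IntegrableOn g (Ico 0 b) (deltaMeasure T))
    (hlim : ∀ z : ℂ, c < z.re → Tendsto (laplacePartial T g z) (atTop ⊓ 𝓟 T) (𝓝 0)) :
    ∀ᵐ t ∂((deltaMeasure T).restrict (Ici 0)), g t = 0 := by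
  have hzero : ∀ a ∈ T, 0 ≤ a → ∫ s in (0 : ℝ)..a, g (floorTS T s) = 0 := fun a ha h0a =>
    hT.integral_eq_zero_of_laplace_eq_zero hg hlim ha h0a
  have hgi : ∀ r ∈ T, 0 ≤ r → IntervalIntegrable (fun s => g (floorTS T s)) volume 0 r :=
    fun r hr h0 => hT.intervalIntegrable_comp_floor hT.zero_mem le_rfl hr h0 (hg r)
  -- the integral also vanishes up to a point inside a gap, as `g ∘ ρ` is constant on the gap
  have hzero' : ∀ b, 0 ≤ b → ∫ s in (0 : ℝ)..b, g (floorTS T s) = 0 := by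
    intro b h0b
    have hfl := hT.floor_mem b
    have h0fl := hT.floor_nonneg b
    rcases (hT.floor_le h0b).lt_or_eq with h | h
    · have hσ := hT.lt_sigma_floor h
      have hμ : (0 : ℝ) < sigma T (floorTS T b) - floorTS T b := by linarith
      have hconst : ∀ d, floorTS T b ≤ d → d ≤ sigma T (floorTS T b) →
          ∫ s in floorTS T b..d, g (floorTS T s) = (d - floorTS T b : ℝ) * g (floorTS T b) := by
        intro d h1 h2
        rw [← Complex.real_smul, ← intervalIntegral.integral_const,
          intervalIntegral.integral_of_le h1, intervalIntegral.integral_of_le h1,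
          integral_Ioc_eq_integral_Ioo, integral_Ioc_eq_integral_Ioo]
        refine setIntegral_congr_fun measurableSet_Ioo fun s hs => ?_
        rw [hT.floor_eq hfl h0fl hs.1.le (hs.2.trans_le h2)]
      have h0σ := h0b.trans hσ.le
      have hgσ := hgi _ (hT.sigma_mem (floorTS T b)) h0σ
      have h3 := intervalIntegral.integral_interval_sub_left hgσ (hgi _ hfl h0fl)
      rw [hzero _ (hT.sigma_mem _) h0σ, hzero _ hfl h0fl, sub_zero,
        hconst _ (h.trans hσ).le le_rfl] at h3
      have hg0 : g (floorTS T b) = 0 :=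
        (mul_eq_zero.1 h3.symm).resolve_left (by exact_mod_cast hμ.ne')
      have hgb : IntervalIntegrable (fun s => g (floorTS T s)) volume 0 b :=
        hgσ.mono_set (by
          rw [uIcc_of_le h0b, uIcc_of_le h0σ]
          exact Icc_subset_Icc_right hσ.le)
      have h4 := intervalIntegral.integral_interval_sub_left hgb (hgi _ hfl h0fl)
      rw [hzero _ hfl h0fl, sub_zero, hconst _ h.le hσ.le, hg0, mul_zero] at h4
      exact h4
    · rw [← h]
      exact hzero _ hfl h0fl
  have hae : ∀ᵐ s : ℝ, 0 < s → g (floorTS T s) = 0 := by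
    have h1 : ∀ n : ℕ, ∀ᵐ s : ℝ, 0 < s → s < n → g (floorTS T s) = 0 := by
      intro n
      obtain ⟨r, hr, hnr⟩ := hT.nonempty_Ioi (n : ℝ)
      have hnr : (n : ℝ) < r := hnr
      have h0r : 0 ≤ r := (Nat.cast_nonneg n).trans hnr.le
      filter_upwards [(hgi r hr h0r).ae_hasDerivAt_integral] with s hs h0s hsn
      have h2 := hs (by rw [uIcc_of_le h0r]; exact ⟨h0s.le, (hsn.trans hnr).le⟩) 0 left_mem_uIcc
      have h3 : HasDerivAt (fun x => ∫ t in (0 : ℝ)..x, g (floorTS T t)) 0 s := by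
        refine (hasDerivAt_const s (0 : ℂ)).congr_of_eventuallyEq ?_
        filter_upwards [Ioi_mem_nhds h0s] with x hx
        exact hzero' x (le_of_lt hx)
      exact h2.unique h3
    filter_upwards [ae_all_iff.2 h1] with s hs h0s
    obtain ⟨n, hn⟩ := exists_nat_gt s
    exact hs n h0s hn
  have hgm : AEStronglyMeasurable g ((deltaMeasure T).restrict (Ici 0)) := by
    have e : Ici (0 : ℝ) = ⋃ n : ℕ, Ico 0 (n : ℝ) := by
      ext s
      simp only [mem_Ici, mem_iUnion, mem_Ico]
      exact ⟨fun h => (exists_nat_gt s).imp fun n hn => ⟨h, hn⟩, fun ⟨n, h⟩ => h.1⟩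
    rw [e, aestronglyMeasurable_iUnion_iff]
    exact fun n => (hg n).aestronglyMeasurable
  rw [hT.deltaMeasure_restrict] at hgm ⊢
  have h1 := hgm.ae_eq_mk
  have h2 : ∀ᵐ t ∂((volume.restrict (Ici 0)).map (floorTS T)), hgm.mk g t = 0 := by
    have h4 := ae_of_ae_map hT.measurable_floor.aemeasurable h1
    refine (ae_map_iff hT.measurable_floor.aemeasurable
      (hgm.stronglyMeasurable_mk.measurable (measurableSet_singleton 0))).2 ?_
    have h5 : ∀ᵐ s ∂(volume.restrict (Ici (0 : ℝ))), g (floorTS T s) = 0 := by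
      rw [restrict_Ioi_eq_restrict_Ici.symm]
      exact (ae_restrict_iff' measurableSet_Ioi).2 hae
    filter_upwards [h4, h5] with s h6 h7
    rw [← h6, h7]
    exact mem_singleton 0
  filter_upwards [h1, h2] with t h3 h4
  rw [h3, h4]

end IsTimeScale

/-! ### Calculus of inverse Laplace transforms -/

namespace IsTimeScale

/-- Two functions that agree `Δ`-almost everywhere agree at every common point of right-continuity,
as every right neighbourhood of a point of `T` has positive `Δ`-measure. -/
lemma deltaEq_of_ae (hT : IsTimeScale T) {f g : ℝ → ℂ}
    (h : ∀ᵐ t ∂((deltaMeasure T).restrict (Ici 0)), f t = g t) : DeltaEq T f g := by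
  refine ⟨h, fun t ht h0 hf hg => ?_⟩
  rw [hT.deltaMeasure_restrict] at h
  have h1 := (ae_restrict_iff' measurableSet_Ici).1
    (ae_of_ae_map hT.measurable_floor.aemeasurable h)
  have hfreq : ∃ᶠ s in 𝓝[>] t, f (floorTS T s) = g (floorTS T s) := by
    intro hev
    obtain ⟨u, hu, hsub⟩ := mem_nhdsGT_iff_exists_Ioo_subset.1 hev
    have hnull : volume (Ioo t u) = 0 :=
      measure_mono_null (t := {s | ¬(s ∈ Ici 0 → f (floorTS T s) = g (floorTS T s))})
        (fun s hs h2 => hsub hs (h2 (h0.trans hs.1.le))) (ae_iff.1 h1)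
    rw [Real.volume_Ioo, ENNReal.ofReal_eq_zero] at hnull
    linarith [mem_Ioi.1 hu]
  have hfl : Tendsto (floorTS T) (𝓝[>] t) (𝓝[T ∩ Ici t] t) := by
    refine tendsto_nhdsWithin_iff.2
      ⟨(hT.tendsto_floor_right h0 ht).mono_left (nhdsWithin_mono _ Ioi_subset_Ici_self), ?_⟩
    filter_upwards [self_mem_nhdsWithin] with u hu
    exact ⟨hT.floor_mem u, le_floor ht (le_of_lt hu)⟩
  have hlim := (hf.tendsto.comp hfl).sub (hg.tendsto.comp hfl)
  refine sub_eq_zero.1 (isClosed_singleton.mem_of_frequently_of_tendsto ?_ hlim)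
  exact hfreq.mono fun s hs => sub_eq_zero.2 hs

lemma tendsto_laplacePartial_sub (hT : IsTimeScale T) {f g : ℝ → ℂ} {z v w : ℂ} (hz : 0 ≤ z.re)
    (hf : ∀ b : ℝ, IntegrableOn f (Ico 0 b) (deltaMeasure T))
    (hg : ∀ b : ℝ, IntegrableOn g (Ico 0 b) (deltaMeasure T))
    (hfl : Tendsto (laplacePartial T f z) (atTop ⊓ 𝓟 T) (𝓝 v))
    (hgl : Tendsto (laplacePartial T g z) (atTop ⊓ 𝓟 T) (𝓝 w)) :
    Tendsto (laplacePartial T (f - g) z) (atTop ⊓ 𝓟 T) (𝓝 (v - w)) := by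
  refine (hfl.sub hgl).congr' ?_
  filter_upwards [eventually_atTop_inf T] with b hb
  rw [hT.laplacePartial_eq hz hb.1 hb.2 (hf b), hT.laplacePartial_eq hz hb.1 hb.2 (hg b),
    hT.laplacePartial_eq hz hb.1 hb.2 ((hf b).sub (hg b)), ← intervalIntegral.integral_sub]
  · simp only [Pi.sub_apply, sub_mul]
  · exact hT.intervalIntegrable_mul_expRatio_sigma le_rfl hz
      (hT.intervalIntegrable_comp_floor hT.zero_mem le_rfl hb.1 hb.2 (hf b))
  · exact hT.intervalIntegrable_mul_expRatio_sigma le_rfl hz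
      (hT.intervalIntegrable_comp_floor hT.zero_mem le_rfl hb.1 hb.2 (hg b))

lemma isInvLaplace_sub (hT : IsTimeScale T) {F G : ℂ → ℂ} {f g : ℝ → ℂ}
    (hf : IsInvLaplace T F f) (hg : IsInvLaplace T G g) :
    IsInvLaplace T (fun z => F z - G z) (f - g) := by
  obtain ⟨c₁, h₁⟩ := hf
  obtain ⟨c₂, h₂⟩ := hg
  refine ⟨max 0 (max c₁ c₂), fun z hz => ?_⟩
  rw [max_lt_iff, max_lt_iff] at hz
  obtain ⟨d₁, e₁⟩ := h₁ z hz.2.1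
  obtain ⟨d₂, e₂⟩ := h₂ z hz.2.2
  have hlim := hT.tendsto_laplacePartial_sub hz.1.le d₁.1 d₂.1 (tendsto_laplacePartial d₁)
    (tendsto_laplacePartial d₂)
  rw [e₁, e₂] at hlim
  exact ⟨⟨fun b => (d₁.1 b).sub (d₂.1 b), d₁.2.1, _, hlim⟩, hT.laplace_eq hlim⟩

lemma isInvLaplace_zero (hT : IsTimeScale T) : IsInvLaplace T (fun _ => 0) 0 := by
  refine ⟨0, fun z hz => ?_⟩
  have hi : ∀ b : ℝ, IntegrableOn (0 : ℝ → ℂ) (Ico 0 b) (deltaMeasure T) := fun b =>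
    integrableOn_zero
  have hlim : Tendsto (laplacePartial T 0 z) (atTop ⊓ 𝓟 T) (𝓝 0) := by
    have : laplacePartial T 0 z = fun _ => 0 := by
      ext b
      simp [laplacePartial, deltaIntegral]
    rw [this]
    exact tendsto_const_nhds
  exact ⟨⟨hi, fun t _ => one_add_mul_ne_zero (hT.graininess_nonneg t) (le_of_lt hz), 0, hlim⟩,
    hT.laplace_eq hlim⟩

lemma isInvLaplace_add (hT : IsTimeScale T) {F G : ℂ → ℂ} {f g : ℝ → ℂ}
    (hf : IsInvLaplace T F f) (hg : IsInvLaplace T G g) :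
    IsInvLaplace T (fun z => F z + G z) (f + g) := by
  have h := hT.isInvLaplace_sub hf (hT.isInvLaplace_sub hT.isInvLaplace_zero hg)
  simpa only [zero_sub, sub_neg_eq_add] using h

end IsTimeScale

lemma IsInvLaplace.congr {F G : ℂ → ℂ} {g : ℝ → ℂ} (h : IsInvLaplace T F g) {c : ℝ}
    (hFG : ∀ z : ℂ, c < z.re → F z = G z) : IsInvLaplace T G g := by
  obtain ⟨c₁, h₁⟩ := h
  refine ⟨max c c₁, fun z hz => ?_⟩
  rw [max_lt_iff] at hz
  exact ⟨(h₁ z hz.2).1, (h₁ z hz.2).2.trans (hFG z hz.1)⟩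

lemma isInvLaplace_congr {F G : ℂ → ℂ} {g : ℝ → ℂ} {c : ℝ}
    (hFG : ∀ z : ℂ, c < z.re → F z = G z) : IsInvLaplace T F g ↔ IsInvLaplace T G g :=
  ⟨fun h => h.congr hFG, fun h => h.congr fun z hz => (hFG z hz).symm⟩

lemma IsInvLaplace.transformable {F : ℂ → ℂ} {g : ℝ → ℂ} (h : IsInvLaplace T F g) :
    LaplaceTransformable T g := h.imp fun _ hc z hz => (hc z hz).1

/-- The fractional derivative of order greater than one and at most two. -/
lemma isFracDeriv_iff_of_le_two {α : ℝ} (h1 : 1 < α) (h2 : α ≤ 2)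
    {f g : ℝ → ℂ} : IsFracDeriv T α f g ↔ LaplaceTransformable T f ∧
      DeltaDifferentiableNearZero T 2 f ∧ ∃ d e, HasInitialValue T f d ∧
      HasInitialValue T (deltaDeriv T f) e ∧
      IsInvLaplace T (fun z => z ^ (α : ℂ) * laplace T f z -
        (d * z ^ ((α - 1 : ℝ) : ℂ) + e * z ^ ((α - 2 : ℝ) : ℂ))) g := by
  have hc : ⌈α⌉₊ = 2 := by
    rw [Nat.ceil_eq_iff two_ne_zero]
    norm_num
    exact ⟨h1, h2⟩
  have hα : α - 1 - 1 = α - 2 := by ring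
  rw [IsFracDeriv, hc]
  simp only [Finset.sum_range_succ, Finset.sum_range_zero, zero_add, Nat.cast_zero, sub_zero,
    Nat.cast_one, hα]
  constructor
  · rintro ⟨hL, hn, d, hd, hi⟩
    exact ⟨hL, hn, d 0, d 1, hd 0 two_pos, hd 1 one_lt_two, hi⟩
  · rintro ⟨hL, hn, d, e, hd, he, hi⟩
    refine ⟨hL, hn, fun k => if k = 0 then d else e, fun k hk => ?_, hi⟩
    rcases (show k = 0 ∨ k = 1 by omega) with rfl | rfl
    · exact hd
    · exact he

lemma ne_zero_of_re_pos {z : ℂ} (hz : 0 < z.re) : z ≠ 0 := by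
  rintro rfl
  simp at hz

lemma cpow_ofReal_mul {z : ℂ} (hz : z ≠ 0) {x y s : ℝ} (h : x + y = s) :
    z ^ (x : ℂ) * z ^ (y : ℂ) = z ^ (s : ℂ) := by
  rw [← h, Complex.ofReal_add, Complex.cpow_add _ _ hz]

lemma cpow_ofReal_mul_self {z : ℂ} (hz : z ≠ 0) {x s : ℝ} (h : x + 1 = s) :
    z ^ (x : ℂ) * z = z ^ (s : ℂ) := by
  rw [← cpow_ofReal_mul hz h, Complex.ofReal_one, Complex.cpow_one]

namespace IsTimeScale

/-- Uniqueness of inverse Laplace transforms. -/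
theorem deltaEq_of_isInvLaplace (hT : IsTimeScale T) {F : ℂ → ℂ} {f g : ℝ → ℂ}
    (hf : IsInvLaplace T F f) (hg : IsInvLaplace T F g) : DeltaEq T f g := by
  obtain ⟨c, h⟩ := hT.isInvLaplace_sub hf hg
  refine hT.deltaEq_of_ae ?_
  have hi : ∀ b : ℝ, IntegrableOn (f - g) (Ico 0 b) (deltaMeasure T) :=
    (h (c + 1 : ℝ) (by rw [Complex.ofReal_re]; linarith)).1.1
  have h0 := hT.ae_eq_zero_of_laplace_eq_zero hi (c := c) fun z hz => by
    have e : laplace T (f - g) z = 0 := (h z hz).2.trans (sub_self _)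
    exact e ▸ tendsto_laplacePartial (h z hz).1
  filter_upwards [h0] with t ht
  exact sub_eq_zero.1 ht

lemma initialValue_unique (hT : IsTimeScale T) {f : ℝ → ℂ} {l m : ℂ}
    (hl : HasInitialValue T f l) (hm : HasInitialValue T f m) : l = m := by
  rcases (hT.le_sigma 0).lt_or_eq with h | h
  · exact (hl.2 h).symm.trans (hm.2 h)
  · have : (𝓝[T ∩ Ioi 0] (0 : ℝ)).NeBot := by
      rw [← mem_closure_iff_nhdsWithin_neBot, Metric.mem_closure_iff]
      intro ε hε
      obtain ⟨r, hr, h1, h2⟩ := hT.exists_mem_Ioo_of_sigma_eq h.symm hε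
      exact ⟨r, ⟨hr, h1⟩, by rwa [dist_comm, Real.dist_eq, sub_zero, abs_of_pos h1]⟩
    exact tendsto_nhds_unique hl.1 hm.1

/-- The fractional derivative of order at most one. -/
lemma isFracDeriv_iff_of_le_one (hT : IsTimeScale T) {α : ℝ} (h0 : 0 < α) (h1 : α ≤ 1)
    {f g : ℝ → ℂ} : IsFracDeriv T α f g ↔ LaplaceTransformable T f ∧
      ∃ d, HasInitialValue T f d ∧ IsInvLaplace T (fun z => z ^ (α : ℂ) * laplace T f z -
        d * z ^ ((α - 1 : ℝ) : ℂ)) g := by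
  have hc : ⌈α⌉₊ = 1 := by
    rw [Nat.ceil_eq_iff one_ne_zero]
    simpa using ⟨h0, h1⟩
  rw [IsFracDeriv, hc]
  simp only [Finset.sum_range_one, Nat.cast_zero, sub_zero]
  constructor
  · rintro ⟨hL, -, d, hd, hi⟩
    exact ⟨hL, d 0, hd 0 one_pos, hi⟩
  · rintro ⟨hL, d, hd, hi⟩
    obtain ⟨b, hb, hσ⟩ := hT.nonempty_Ioi ((sigma T)^[1] 0)
    refine ⟨hL, ⟨b, hb, hσ, fun k hk => absurd hk (by omega)⟩, fun _ => d, fun k hk => ?_, hi⟩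
    obtain rfl : k = 0 := by omega
    exact hd

end IsTimeScale

/-! ### Composition rules -/

lemma isFracIntegral_comp_iff {α β : ℝ} {f g h : ℝ → ℂ}
    (hfg : IsFracIntegral T α f g) : IsFracIntegral T β g h ↔ IsFracIntegral T (α + β) f h := by
  obtain ⟨hf, hg⟩ := hfg
  have htr := hg.transformable
  obtain ⟨c, hc⟩ := hg
  rw [IsFracIntegral, IsFracIntegral, and_iff_right htr, and_iff_right hf]
  refine isInvLaplace_congr (c := max 0 c) fun z hz => ?_
  rw [max_lt_iff] at hz
  rw [(hc z hz.2).2, div_div, cpow_ofReal_mul (ne_zero_of_re_pos hz.1) rfl]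

namespace IsTimeScale

/-- If `G` is the transform of `f^(α)`, then `z ^ β * G(z)` and the boundary term of `f` combine to
the expression on the right, so that existence of `(f^(α))^(β)` becomes a condition on the transform
of `f`. -/
lemma isFracDeriv_comp_iff (hT : IsTimeScale T) {α β : ℝ} (hα : 0 < α) (hα1 : α ≤ 1) (hβ : 0 < β)
    (hβ1 : β ≤ 1) {f g A : ℝ → ℂ} {d g0 : ℂ} (hfg : IsFracDeriv T α f g)
    (hd : HasInitialValue T f d) (hg0 : HasInitialValue T g g0) :
    IsFracDeriv T β g A ↔ IsInvLaplace T (fun z => z ^ ((α + β : ℝ) : ℂ) * laplace T f z -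
      d * z ^ ((α + β - 1 : ℝ) : ℂ) - z ^ ((β - 1 : ℝ) : ℂ) * g0) A := by
  obtain ⟨-, d', hd', hg⟩ := (hT.isFracDeriv_iff_of_le_one hα hα1).1 hfg
  obtain rfl := hT.initialValue_unique hd hd'
  have htr := hg.transformable
  obtain ⟨c, hc⟩ := hg
  have key : IsInvLaplace T (fun z => z ^ (β : ℂ) * laplace T g z - g0 * z ^ ((β - 1 : ℝ) : ℂ)) A ↔
      IsInvLaplace T (fun z => z ^ ((α + β : ℝ) : ℂ) * laplace T f z -
        d * z ^ ((α + β - 1 : ℝ) : ℂ) - z ^ ((β - 1 : ℝ) : ℂ) * g0) A := by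
    refine isInvLaplace_congr (c := max 0 c) fun z hz => ?_
    rw [max_lt_iff] at hz
    have hz0 := ne_zero_of_re_pos hz.1
    rw [(hc z hz.2).2, ← cpow_ofReal_mul hz0 (show β + α = α + β by ring),
      ← cpow_ofReal_mul hz0 (show β + (α - 1) = α + β - 1 by ring)]
    ring
  rw [hT.isFracDeriv_iff_of_le_one hβ hβ1, ← key]
  constructor
  · rintro ⟨-, e, he, hA⟩
    rwa [hT.initialValue_unique he hg0] at hA
  · exact fun hA => ⟨htr, g0, hg0, hA⟩

/-- A function that is `Δ`-differentiable everywhere satisfies the regularity condition near `0` and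
has `f(0⁺) = f(0)`, and the rule for the transform of `f^Δ` turns the order `β` derivative of `f^Δ`
into the order `β + 1` derivative of `f`. -/
lemma isFracDeriv_deltaDeriv_iff (hT : IsTimeScale T) {β : ℝ} (hβ : 0 < β) (hβ1 : β ≤ 1)
    {f h : ℝ → ℂ} (hdiff : ∀ t ∈ T, 0 ≤ t → DeltaDifferentiableAt T f t)
    (hf : LaplaceTransformable T f) (hf' : LaplaceTransformable T (deltaDeriv T f)) :
    IsFracDeriv T β (deltaDeriv T f) h ↔ IsFracDeriv T (β + 1) f h := by
  have hnear : DeltaDifferentiableNearZero T 2 f := by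
    obtain ⟨b, hb, hσ⟩ := hT.nonempty_Ioi ((sigma T)^[2] 0)
    refine ⟨b, hb, hσ, fun k hk t ht ht0 _ _ => ?_⟩
    obtain rfl : k = 0 := by omega
    exact hdiff t ht ht0
  have hf0 : HasInitialValue T f (f 0) :=
    ⟨((hdiff 0 hT.zero_mem le_rfl).hasDeltaDeriv.continuousWithinAt hT.zero_mem).mono
      inter_subset_left, fun _ => rfl⟩
  obtain ⟨c, hc⟩ := hT.exists_laplace_deltaDeriv hdiff hf hf'
  have key (e : ℂ) : IsInvLaplace T (fun z => z ^ (β : ℂ) * laplace T (deltaDeriv T f) z -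
        e * z ^ ((β - 1 : ℝ) : ℂ)) h ↔
      IsInvLaplace T (fun z => z ^ ((β + 1 : ℝ) : ℂ) * laplace T f z -
        (f 0 * z ^ ((β + 1 - 1 : ℝ) : ℂ) + e * z ^ ((β + 1 - 2 : ℝ) : ℂ))) h := by
    refine isInvLaplace_congr (c := max 0 c) fun z hz => ?_
    rw [max_lt_iff] at hz
    rw [hc z hz.2, ← cpow_ofReal_mul_self (ne_zero_of_re_pos hz.1) (rfl : β + 1 = β + 1),
      show β + 1 - 1 = β by ring, show β + 1 - 2 = β - 1 by ring]
    ring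
  rw [hT.isFracDeriv_iff_of_le_one hβ hβ1,
    isFracDeriv_iff_of_le_two (by linarith) (by linarith)]
  constructor
  · rintro ⟨-, e, he, hi⟩
    exact ⟨hf, hnear, f 0, e, hf0, he, (key e).1 hi⟩
  · rintro ⟨-, -, d, e, hd, he, hi⟩
    obtain rfl := hT.initialValue_unique hd hf0
    exact ⟨hf', e, he, (key e).2 hi⟩

end IsTimeScale

end TimeScale

theorem mainTheorem10 (T : Set ℝ) (hT : IsClosed T) (h0 : (0 : ℝ) ∈ T) (hunb : ¬ BddAbove T) :
    -- composition of fractional integrals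
    (∀ α β : ℝ, 0 < α → 0 < β → ∀ f g : ℝ → ℂ, TimeScale.IsFracIntegral T α f g →
      (∀ h : ℝ → ℂ,
        TimeScale.IsFracIntegral T β g h ↔ TimeScale.IsFracIntegral T (α + β) f h) ∧
      (∀ h k : ℝ → ℂ, TimeScale.IsFracIntegral T β g h →
        TimeScale.IsFracIntegral T (α + β) f k → TimeScale.DeltaEq T h k)) ∧
    -- composition of fractional derivatives, total order at most one;
    -- here g = f^(α), g0 = f^(α)(0+), A = (f^(α))^(β), B = f^(α+β), C = the boundary term
    (∀ α β : ℝ, 0 < α → α ≤ 1 → 0 < β → β ≤ 1 → α + β ≤ 1 →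
      ∀ (f g : ℝ → ℂ) (g0 : ℂ), TimeScale.IsFracDeriv T α f g →
        TimeScale.HasInitialValue T g g0 →
        (∀ A B : ℝ → ℂ, TimeScale.IsFracDeriv T β g A → TimeScale.IsFracDeriv T (α + β) f B →
          TimeScale.IsInvLaplace T (fun z => z ^ ((β - 1 : ℝ) : ℂ) * g0) (B - A)) ∧
        (∀ C : ℝ → ℂ, TimeScale.IsInvLaplace T (fun z => z ^ ((β - 1 : ℝ) : ℂ) * g0) C →
          (∀ B : ℝ → ℂ, TimeScale.IsFracDeriv T (α + β) f B →
            TimeScale.IsFracDeriv T β g (B - C)) ∧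
          (∀ A : ℝ → ℂ, TimeScale.IsFracDeriv T β g A →
            TimeScale.IsFracDeriv T (α + β) f (A + C)) ∧
          (∀ A B : ℝ → ℂ, TimeScale.IsFracDeriv T β g A → TimeScale.IsFracDeriv T (α + β) f B →
            TimeScale.DeltaEq T A (B - C)))) ∧
    -- composition of fractional derivatives, total order in (1, 2];
    -- here moreover d = f^Δ(0+), and D is the additional boundary term
    (∀ α β : ℝ, 0 < α → α ≤ 1 → 0 < β → β ≤ 1 → 1 < α + β → α + β ≤ 2 →
      ∀ (f g : ℝ → ℂ) (g0 d : ℂ), TimeScale.IsFracDeriv T α f g →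
        TimeScale.HasInitialValue T g g0 →
        TimeScale.DeltaDifferentiableNearZero T 2 f →
        TimeScale.HasInitialValue T (TimeScale.deltaDeriv T f) d →
        (∀ A B : ℝ → ℂ, TimeScale.IsFracDeriv T β g A → TimeScale.IsFracDeriv T (α + β) f B →
          TimeScale.IsInvLaplace T
            (fun z => z ^ ((β - 1 : ℝ) : ℂ) * g0 - z ^ ((α + β - 2 : ℝ) : ℂ) * d) (B - A)) ∧
        (∀ C D : ℝ → ℂ, TimeScale.IsInvLaplace T (fun z => z ^ ((β - 1 : ℝ) : ℂ) * g0) C →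
          TimeScale.IsInvLaplace T (fun z => z ^ ((α + β - 2 : ℝ) : ℂ) * d) D →
          (∀ B : ℝ → ℂ, TimeScale.IsFracDeriv T (α + β) f B →
            TimeScale.IsFracDeriv T β g (B - C + D)) ∧
          (∀ A : ℝ → ℂ, TimeScale.IsFracDeriv T β g A →
            TimeScale.IsFracDeriv T (α + β) f (A + C - D)) ∧
          (∀ A B : ℝ → ℂ, TimeScale.IsFracDeriv T β g A → TimeScale.IsFracDeriv T (α + β) f B →
            TimeScale.DeltaEq T A (B - C + D)))) ∧
    -- fractional derivative of the delta derivative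
    (∀ β : ℝ, 0 < β → β ≤ 1 → ∀ f : ℝ → ℂ,
      (∀ t ∈ T, 0 ≤ t → TimeScale.DeltaDifferentiableAt T f t) →
      TimeScale.LaplaceTransformable T f →
      TimeScale.LaplaceTransformable T (TimeScale.deltaDeriv T f) →
      (∀ h : ℝ → ℂ, TimeScale.IsFracDeriv T β (TimeScale.deltaDeriv T f) h ↔
        TimeScale.IsFracDeriv T (β + 1) f h) ∧
      (∀ h k : ℝ → ℂ, TimeScale.IsFracDeriv T β (TimeScale.deltaDeriv T f) h →
        TimeScale.IsFracDeriv T (β + 1) f k → TimeScale.DeltaEq T h k)) := by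
  have hT' : TimeScale.IsTimeScale T := ⟨hT, h0, hunb⟩
  refine ⟨fun α β _ _ f g hfg => ⟨fun h => TimeScale.isFracIntegral_comp_iff hfg,
      fun h k hh hk => ?_⟩,
    fun α β hα hα1 hβ hβ1 hαβ f g g0 hfg hg0 => ?_,
    fun α β hα hα1 hβ hβ1 hαβ hαβ2 f g g0 e hfg hg0 hnear he => ?_,
    fun β hβ hβ1 f hdiff hf hf' => ⟨fun h => hT'.isFracDeriv_deltaDeriv_iff hβ hβ1 hdiff hf hf',
      fun h k hh hk => ?_⟩⟩
  · exact hT'.deltaEq_of_isInvLaplace ((TimeScale.isFracIntegral_comp_iff hfg).1 hh).2 hk.2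
  · obtain ⟨hf, d, hd, -⟩ := (hT'.isFracDeriv_iff_of_le_one hα hα1).1 hfg
    have hA (A : ℝ → ℂ) := hT'.isFracDeriv_comp_iff (A := A) hα hα1 hβ hβ1 hfg hd hg0
    have hB (B : ℝ → ℂ) : TimeScale.IsFracDeriv T (α + β) f B ↔
        TimeScale.IsInvLaplace T (fun z => z ^ ((α + β : ℝ) : ℂ) * TimeScale.laplace T f z -
          d * z ^ ((α + β - 1 : ℝ) : ℂ)) B := by
      rw [hT'.isFracDeriv_iff_of_le_one (by linarith) hαβ]
      constructor
      · rintro ⟨-, d', hd', hi⟩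
        rwa [hT'.initialValue_unique hd' hd] at hi
      · exact fun hi => ⟨hf, d, hd, hi⟩
    simp only [hA, hB]
    refine ⟨fun A B hA hB => ?_, fun C hC => ⟨fun B hB => hT'.isInvLaplace_sub hB hC,
      fun A hA => ?_, fun A B hA hB =>
        hT'.deltaEq_of_isInvLaplace hA (hT'.isInvLaplace_sub hB hC)⟩⟩
    · exact (hT'.isInvLaplace_sub hB hA).congr (c := 0) fun z _ => by ring
    · exact (hT'.isInvLaplace_add hA hC).congr (c := 0) fun z _ => by ring
  · obtain ⟨hf, d, hd, -⟩ := (hT'.isFracDeriv_iff_of_le_one hα hα1).1 hfg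
    have hA (A : ℝ → ℂ) := hT'.isFracDeriv_comp_iff (A := A) hα hα1 hβ hβ1 hfg hd hg0
    have hB (B : ℝ → ℂ) : TimeScale.IsFracDeriv T (α + β) f B ↔
        TimeScale.IsInvLaplace T (fun z => z ^ ((α + β : ℝ) : ℂ) * TimeScale.laplace T f z -
          (d * z ^ ((α + β - 1 : ℝ) : ℂ) + e * z ^ ((α + β - 2 : ℝ) : ℂ))) B := by
      rw [TimeScale.isFracDeriv_iff_of_le_two hαβ hαβ2]
      constructor
      · rintro ⟨-, -, d', e', hd', he', hi⟩
        rwa [hT'.initialValue_unique hd' hd, hT'.initialValue_unique he' he] at hi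
      · exact fun hi => ⟨hf, hnear, d, e, hd, he, hi⟩
    simp only [hA, hB]
    have hBCD {B C D : ℝ → ℂ}
        (hB : TimeScale.IsInvLaplace T (fun z => z ^ ((α + β : ℝ) : ℂ) * TimeScale.laplace T f z -
          (d * z ^ ((α + β - 1 : ℝ) : ℂ) + e * z ^ ((α + β - 2 : ℝ) : ℂ))) B)
        (hC : TimeScale.IsInvLaplace T (fun z => z ^ ((β - 1 : ℝ) : ℂ) * g0) C)
        (hD : TimeScale.IsInvLaplace T (fun z => z ^ ((α + β - 2 : ℝ) : ℂ) * e) D) :=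
      (hT'.isInvLaplace_add (hT'.isInvLaplace_sub hB hC) hD).congr (c := 0)
        (G := fun z => z ^ ((α + β : ℝ) : ℂ) * TimeScale.laplace T f z -
          d * z ^ ((α + β - 1 : ℝ) : ℂ) - z ^ ((β - 1 : ℝ) : ℂ) * g0) fun z _ => by ring
    refine ⟨fun A B hA hB => ?_, fun C D hC hD => ⟨fun B hB => hBCD hB hC hD,
      fun A hA => ?_, fun A B hA hB => hT'.deltaEq_of_isInvLaplace hA (hBCD hB hC hD)⟩⟩
    · exact (hT'.isInvLaplace_sub hB hA).congr (c := 0) fun z _ => by ring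
    · exact (hT'.isInvLaplace_sub (hT'.isInvLaplace_add hA hC) hD).congr (c := 0)
        fun z _ => by ring
  · obtain ⟨-, -, d, e, hd, he, hh'⟩ := (TimeScale.isFracDeriv_iff_of_le_two (by linarith)
      (by linarith)).1 ((hT'.isFracDeriv_deltaDeriv_iff hβ hβ1 hdiff hf hf').1 hh)
    obtain ⟨-, -, d', e', hd', he', hk'⟩ := (TimeScale.isFracDeriv_iff_of_le_two (by linarith)
      (by linarith)).1 hk
    obtain rfl := hT'.initialValue_unique hd hd'
    obtain rfl := hT'.initialValue_unique he he'
    exact hT'.deltaEq_of_isInvLaplace hh' hk'
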